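/- Minimum Cost Covering (MCC). An instance consists of $n$ distinct clients $X$ and $m\ge 1$ distinct servers $Y$ (a point may be both) in a metric space, given by the matrix of the distances between the points of $X\cup Y$. A cover is a finite set $\mathcal B$ of balls $B(y,r)$ with $y\in Y$, $r\ge 0$, whose union contains $X$; for $\alpha\ge 1$ its cost is $\sum_{B(y,r)\in\mathcal B} r^{\alpha}$, and $\mathrm{opt}$ denotes the minimum cost of a cover. For $n\ge 2$ let $$L = 1+\log_2\frac{\max_{x\ne x'\in X} d(x,x')}{\min_{x\neq x'\in X} d(x,x')}.$$ Algorithms are programs of a randomized real RAM (unit-cost real arithmetic, comparisons, the operation $x\mapsto x^\alpha$ for $x\ge0$, integer addition, truncated subtraction and multiplication with indirect addressing, recursive procedures, and independent uniform random numbers from $[0,1]$); they receive $\alpha$, $\varepsilon$ and the instance as input. Running times are worst case, over all outcomes of the random numbers. (1) There are a program and an absolute constant $C>0$ such that for all real $\alpha\ge 1$, $\varepsilon>0$ and all instances with $n\ge 2$, $m\ge 1$, the program always halts within $$(mn)^{\left(C\,\frac{\alpha L^2\log_2 n}{\min\{\varepsilon,1\}^2}\right)^{\alpha} L}$$ steps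 and always outputs a cover, and the expected cost of this cover is at most $(1+\varepsilon)\,\mathrm{opt}$. (2) In particular MCC has a quasi-polynomial $(1+\varepsilon)$-approximation: there is a program such that for every $\alpha\ge1$ there is a constant $c>0$ such that for all $\varepsilon>0$ and all instances with $n,m\ge1$, the program always halts within $c\cdot 2^{(\log_2(mn)/\min\{\varepsilon,1\})^{c}}$ steps and always outputs a cover, and the expected cost of this cover is at most $(1+\varepsilon)\,\mathrm{opt}$. -/

import Mathlib

open MeasureTheory
open scoped NNReal

noncomputable section

/-! ## The machine model: a randomised real RAM

Integer memory and real memory are unbounded arrays; programs are built from assignments, sequencing,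
conditionals, loops and calls of (possibly recursive) parameterless procedures. Every assignment,
random draw, test and call costs one step, and so does every node of every evaluated expression.
There are no real constants (only natural-number constants), no rounding of reals to integers,
and no integer division. -/

namespace RealRAM

/-- Memory contents, together with the number of random numbers drawn so far. -/
structure State where
  nat : ℕ → ℕ
  real : ℕ → ℝ
  drawn : ℕ

/-- Integer expressions. `mem e` is the integer cell whose address is the value of `e`;
`sub` is truncated subtraction. -/
inductive NExpr where
  | const (k : ℕ)
  | mem (e : NExpr)
  | add (e f : NExpr)
  | sub (e f : NExpr)
  | mul (e f : NExpr)

/-- Real expressions. `mem e` is the real cell whose address is the value of `e`. The operation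
`pow` raises a non-negative number to the power `α`, the exponent of the cost function. -/
inductive RExpr where
  | mem (e : NExpr)
  | cast (e : NExpr)
  | add (e f : RExpr)
  | sub (e f : RExpr)
  | mul (e f : RExpr)
  | div (e f : RExpr)
  | pow (e : RExpr)

/-- Tests. -/
inductive Test where
  | leN (e f : NExpr)
  | leR (e f : RExpr)
  | not (b : Test)
  | and (b c : Test)

def NExpr.eval (s : State) : NExpr → ℕ
  | const k => k
  | mem e => s.nat (e.eval s)
  | add e f => e.eval s + f.eval s
  | sub e f => e.eval s - f.eval s
  | mul e f => e.eval s * f.eval s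

/-- Number of nodes, which is the evaluation time. -/
def NExpr.size : NExpr → ℕ
  | const _ => 1
  | mem e => e.size + 1
  | add e f => e.size + f.size + 1
  | sub e f => e.size + f.size + 1
  | mul e f => e.size + f.size + 1

/-- Evaluation on the machine whose power operation has exponent `α`; division by zero gives zero,
and a negative base of a power is replaced by zero. -/
def RExpr.eval (α : ℝ) (s : State) : RExpr → ℝ
  | mem e => s.real (e.eval s)
  | cast e => (e.eval s : ℝ)
  | add e f => e.eval α s + f.eval α s
  | sub e f => e.eval α s - f.eval α s
  | mul e f => e.eval α s * f.eval α s
  | div e f => e.eval α s / f.eval α s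
  | pow e => (max (e.eval α s) 0) ^ α

/-- Number of nodes, which is the evaluation time. -/
def RExpr.size : RExpr → ℕ
  | mem e => e.size + 1
  | cast e => e.size + 1
  | add e f => e.size + f.size + 1
  | sub e f => e.size + f.size + 1
  | mul e f => e.size + f.size + 1
  | div e f => e.size + f.size + 1
  | pow e => e.size + 1

def Test.Holds (α : ℝ) (s : State) : Test → Prop
  | leN e f => e.eval s ≤ f.eval s
  | leR e f => e.eval α s ≤ f.eval α s
  | not b => ¬ b.Holds α s
  | and b c => b.Holds α s ∧ c.Holds α s

/-- Number of nodes, which is the evaluation time. -/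
def Test.size : Test → ℕ
  | leN e f => e.size + f.size + 1
  | leR e f => e.size + f.size + 1
  | not b => b.size + 1
  | and b c => b.size + c.size + 1

/-- Statements. `setN a e` writes the value of `e` into the integer cell with address `a`, `setR a e`
does the same in real memory, `draw a` writes a fresh uniform random number from `[0,1]` into the
real cell with address `a`, and `call i` executes the `i`-th procedure. -/
inductive Stmt where
  | skip
  | setN (a e : NExpr)
  | setR (a : NExpr) (e : RExpr)
  | draw (a : NExpr)
  | seq (p q : Stmt)
  | ite (b : Test) (p q : Stmt)
  | while (b : Test) (p : Stmt)
  | call (i : ℕ)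

/-- A program: a main statement and a finite list of procedures that it may call and that
may call each other. -/
structure Program where
  main : Stmt
  procs : List Stmt

/-- An infinite sequence of numbers from `[0,1]`, the source of randomness. -/
abbrev Tape : Type := ℕ → unitInterval

/-- The law of a sequence of independent uniform random numbers from `[0,1]`. -/
def tapeMeasure : Measure Tape := Measure.infinitePi fun _ : ℕ => (volume : Measure unitInterval)

/-- `Exec α ω procs p s t s'`: on the machine with power operation `x ↦ x ^ α` and random numbers
`ω`, the statement `p` started in state `s` halts after exactly `t` steps in state `s'`. -/
inductive Exec (α : ℝ) (ω : Tape) (procs : List Stmt) : Stmt → State → ℕ → State → Prop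
  | skip (s : State) : Exec α ω procs .skip s 1 s
  | setN (a e : NExpr) (s : State) :
      Exec α ω procs (.setN a e) s (a.size + e.size + 1)
        { s with nat := Function.update s.nat (a.eval s) (e.eval s) }
  | setR (a : NExpr) (e : RExpr) (s : State) :
      Exec α ω procs (.setR a e) s (a.size + e.size + 1)
        { s with real := Function.update s.real (a.eval s) (e.eval α s) }
  | draw (a : NExpr) (s : State) :
      Exec α ω procs (.draw a) s (a.size + 1)
        { s with
          real := Function.update s.real (a.eval s) (ω s.drawn : ℝ)
          drawn := s.drawn + 1 }
  | seq {p q : Stmt} {s s₁ s₂ : State} {t u : ℕ} :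
      Exec α ω procs p s t s₁ → Exec α ω procs q s₁ u s₂ →
      Exec α ω procs (.seq p q) s (t + u) s₂
  | ite_true {b : Test} {p q : Stmt} {s s₁ : State} {t : ℕ} :
      b.Holds α s → Exec α ω procs p s t s₁ →
      Exec α ω procs (.ite b p q) s (b.size + t + 1) s₁
  | ite_false {b : Test} {p q : Stmt} {s s₁ : State} {t : ℕ} :
      ¬ b.Holds α s → Exec α ω procs q s t s₁ →
      Exec α ω procs (.ite b p q) s (b.size + t + 1) s₁
  | while_false {b : Test} {p : Stmt} {s : State} :
      ¬ b.Holds α s → Exec α ω procs (.while b p) s (b.size + 1) s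
  | while_true {b : Test} {p : Stmt} {s s₁ s₂ : State} {t u : ℕ} :
      b.Holds α s → Exec α ω procs p s t s₁ → Exec α ω procs (.while b p) s₁ u s₂ →
      Exec α ω procs (.while b p) s (b.size + t + u + 1) s₂
  | call {i : ℕ} {p : Stmt} {s s₁ : State} {t : ℕ} :
      procs[i]? = some p → Exec α ω procs p s t s₁ →
      Exec α ω procs (.call i) s (t + 1) s₁

/-- The program halts on initial state `s` after exactly `t` steps in state `s'`. -/
def Program.HaltsIn (P : Program) (α : ℝ) (ω : Tape) (s : State) (t : ℕ) (s' : State) : Prop :=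
  Exec α ω P.procs P.main s t s'

end RealRAM

/-! ## The Minimum Cost Covering problem -/

/-- An instance of the Minimum Cost Covering problem: `n` distinct clients and `m` distinct servers
in a metric space. A point may be both a client and a server. -/
structure MCCInstance where
  Point : Type
  [metric : MetricSpace Point]
  n : ℕ
  m : ℕ
  client : Fin n ↪ Point
  server : Fin m ↪ Point

attribute [instance] MCCInstance.metric

namespace MCCInstance

variable (I : MCCInstance)

/-- A ball centered at a server, given by its center and its radius. -/
abbrev Ball : Type := Fin I.m × ℝ≥0

variable {I} in
/-- The set of balls `B` contains all clients in its union. -/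
def IsCover (B : Finset I.Ball) : Prop :=
  ∀ i : Fin I.n, ∃ b ∈ B, dist (I.server b.1) (I.client i) ≤ (b.2 : ℝ)

variable {I} in
/-- Sum of the `α`-th powers of the radii. -/
def cost (α : ℝ) (B : Finset I.Ball) : ℝ := ∑ b ∈ B, (b.2 : ℝ) ^ α

/-- The cost of an optimal cover. -/
def opt (α : ℝ) : ℝ := sInf {x : ℝ | ∃ B : Finset I.Ball, IsCover B ∧ cost α B = x}

/-- One plus the binary logarithm of the ratio of the maximum to the minimum distance between two
distinct clients. -/
def L : ℝ :=
  1 + Real.logb 2 (Metric.diam (Set.range I.client) / (Set.range I.client).infsep)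

/-- The clients followed by the servers. -/
def point : Fin (I.n + I.m) → I.Point := Fin.append I.client I.server

/-- Entry `(i, j)` of the distance matrix of the clients followed by the servers
(and zero outside the matrix). -/
def entry (i j : ℕ) : ℝ :=
  if h : i < I.n + I.m ∧ j < I.n + I.m then dist (I.point ⟨i, h.1⟩) (I.point ⟨j, h.2⟩) else 0

/-- The initial state: integer cells `0` and `1` hold `n` and `m`, real cells `0` and `1` hold `α`
and `ε`, and the distance matrix is stored row by row in the real cells from address `2` on.
All other cells are zero. -/
def input (α ε : ℝ) : RealRAM.State where
  nat a := if a = 0 then I.n else if a = 1 then I.m else 0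
  real a :=
    if a = 0 then α else if a = 1 then ε
    else I.entry ((a - 2) / (I.n + I.m)) ((a - 2) % (I.n + I.m))
  drawn := 0

variable {I} in
/-- The state `s` contains the set of balls `B` as output: integer cell `0` holds the length of a list
of balls, the `j`-th of which has its center in integer cell `j + 1` and its radius in
real cell `j`; the balls of this list are exactly those of `B`. -/
def IsOutput (s : RealRAM.State) (B : Finset I.Ball) : Prop :=
  {p : ℕ × ℝ | ∃ b ∈ B, p = ((b.1 : ℕ), (b.2 : ℝ))} =
    {p : ℕ × ℝ | ∃ j < s.nat 0, p = (s.nat (j + 1), s.real j)}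

/-- On input `I`, `α`, `ε`, the randomised program `P` always halts within `T` steps and outputs
a cover, and the expected cost of this cover is at most `1 + ε` times the optimum. -/
def SolvedWithin (P : RealRAM.Program) (α ε T : ℝ) : Prop :=
  ∃ B : RealRAM.Tape → Finset I.Ball,
    (∀ ω : RealRAM.Tape, IsCover (B ω) ∧
      ∃ (t : ℕ) (s : RealRAM.State),
        P.HaltsIn α ω (I.input α ε) t s ∧ (t : ℝ) ≤ T ∧ IsOutput s (B ω)) ∧
    Integrable (fun ω => cost α (B ω)) RealRAM.tapeMeasure ∧
    ∫ ω, cost α (B ω) ∂ RealRAM.tapeMeasure ≤ (1 + ε) * I.opt α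

end MCCInstance

end

/-!
Minimum Cost Covering is solved by a deterministic recursive algorithm `solve`, run with a fixed
recursion depth. At depth zero it covers the given clients by the cheapest single ball (`leaf`). At
positive depth it tries, for every server `y` and client `w`, two moves, and keeps the cheapest of
all solutions found. A cover move buys the ball around `y` through `w` and recurses on the clients
outside of it. A carving move, at scale `δ = d(y, w)`, cuts the clients into clusters, each of which
consists of the remaining clients within distance `2 * i * δ` of a centre, and recurses on every
cluster. Only radii `d(y, w)` matter, since the balls of a cover can be shrunk until a client lies
on their boundary (`exists_pair_cover`).

The index `i` is found by region growing. A ball of radius at most `δ` cannot meet both the cluster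
with index `i` and the remaining clients outside of the cluster with index `i + 1`
(`disjoint_meeting`). If the cost of the cluster with index `i + 1`, as computed by the recursion,
is at most `1 + 1 / q` times that of the cluster with index `i`, up to a share of the total cost
that is proportional to the number of clients, then the clusters can be charged to disjoint sets of
balls. Among `H` indices with `n + 1 ≤ (1 + 1 / q) ^ H` there is such an index `i` (`pick_spec`),
and carving loses a factor of `1 + 2 / q` only (`carve_le`). No random choice of the radius is
needed.

For a set of diameter `D`, call a ball large if its radius exceeds `D / (8 * H)`. If a cover has at
least `(16 * H) ^ α` large balls, then a single ball around one of their servers is at least as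
cheap as they are (`leaf_le_of_many`). Otherwise there are at most `K` of them, which are bought by
cover moves, and carving at the scale of the largest remaining ball leaves clusters of diameter at
most `D / 2`. Hence `K + 1` levels of the recursion halve the diameter (`Bound.double`), and `Λ`
halvings need recursion depth `Λ * (K + 1)` and lose the factor `(1 + 2 / q) ^ Λ`, which is harmless
for `q = 16 * Λ * e` with `1 / e ≤ ε`.

The two programs differ in the choice of `Λ`. In the first one `Λ ≤ L` halvings separate all
clients, and single clients are covered optimally (`solve_le_of_ratio`). In the second one a first
carving, at the scale of the largest radius `R` of an optimal cover, leaves clusters of diameter at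
most `4 * H * R`, and after `O(α + log n + 1 / ε)` halvings the diameter is so small compared to `R`
that single balls are good enough (`solve_le_of_levels`).

The algorithm runs on the machine as a recursive procedure that keeps one frame per recursion depth
(`solveSpec`). A call makes at most `O(m * n² * H)` recursive calls, so the running time is at most
`baseTime n m H ^ (N + 2)` for recursion depth `N` (`totalTime_le`); the claimed bounds follow by
arithmetic (`ratioTime_le`, `levelTime_le`, `exists_quasi`). The program draws no random numbers, so
it behaves in the same way on all tapes (`exec_tape`).
-/

noncomputable section

namespace CoverAlg

/-! ### The recursive algorithm -/

/-- `loop f b N` applies `f 0`, …, `f (N - 1)` in this order, starting from `b`. -/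
def loop {β : Type*} (f : ℕ → β → β) (b : β) : ℕ → β
  | 0 => b
  | i + 1 => f i (loop f b i)

theorem loop_inv {β : Type*} {f : ℕ → β → β} {b : β} {Q : ℕ → β → Prop} (N : ℕ) (h0 : Q 0 b)
    (h : ∀ i < N, ∀ c, Q i c → Q (i + 1) (f i c)) : Q N (loop f b N) := by
  induction N with
  | zero => exact h0
  | succ N ih => exact h N (Nat.lt_succ_self N) _ (ih fun i hi => h i (Nat.lt_succ_of_lt hi))

theorem loop_le {β γ : Type*} [Preorder β] {f : ℕ → β × γ → β × γ} {b : β × γ}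
    (hf : ∀ i c, (f i c).1 ≤ c.1) (N : ℕ) : (loop f b N).1 ≤ b.1 := by
  induction N with
  | zero => exact le_rfl
  | succ N ih => exact (hf _ _).trans ih

theorem loop_le_of_step {β γ : Type*} [Preorder β] {f : ℕ → β × γ → β × γ} {b : β × γ}
    (hf : ∀ i c, (f i c).1 ≤ c.1) {v : β} {j : ℕ}
    (hj : ∀ c, (f j c).1 ≤ v) {N : ℕ} (hN : j < N) : (loop f b N).1 ≤ v := by
  induction N with
  | zero => omega
  | succ N ih =>
    rcases Nat.lt_succ_iff_lt_or_eq.1 hN with h | rfl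
    · exact (hf _ _).trans (ih h)
    · exact hj _

/-- A linear scan for the index `i` that minimises the excess `q * u i - (q + 1) * u (i - 1)` over
`1 ≤ i ≤ N`. The state consists of the last value of `u`, the smallest excess and its index. Scaling
by `q` avoids a division: the excess is `q` times the growth of `u` beyond the factor `1 + 1 / q`.
-/
def scan (u : ℕ → ℝ) (q : ℕ) : ℕ → ℝ × ℝ × ℕ :=
  loop (fun i st =>
    if i = 0 ∨ q * u (i + 1) - (q + 1) * st.1 < st.2.1 then
      (u (i + 1), q * u (i + 1) - (q + 1) * st.1, i + 1)
    else (u (i + 1), st.2.1, st.2.2)) (u 0, 0, 0)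

/-- The scan ends with the last value of the sequence and with an index of smallest excess. -/
theorem scan_spec (u : ℕ → ℝ) (q N : ℕ) :
    (scan u q N).1 = u N ∧ (1 ≤ N → ∃ j, (scan u q N).2.2 = j + 1 ∧ j < N ∧
      (scan u q N).2.1 = q * u (j + 1) - (q + 1) * u j ∧
      ∀ i < N, (scan u q N).2.1 ≤ q * u (i + 1) - (q + 1) * u i) := by
  induction N with
  | zero => simp [scan, loop]
  | succ N ih =>
    have hs : scan u q (N + 1) = (if N = 0 ∨
        q * u (N + 1) - (q + 1) * (scan u q N).1 < (scan u q N).2.1 then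
      (u (N + 1), q * u (N + 1) - (q + 1) * (scan u q N).1, N + 1)
    else (u (N + 1), (scan u q N).2.1, (scan u q N).2.2)) := rfl
    obtain ⟨h1, h2⟩ := ih
    rw [hs, h1]
    split_ifs with hc
    · refine ⟨rfl, fun _ => ⟨N, rfl, N.lt_succ_self, rfl, fun i hi => ?_⟩⟩
      rcases Nat.lt_succ_iff_lt_or_eq.1 hi with hi' | rfl
      · rcases hc with rfl | hc
        · omega
        · obtain ⟨j, -, -, -, h6⟩ := h2 (by omega)
          exact hc.le.trans (h6 i hi')
      · exact le_rfl
    · push Not at hc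
      obtain ⟨j, h3, h4, h5, h6⟩ := h2 (by omega)
      refine ⟨rfl, fun _ => ⟨j, h3, by omega, h5, fun i hi => ?_⟩⟩
      rcases Nat.lt_succ_iff_lt_or_eq.1 hi with hi' | rfl
      · exact h6 i hi'
      · exact hc.2

/-- The index chosen by the scan over `u 0`, …, `u H`. -/
def pick (u : ℕ → ℝ) (q H : ℕ) : ℕ := (scan u q H).2.2

/-- Among the values `u 0`, …, `u H`, the sequence `u + s` grows by a factor of at most `1 + 1 / q`
at the chosen index, provided that it cannot grow by this factor all the time. The choice is made
without knowledge of `s`, because minimising the excess works for all `s` at once. -/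
theorem pick_spec {u : ℕ → ℝ} {q H : ℕ} {s : ℝ} (hq : 0 < q) (hH : 1 ≤ H) (h0 : 0 ≤ u 0)
    (hu : u H + s ≤ (1 + 1 / (q : ℝ)) ^ H * s) :
    ∃ j < H, pick u q H = j + 1 ∧ u (j + 1) ≤ (1 + 1 / (q : ℝ)) * u j + 1 / (q : ℝ) * s := by
  have hq' : (0 : ℝ) < q := by exact_mod_cast hq
  obtain ⟨j, h1, h2, h3, h4⟩ := (scan_spec u q H).2 hH
  refine ⟨j, h2, h1, ?_⟩
  by_contra hc
  have key : ∀ i < H, (1 + 1 / (q : ℝ)) * (u i + s) < u (i + 1) + s := by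
    intro i hi
    have h5 := h4 i hi
    rw [h3] at h5
    have h6 : s < q * u (j + 1) - (q + 1) * u j := by
      push Not at hc
      have := mul_lt_mul_of_pos_left hc hq'
      have e : (q : ℝ) * ((1 + 1 / (q : ℝ)) * u j + 1 / (q : ℝ) * s) = (q + 1) * u j + s := by
        field_simp
      linarith
    have h7 : s < q * u (i + 1) - (q + 1) * u i := h6.trans_le h5
    have e : (1 + 1 / (q : ℝ)) * (u i + s) = ((q + 1) * u i + s) / q + s := by
      field_simp
      ring
    rw [e]
    have : ((q + 1) * u i + s) / q < u (i + 1) := by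
      rw [div_lt_iff₀ hq']
      linarith
    linarith
  have key2 : ∀ i ≤ H, (1 + 1 / (q : ℝ)) ^ i * (u 0 + s) ≤ u i + s := by
    intro i
    induction i with
    | zero => simp
    | succ i ih =>
      intro hi
      have h5 := ih (by omega)
      have h6 := (key i (by omega)).le
      refine le_trans ?_ h6
      rw [pow_succ', mul_assoc]
      gcongr
  obtain ⟨H', rfl⟩ : ∃ H', H = H' + 1 := ⟨H - 1, by omega⟩
  have h5 := key H' (by omega)
  have h6 := key2 H' (by omega)
  have h7 : (1 + 1 / (q : ℝ)) ^ (H' + 1) * (u 0 + s) ≤ (1 + 1 / (q : ℝ)) * (u H' + s) := by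
    rw [pow_succ', mul_assoc]
    gcongr
  have h8 : (1 + 1 / (q : ℝ)) ^ (H' + 1) * s ≤ (1 + 1 / (q : ℝ)) ^ (H' + 1) * (u 0 + s) := by
    gcongr
    linarith
  linarith

section Algorithm

variable (I : MCCInstance) (α : ℝ) (H q : ℕ)

/-- Distance between the `y`-th server and the `x`-th client. -/
def sd (y x : ℕ) : ℝ := I.entry (I.n + y) x

/-- A client in `S` that is farthest from the server `y`, with its distance; `(0, 0)` if `S` is
empty. -/
def far (S : Finset ℕ) (y : ℕ) : ℝ × ℕ :=
  loop (fun x st => if x ∈ S ∧ st.1 ≤ sd I y x then (sd I y x, x) else st) (0, 0) I.n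

/-- The cheapest single ball that covers `S`: cost, server, and client on its boundary. -/
def leaf (S : Finset ℕ) : ℝ × ℕ × ℕ :=
  loop (fun y st => if y = 0 ∨ (far I S y).1 ^ α < st.1 then
    ((far I S y).1 ^ α, y, (far I S y).2) else st) (0, 0, 0) I.m

/-- The clients in `R` within distance `t` of the client `x`. -/
def near (x : ℕ) (t : ℝ) (R : Finset ℕ) : Finset ℕ := R.filter fun z => I.entry x z ≤ t

/-- One step of the carving procedure at the client `x`, with the solver `g` for the clusters. -/
def carveStep (g : Finset ℕ → ℝ × (ℕ → ℕ × ℕ)) (δ : ℝ) (x : ℕ)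
    (st : Finset ℕ × ℝ × (ℕ → ℕ × ℕ)) : Finset ℕ × ℝ × (ℕ → ℕ × ℕ) :=
  if x ∈ st.1 then
    let P := near I x (2 * (pick (fun i => (g (near I x (2 * (i : ℝ) * δ) st.1)).1) q H : ℝ) * δ)
      st.1
    (st.1 \ P, st.2.1 + (g P).1, fun z => if z ∈ P then (g P).2 z else st.2.2 z)
  else st

/-- Carve `S` into clusters, each of which consists of the remaining clients in a ball of radius
`2 * i * δ` around the first remaining client, and solve every cluster with `g`. The number `i` is
chosen so that the cost grows little from radius `2 * (i - 1) * δ` to radius `2 * i * δ`. -/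
def carve (g : Finset ℕ → ℝ × (ℕ → ℕ × ℕ)) (δ : ℝ) (S : Finset ℕ) :
    Finset ℕ × ℝ × (ℕ → ℕ × ℕ) :=
  loop (carveStep I H q g δ) (S, 0, fun _ => (0, 0)) I.n

/-- Keep the cheaper one of two solutions. -/
def better (c acc : ℝ × (ℕ → ℕ × ℕ)) : ℝ × (ℕ → ℕ × ℕ) := if c.1 < acc.1 then c else acc

/-- Buy the ball around server `y` with client `w` on its boundary, and solve the rest with `g`. -/
def coverCand (g : Finset ℕ → ℝ × (ℕ → ℕ × ℕ)) (S : Finset ℕ) (y w : ℕ) : ℝ × (ℕ → ℕ × ℕ) :=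
  let r := g (S.filter fun x => ¬ sd I y x ≤ sd I y w)
  (sd I y w ^ α + r.1, fun x => if sd I y x ≤ sd I y w then (y, w) else r.2 x)

/-- Try both moves for the server `y` and the client `w`. -/
def tryPair (g : Finset ℕ → ℝ × (ℕ → ℕ × ℕ)) (S : Finset ℕ) (y w : ℕ)
    (acc : ℝ × (ℕ → ℕ × ℕ)) : ℝ × (ℕ → ℕ × ℕ) :=
  better (carve I H q g (sd I y w) S).2 (better (coverCand I α g S y w) acc)

/-- The recursive algorithm with recursion depth `k`. It returns the cost of a set of balls covering
`S` and assigns to each client in `S` a ball containing it, encoded by its server and a client on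
its boundary. -/
def solve : ℕ → Finset ℕ → ℝ × (ℕ → ℕ × ℕ)
  | 0, S => ((leaf I α S).1, fun _ => (leaf I α S).2)
  | k + 1, S => loop (fun y acc => loop (fun w acc => tryPair I α H q (solve k) S y w acc) acc I.n)
      (solve k S) I.m

/-- The assignment `r.2` covers the clients in `S` by balls of total cost at most `r.1`. -/
def Valid (S : Finset ℕ) (r : ℝ × (ℕ → ℕ × ℕ)) : Prop :=
  (∀ x ∈ S, (r.2 x).1 < I.m ∧ (r.2 x).2 < I.n ∧ sd I (r.2 x).1 x ≤ sd I (r.2 x).1 (r.2 x).2) ∧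
    ∑ p ∈ S.image r.2, sd I p.1 p.2 ^ α ≤ r.1

/-- The set of pairs `𝓑` (server, client on the boundary) describes balls that cover `S`. -/
def Covers (𝓑 : Finset (ℕ × ℕ)) (S : Finset ℕ) : Prop :=
  ∀ x ∈ S, ∃ p ∈ 𝓑, sd I p.1 x ≤ sd I p.1 p.2

/-- The cost of the balls described by `𝓑`. -/
def pairCost (𝓑 : Finset (ℕ × ℕ)) : ℝ := ∑ p ∈ 𝓑, sd I p.1 p.2 ^ α

/-- On sets of diameter at most `D`, recursion depth `k` guarantees an approximation factor `G` and
an additional error of at most `h` per client. -/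
def Bound (k : ℕ) (D G h : ℝ) : Prop :=
  ∀ S ⊆ Finset.range I.n, (∀ x ∈ S, ∀ x' ∈ S, I.entry x x' ≤ D) →
    ∀ 𝓑 ⊆ Finset.range I.m ×ˢ Finset.range I.n, Covers I 𝓑 S →
      (solve I α H q k S).1 ≤ G * pairCost I α 𝓑 + h * S.card

end Algorithm

/-! ### Distances of an instance -/

section Metric

variable (I : MCCInstance)

theorem entry_eq {i j : ℕ} (hi : i < I.n + I.m) (hj : j < I.n + I.m) :
    I.entry i j = dist (I.point ⟨i, hi⟩) (I.point ⟨j, hj⟩) := by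
  simp [MCCInstance.entry, hi, hj]

theorem entry_nonneg (i j : ℕ) : 0 ≤ I.entry i j := by
  unfold MCCInstance.entry
  split_ifs
  · exact dist_nonneg
  · exact le_rfl

theorem entry_comm (i j : ℕ) : I.entry i j = I.entry j i := by
  unfold MCCInstance.entry
  by_cases h : i < I.n + I.m ∧ j < I.n + I.m
  · rw [dif_pos h, dif_pos h.symm, dist_comm]
  · rw [dif_neg h, dif_neg fun h' => h h'.symm]

theorem entry_self (i : ℕ) : I.entry i i = 0 := by
  unfold MCCInstance.entry
  split_ifs <;> simp

theorem entry_triangle {i j l : ℕ} (hi : i < I.n + I.m) (hj : j < I.n + I.m)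
    (hl : l < I.n + I.m) : I.entry i l ≤ I.entry i j + I.entry j l := by
  rw [entry_eq I hi hj, entry_eq I hj hl, entry_eq I hi hl]
  exact dist_triangle _ _ _

theorem sd_nonneg (y x : ℕ) : 0 ≤ sd I y x := entry_nonneg I _ _

theorem sd_le_add {y x x' : ℕ} (hy : y < I.m) (hx : x < I.n) (hx' : x' < I.n) :
    sd I y x' ≤ sd I y x + I.entry x x' :=
  entry_triangle I (by omega) (by omega) (by omega)

theorem entry_le_sd_add {y x x' : ℕ} (hy : y < I.m) (hx : x < I.n) (hx' : x' < I.n) :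
    I.entry x x' ≤ sd I y x + sd I y x' := by
  have := entry_triangle I (i := x) (j := I.n + y) (l := x') (by omega) (by omega) (by omega)
  rwa [entry_comm I x (I.n + y)] at this

theorem entry_client {x x' : ℕ} (hx : x < I.n) (hx' : x' < I.n) :
    I.entry x x' = dist (I.client ⟨x, hx⟩) (I.client ⟨x', hx'⟩) := by
  rw [entry_eq I (by omega) (by omega)]
  have h : ∀ x (hx : x < I.n), I.point ⟨x, by omega⟩ = I.client ⟨x, hx⟩ := fun x hx =>
    Fin.append_left I.client I.server ⟨x, hx⟩
  rw [h x hx, h x' hx']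

theorem sd_eq {y x : ℕ} (hy : y < I.m) (hx : x < I.n) :
    sd I y x = dist (I.server ⟨y, hy⟩) (I.client ⟨x, hx⟩) := by
  unfold sd
  rw [entry_eq I (by omega) (by omega)]
  have h : I.point ⟨x, by omega⟩ = I.client ⟨x, hx⟩ :=
    Fin.append_left I.client I.server ⟨x, hx⟩
  have h' : I.point ⟨I.n + y, by omega⟩ = I.server ⟨y, hy⟩ :=
    Fin.append_right I.client I.server ⟨y, hy⟩
  rw [h, h']

end Metric

/-! ### Covering by a single ball -/

section Leaf

variable {I : MCCInstance} {α : ℝ}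

theorem far_spec {S : Finset ℕ} (hS : S ⊆ Finset.range I.n) (y : ℕ) :
    (∀ x ∈ S, sd I y x ≤ (far I S y).1) ∧ (S = ∅ → far I S y = (0, 0)) ∧
      (S.Nonempty → (far I S y).2 ∈ S ∧ (far I S y).1 = sd I y (far I S y).2) := by
  have := loop_inv (f := fun x (st : ℝ × ℕ) =>
      if x ∈ S ∧ st.1 ≤ sd I y x then (sd I y x, x) else st) (b := ((0 : ℝ), 0))
    (Q := fun N st => (∀ x ∈ S, x < N → sd I y x ≤ st.1) ∧
      ((st = (0, 0) ∧ ∀ x ∈ S, ¬ x < N) ∨ (st.2 ∈ S ∧ st.1 = sd I y st.2))) I.n (by simp)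
    (by
      rintro i - ⟨r, w⟩ ⟨h1, h2⟩
      dsimp only at h1 h2 ⊢
      split_ifs with hc
      · refine ⟨fun x hx hi => ?_, Or.inr ⟨hc.1, rfl⟩⟩
        rcases Nat.lt_succ_iff_lt_or_eq.1 hi with hi' | rfl
        · exact (h1 x hx hi').trans hc.2
        · exact le_rfl
      · refine ⟨fun x hx hi => ?_, ?_⟩
        · rcases Nat.lt_succ_iff_lt_or_eq.1 hi with hi' | rfl
          · exact h1 x hx hi'
          · by_contra h
            exact hc ⟨hx, (not_le.1 h).le⟩
        · rcases h2 with ⟨h2, h3⟩ | h2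
          · refine Or.inl ⟨h2, fun x hx hi => ?_⟩
            rcases Nat.lt_succ_iff_lt_or_eq.1 hi with hi' | rfl
            · exact h3 x hx hi'
            · refine hc ⟨hx, ?_⟩
              rw [show r = 0 from (Prod.ext_iff.1 h2).1]
              exact sd_nonneg I y x
          · exact Or.inr h2)
  obtain ⟨h1, h2⟩ := this
  change (∀ x ∈ S, x < I.n → sd I y x ≤ (far I S y).1) at h1
  change (far I S y = (0, 0) ∧ _) ∨ ((far I S y).2 ∈ S ∧ (far I S y).1 = _) at h2
  refine ⟨fun x hx => h1 x hx (Finset.mem_range.1 (hS hx)), ?_, ?_⟩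
  · rintro rfl
    simpa using h2
  · rintro ⟨x, hx⟩
    rcases h2 with ⟨-, h2⟩ | h2
    · exact absurd (Finset.mem_range.1 (hS hx)) (h2 x hx)
    · exact h2

theorem far_nonneg {S : Finset ℕ} (hS : S ⊆ Finset.range I.n) (y : ℕ) : 0 ≤ (far I S y).1 := by
  rcases S.eq_empty_or_nonempty with h | h
  · rw [(far_spec hS y).2.1 h]
  · rw [((far_spec hS y).2.2 h).2]
    exact sd_nonneg I _ _

theorem leaf_spec (S : Finset ℕ) (hm : 1 ≤ I.m) :
    (leaf I α S).2.1 < I.m ∧ (leaf I α S).1 = (far I S (leaf I α S).2.1).1 ^ α ∧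
      (leaf I α S).2.2 = (far I S (leaf I α S).2.1).2 ∧
      ∀ y < I.m, (leaf I α S).1 ≤ (far I S y).1 ^ α := by
  have := loop_inv (f := fun y (st : ℝ × ℕ × ℕ) => if y = 0 ∨ (far I S y).1 ^ α < st.1 then
    ((far I S y).1 ^ α, y, (far I S y).2) else st) (b := ((0 : ℝ), 0, 0))
    (Q := fun N st => N = 0 ∨ (st.2.1 < N ∧ st.1 = (far I S st.2.1).1 ^ α ∧
      st.2.2 = (far I S st.2.1).2 ∧ ∀ y < N, st.1 ≤ (far I S y).1 ^ α)) I.m (by simp)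
    (by
      rintro i - ⟨r, y, w⟩ h
      right
      dsimp only at h ⊢
      split_ifs with hc
      · refine ⟨i.lt_succ_self, rfl, rfl, fun y hy => ?_⟩
        rcases Nat.lt_succ_iff_lt_or_eq.1 hy with hi' | rfl
        · rcases h with rfl | h
          · omega
          · rcases hc with rfl | hc
            · omega
            · exact hc.le.trans (h.2.2.2 y hi')
        · exact le_rfl
      · push Not at hc
        rcases h with rfl | h
        · exact absurd rfl hc.1
        · refine ⟨h.1.trans i.lt_succ_self, h.2.1, h.2.2.1, fun y hy => ?_⟩
          rcases Nat.lt_succ_iff_lt_or_eq.1 hy with hi' | rfl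
          · exact h.2.2.2 y hi'
          · exact hc.2)
  rcases this with h | h
  · omega
  · exact h

theorem leaf_valid {S : Finset ℕ} (hS : S ⊆ Finset.range I.n) (hm : 1 ≤ I.m) :
    Valid I α S ((leaf I α S).1, fun _ => (leaf I α S).2) := by
  obtain ⟨h1, h2, h3, -⟩ := leaf_spec (α := α) S hm
  have h4 := far_spec hS (leaf I α S).2.1
  rcases S.eq_empty_or_nonempty with rfl | hne
  · refine ⟨by simp, ?_⟩
    simp only [Finset.image_empty, Finset.sum_empty]
    rw [h2]
    exact Real.rpow_nonneg (far_nonneg hS _) _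
  · obtain ⟨h5, h6⟩ := h4.2.2 hne
    refine ⟨fun x hx => ⟨h1, ?_, ?_⟩, ?_⟩
    · rw [h3]
      exact Finset.mem_range.1 (hS h5)
    · dsimp only
      rw [h3, ← h6]
      exact h4.1 x hx
    · dsimp only
      rw [Finset.image_const hne, Finset.sum_singleton, h2, h3, h6]

theorem leaf_le {S : Finset ℕ} (hα : 1 ≤ α) (hS : S ⊆ Finset.range I.n) (hm : 1 ≤ I.m) {y : ℕ}
    (hy : y < I.m) {r : ℝ} (hr : 0 ≤ r) (h : ∀ x ∈ S, sd I y x ≤ r) :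
    (leaf I α S).1 ≤ r ^ α := by
  refine ((leaf_spec S hm).2.2.2 y hy).trans (Real.rpow_le_rpow (far_nonneg hS y) ?_ (by linarith))
  rcases S.eq_empty_or_nonempty with h' | h'
  · rw [(far_spec hS y).2.1 h']
    exact hr
  · obtain ⟨h5, h6⟩ := (far_spec hS y).2.2 h'
    rw [h6]
    exact h _ h5

end Leaf

/-! ### Moves of the algorithm, and validity of its output -/

section Solve

variable {I : MCCInstance} {α : ℝ} {H q : ℕ}

theorem better_le_left (c acc : ℝ × (ℕ → ℕ × ℕ)) : (better c acc).1 ≤ c.1 := by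
  unfold better
  split_ifs with h
  · exact le_rfl
  · exact not_lt.1 h

theorem better_le_right (c acc : ℝ × (ℕ → ℕ × ℕ)) : (better c acc).1 ≤ acc.1 := by
  unfold better
  split_ifs with h
  · exact h.le
  · exact le_rfl

theorem solve_loop_le (g : Finset ℕ → ℝ × (ℕ → ℕ × ℕ)) (S : Finset ℕ) (y : ℕ)
    (acc : ℝ × (ℕ → ℕ × ℕ)) :
    (loop (fun w acc => tryPair I α H q g S y w acc) acc I.n).1 ≤ acc.1 :=
  loop_le (fun _ _ => (better_le_right _ _).trans (better_le_right _ _)) _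

theorem solve_succ_le (k : ℕ) (S : Finset ℕ) :
    (solve I α H q (k + 1) S).1 ≤ (solve I α H q k S).1 :=
  loop_le (fun _ _ => solve_loop_le _ _ _ _) _

/-- A larger recursion depth never hurts, since the solution of the smaller depth is a candidate. -/
theorem solve_anti {k k' : ℕ} (h : k ≤ k') (S : Finset ℕ) :
    (solve I α H q k' S).1 ≤ (solve I α H q k S).1 := by
  induction h with
  | refl => exact le_rfl
  | step _ ih => exact (solve_succ_le _ _).trans ih

theorem solve_le_tryPair (k : ℕ) (S : Finset ℕ) {y w : ℕ} (hy : y < I.m) (hw : w < I.n) {v : ℝ}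
    (h : ∀ acc, (tryPair I α H q (solve I α H q k) S y w acc).1 ≤ v) :
    (solve I α H q (k + 1) S).1 ≤ v := by
  rw [solve]
  refine loop_le_of_step (fun _ _ => solve_loop_le _ _ _ _) (j := y) (fun acc => ?_) hy
  exact loop_le_of_step (f := fun w acc => tryPair I α H q (solve I α H q k) S y w acc)
    (fun _ _ => (better_le_right _ _).trans (better_le_right _ _)) (j := w) h hw

theorem solve_le_cover (k : ℕ) (S : Finset ℕ) {y w : ℕ} (hy : y < I.m) (hw : w < I.n) :
    (solve I α H q (k + 1) S).1 ≤ sd I y w ^ α +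
      (solve I α H q k (S.filter fun x => ¬ sd I y x ≤ sd I y w)).1 :=
  solve_le_tryPair k S hy hw fun _ => (better_le_right _ _).trans (better_le_left _ _)

theorem solve_le_carve (k : ℕ) (S : Finset ℕ) {y w : ℕ} (hy : y < I.m) (hw : w < I.n) :
    (solve I α H q (k + 1) S).1 ≤ (carve I H q (solve I α H q k) (sd I y w) S).2.1 :=
  solve_le_tryPair k S hy hw fun _ => better_le_left _ _

theorem self_mem_near {x : ℕ} {t : ℝ} {R : Finset ℕ} (hx : x ∈ R) (ht : 0 ≤ t) :
    x ∈ near I x t R := by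
  simp [near, hx, entry_self, ht]

theorem near_subset (x : ℕ) (t : ℝ) (R : Finset ℕ) : near I x t R ⊆ R := Finset.filter_subset _ _

/-- Solutions of two sets of clients combine to a solution of their union. A ball that is used in
both of them is paid twice, hence the inequality in `Valid`. -/
theorem valid_union {S T : Finset ℕ} {r : ℝ × (ℕ → ℕ × ℕ)} {s : ℝ × (ℕ → ℕ × ℕ)}
    (hr : Valid I α S r) (hs : Valid I α T s) (f : ℕ → ℕ × ℕ) (hf : ∀ x ∈ S, f x = r.2 x)
    (hf' : ∀ x ∈ T, f x = s.2 x) : Valid I α (S ∪ T) (r.1 + s.1, f) := by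
  classical
  constructor
  · intro x hx
    rcases Finset.mem_union.1 hx with h | h
    · have := hr.1 x h
      rwa [← hf x h] at this
    · have := hs.1 x h
      rwa [← hf' x h] at this
  · dsimp only
    rw [Finset.image_union, Finset.image_congr (g := r.2) (fun x hx => hf x hx),
      Finset.image_congr (g := s.2) (s := T) (fun x hx => hf' x hx)]
    have := Finset.sum_union_inter (s₁ := S.image r.2) (s₂ := T.image s.2)
      (f := fun p : ℕ × ℕ => sd I p.1 p.2 ^ α)
    have h0 : 0 ≤ ∑ p ∈ S.image r.2 ∩ T.image s.2, sd I p.1 p.2 ^ α :=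
      Finset.sum_nonneg fun p _ => Real.rpow_nonneg (sd_nonneg I _ _) _
    linarith [hr.2, hs.2]

/-- Carving exhausts all clients, because the centre of a carving step belongs to its cluster, and
it preserves validity. -/
theorem carve_inv {g : Finset ℕ → ℝ × (ℕ → ℕ × ℕ)} {δ : ℝ} (hδ : 0 ≤ δ) {S : Finset ℕ}
    (hS : S ⊆ Finset.range I.n) :
    (carve I H q g δ S).1 = ∅ ∧ ((∀ T ⊆ S, Valid I α T (g T)) →
      Valid I α S (carve I H q g δ S).2) := by
  have h := loop_inv (f := carveStep I H q g δ) (b := (S, 0, fun _ => (0, 0)))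
    (Q := fun N st => st.1 ⊆ S ∧ (∀ x ∈ st.1, N ≤ x) ∧ ((∀ T ⊆ S, Valid I α T (g T)) →
      Valid I α (S \ st.1) st.2)) I.n
    (by
      refine ⟨subset_rfl, by simp, fun _ => ?_⟩
      simp [Valid])
    (by
      rintro x hx ⟨R, t, f⟩ ⟨h1, h2, h3⟩
      dsimp only at h1 h2 h3 ⊢
      unfold carveStep
      split_ifs with hc
      · -- the cluster of a carving step contains its centre, so `x` is removed
        dsimp only at hc ⊢
        set P := near I x (2 * (pick (fun i => (g (near I x (2 * (i : ℝ) * δ) R)).1) q H : ℝ) * δ)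
          R with hP
        have hPR : P ⊆ R := near_subset _ _ _
        have hxP : x ∈ P := self_mem_near hc (by positivity)
        refine ⟨Finset.sdiff_subset.trans h1, fun z hz => ?_, fun hg => ?_⟩
        · rw [Finset.mem_sdiff] at hz
          have := h2 z hz.1
          have : z ≠ x := by
            rintro rfl
            exact hz.2 hxP
          omega
        · have := valid_union (h3 hg) (hg P (hPR.trans h1))
            (fun z => if z ∈ P then (g P).2 z else f z)
            (fun z hz => by
              rw [if_neg]
              intro h
              exact (Finset.mem_sdiff.1 hz).2 (hPR h))
            (fun z hz => by rw [if_pos hz])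
          convert this using 1
          ext z
          simp only [Finset.mem_sdiff, Finset.mem_union]
          have := @hPR z
          have := @h1 z
          tauto
      · refine ⟨h1, fun z hz => ?_, h3⟩
        dsimp only at hc hz
        have := h2 z hz
        have : z ≠ x := by
          rintro rfl
          exact hc hz
        omega)
  change (carve I H q g δ S).1 ⊆ S ∧ (∀ x ∈ (carve I H q g δ S).1, I.n ≤ x) ∧ (_ →
      Valid I α (S \ (carve I H q g δ S).1) (carve I H q g δ S).2) at h
  obtain ⟨h1, h2, h3⟩ := h
  have h4 : (carve I H q g δ S).1 = ∅ := by
    rw [Finset.eq_empty_iff_forall_notMem]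
    intro x hx
    have := Finset.mem_range.1 (hS (h1 hx))
    have := h2 x hx
    omega
  refine ⟨h4, fun hg => ?_⟩
  have := h3 hg
  rwa [h4, Finset.sdiff_empty] at this

theorem solve_valid (hm : 1 ≤ I.m) (k : ℕ) {S : Finset ℕ} (hS : S ⊆ Finset.range I.n) :
    Valid I α S (solve I α H q k S) := by
  induction k generalizing S with
  | zero => exact leaf_valid hS hm
  | succ k ih =>
    have hb : ∀ c acc, Valid I α S c → Valid I α S acc → Valid I α S (better c acc) := by
      intro c acc hc ha
      unfold better
      split_ifs
      · exact hc
      · exact ha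
    refine loop_inv (Q := fun _ acc => Valid I α S acc) I.m (ih hS) fun y hy acc hacc =>
      loop_inv (Q := fun _ acc => Valid I α S acc) I.n hacc fun w hw acc hacc => ?_
    refine hb _ _ ((carve_inv (sd_nonneg I y w) hS).2 fun T hT => ih (hT.trans hS))
      (hb _ _ ?_ hacc)
    have h1 : Valid I α (S.filter fun x => sd I y x ≤ sd I y w)
        (sd I y w ^ α, fun _ => (y, w)) := by
      refine ⟨fun x hx => ⟨hy, hw, (Finset.mem_filter.1 hx).2⟩, ?_⟩
      rcases (S.filter fun x => sd I y x ≤ sd I y w).eq_empty_or_nonempty with h | h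
      · rw [h]
        simpa using Real.rpow_nonneg (sd_nonneg I _ _) _
      · rw [Finset.image_const h]
        simp
    have := valid_union h1 (ih ((Finset.filter_subset (fun x => ¬ sd I y x ≤ sd I y w) S).trans hS))
      (coverCand I α (solve I α H q k) S y w).2
      (fun x hx => if_pos (Finset.mem_filter.1 hx).2)
      (fun x hx => if_neg (Finset.mem_filter.1 hx).2)
    rwa [Finset.filter_union_filter_not_eq] at this

theorem solve_nonneg (hm : 1 ≤ I.m) (k : ℕ) {S : Finset ℕ} (hS : S ⊆ Finset.range I.n) :
    0 ≤ (solve I α H q k S).1 :=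
  (Finset.sum_nonneg fun _ _ => Real.rpow_nonneg (sd_nonneg I _ _) _).trans
    (solve_valid hm k hS).2

end Solve

/-! ### Approximation guarantee -/

section Analysis

variable {I : MCCInstance} {α : ℝ} {H q : ℕ}

theorem pairCost_nonneg (𝓑 : Finset (ℕ × ℕ)) : 0 ≤ pairCost I α 𝓑 :=
  Finset.sum_nonneg fun _ _ => Real.rpow_nonneg (sd_nonneg I _ _) _

theorem pairCost_mono {𝓐 𝓑 : Finset (ℕ × ℕ)} (h : 𝓐 ⊆ 𝓑) :
    pairCost I α 𝓐 ≤ pairCost I α 𝓑 :=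
  Finset.sum_le_sum_of_subset_of_nonneg h fun _ _ _ => Real.rpow_nonneg (sd_nonneg I _ _) _

theorem pairCost_add_le {𝓐 𝓑 𝓒 : Finset (ℕ × ℕ)} (h : Disjoint 𝓐 𝓑) (hA : 𝓐 ⊆ 𝓒)
    (hB : 𝓑 ⊆ 𝓒) : pairCost I α 𝓐 + pairCost I α 𝓑 ≤ pairCost I α 𝓒 := by
  classical
  have : pairCost I α (𝓐 ∪ 𝓑) = pairCost I α 𝓐 + pairCost I α 𝓑 := Finset.sum_union h
  rw [← this]
  exact pairCost_mono (Finset.union_subset hA hB)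

open Classical in
/-- The balls in `𝓑` that contain a client in `S`. -/
def meeting (I : MCCInstance) (𝓑 : Finset (ℕ × ℕ)) (S : Finset ℕ) : Finset (ℕ × ℕ) :=
  𝓑.filter fun p => ∃ x ∈ S, sd I p.1 x ≤ sd I p.1 p.2

theorem meeting_subset (𝓑 : Finset (ℕ × ℕ)) (S : Finset ℕ) : meeting I 𝓑 S ⊆ 𝓑 :=
  Finset.filter_subset _ _

theorem mem_meeting {𝓑 : Finset (ℕ × ℕ)} {S : Finset ℕ} {p : ℕ × ℕ} :
    p ∈ meeting I 𝓑 S ↔ p ∈ 𝓑 ∧ ∃ x ∈ S, sd I p.1 x ≤ sd I p.1 p.2 := by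
  simp [meeting]

/-- The balls meeting a set of clients suffice to cover it. -/
theorem Covers.meeting {𝓑 : Finset (ℕ × ℕ)} {S T : Finset ℕ} (h : Covers I 𝓑 S) (hT : T ⊆ S) :
    Covers I (meeting I 𝓑 T) T := fun x hx => by
  obtain ⟨p, hp, hp'⟩ := h x (hT hx)
  exact ⟨p, mem_meeting.2 ⟨hp, x, hx, hp'⟩, hp'⟩

theorem mem_near {x z : ℕ} {t : ℝ} {R : Finset ℕ} : z ∈ near I x t R ↔ z ∈ R ∧ I.entry x z ≤ t := by
  simp [near]

theorem near_diam {x : ℕ} {t : ℝ} {R : Finset ℕ} (hx : x < I.n) (hR : R ⊆ Finset.range I.n)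
    {a b : ℕ} (ha : a ∈ near I x t R) (hb : b ∈ near I x t R) : I.entry a b ≤ 2 * t := by
  rw [mem_near] at ha hb
  have ha' := Finset.mem_range.1 (hR ha.1)
  have hb' := Finset.mem_range.1 (hR hb.1)
  have := entry_triangle I (i := a) (j := x) (l := b) (by omega) (by omega) (by omega)
  rw [entry_comm I a x] at this
  linarith [ha.2, hb.2]

/-- Balls of radius at most `δ` do not meet both the inner and the complement of the outer one of
two concentric clusters whose radii differ by `2 * δ`. -/
theorem disjoint_meeting {𝓑 : Finset (ℕ × ℕ)} (h𝓑 : 𝓑 ⊆ Finset.range I.m ×ˢ Finset.range I.n)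
    {δ : ℝ} (hδ : ∀ p ∈ 𝓑, sd I p.1 p.2 ≤ δ) {R : Finset ℕ} (hR : R ⊆ Finset.range I.n) {x : ℕ}
    (hx : x < I.n) {s t : ℝ} (hst : s + 2 * δ ≤ t) :
    Disjoint (meeting I 𝓑 (near I x s R)) (meeting I 𝓑 (R \ near I x t R)) := by
  rw [Finset.disjoint_left]
  intro p hp hp'
  rw [mem_meeting] at hp hp'
  obtain ⟨hp1, a, ha, ha'⟩ := hp
  obtain ⟨-, b, hb, hb'⟩ := hp'
  rw [mem_near] at ha
  rw [Finset.mem_sdiff, mem_near] at hb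
  have h1 := Finset.mem_range.1 (hR ha.1)
  have h2 := Finset.mem_range.1 (hR hb.1)
  have h3 := Finset.mem_range.1 (Finset.mem_product.1 (h𝓑 hp1)).1
  have h4 := entry_le_sd_add I h3 h1 h2
  have h5 := hδ p hp1
  have h6 := entry_triangle I (i := x) (j := a) (l := b) (by omega) (by omega) (by omega)
  exact hb.2 ⟨hb.1, by linarith⟩

/-- Carving loses only a factor `1 + 2 / q` if all balls are small compared to the diameter on which
the solver for the clusters works well. -/
theorem carve_le (hm : 1 ≤ I.m) (hq : 1 ≤ q) (hH : 1 ≤ H)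
    (hn : (I.n : ℝ) + 1 ≤ (1 + 1 / (q : ℝ)) ^ H) {k : ℕ} {D G h δ : ℝ} (hG : 0 ≤ G) (hh : 0 ≤ h)
    (hB : Bound I α H q k D G h) {S : Finset ℕ} (hS : S ⊆ Finset.range I.n)
    {𝓑 : Finset (ℕ × ℕ)} (h𝓑 : 𝓑 ⊆ Finset.range I.m ×ˢ Finset.range I.n) (hc : Covers I 𝓑 S)
    (hδ : ∀ p ∈ 𝓑, sd I p.1 p.2 ≤ δ) (hδ0 : 0 ≤ δ) (hD : 4 * H * δ ≤ D) :
    (carve I H q (solve I α H q k) δ S).2.1 ≤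
      (1 + 2 / (q : ℝ)) * (G * pairCost I α 𝓑 + h * S.card) := by
  have hq' : (0 : ℝ) < q := by exact_mod_cast hq
  -- Every client may be charged `s`, the average of the whole bound. This is what the growth of the
  -- cost is measured against, so that it cannot be large for all `H` radii.
  set s : ℝ := (G * pairCost I α 𝓑 + h * S.card) / S.card with hs
  have hA : 0 ≤ G * pairCost I α 𝓑 + h * S.card :=
    add_nonneg (mul_nonneg hG (pairCost_nonneg _)) (by positivity)
  have hs0 : 0 ≤ s := div_nonneg hA (Nat.cast_nonneg _)
  -- The balls meeting the remaining clients are not yet charged: a cluster is charged to the balls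
  -- that meet the next smaller cluster, and these do not meet the clients left behind.
  have hinv := loop_inv (f := carveStep I H q (solve I α H q k) δ) (b := (S, 0, fun _ => (0, 0)))
    (Q := fun _ st => st.1 ⊆ S ∧ st.2.1 ≤ (1 + 1 / (q : ℝ)) *
      (G * pairCost I α (𝓑 \ meeting I 𝓑 st.1) + h * (S \ st.1).card) +
        1 / (q : ℝ) * (s * (S \ st.1).card)) I.n
    (by
      refine ⟨subset_rfl, ?_⟩
      have := pairCost_nonneg (I := I) (α := α) (𝓑 \ meeting I 𝓑 S)
      simp only [sdiff_self, Finset.bot_eq_empty, Finset.card_empty, Nat.cast_zero, mul_zero,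
        add_zero]
      positivity)
    (by
      rintro x hx ⟨R, t, f⟩ ⟨h1, h2⟩
      dsimp only at h1 h2 ⊢
      unfold carveStep
      split_ifs with hxR
      swap
      · exact ⟨h1, h2⟩
      dsimp only at hxR ⊢
      set u : ℕ → ℝ := fun i => (solve I α H q k (near I x (2 * (i : ℝ) * δ) R)).1 with hu
      have hRn := h1.trans hS
      have hScard : (1 : ℝ) ≤ S.card := by
        have : 0 < S.card := Finset.card_pos.2 ⟨x, h1 hxR⟩
        exact_mod_cast this
      have hub : ∀ i ≤ H, u i ≤ G * pairCost I α (meeting I 𝓑 (near I x (2 * (i : ℝ) * δ) R)) +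
          h * (near I x (2 * (i : ℝ) * δ) R).card := by
        intro i hi
        refine hB _ ((near_subset _ _ _).trans hRn) (fun a ha b hb => ?_) _
          ((meeting_subset _ _).trans h𝓑) (hc.meeting ((near_subset _ _ _).trans h1))
        refine (near_diam hx hRn ha hb).trans (le_trans ?_ hD)
        have : (i : ℝ) ≤ H := by exact_mod_cast hi
        have : (i : ℝ) * δ ≤ H * δ := by gcongr
        linarith
      have hsS : S.card * s = G * pairCost I α 𝓑 + h * S.card := by
        rw [hs]
        field_simp
      obtain ⟨j, hj, hp, hgrow⟩ := pick_spec (u := u) (q := q) (H := H) (s := s) hq hH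
        (solve_nonneg hm k ((near_subset _ _ _).trans hRn)) (by
          have e1 := hub H le_rfl
          have e2 := pairCost_mono (I := I) (α := α)
            (meeting_subset (I := I) 𝓑 (near I x (2 * (H : ℝ) * δ) R))
          have e3 : ((near I x (2 * (H : ℝ) * δ) R).card : ℝ) ≤ S.card := by
            exact_mod_cast Finset.card_le_card ((near_subset _ _ _).trans h1)
          have e4 : u H ≤ S.card * s := by
            rw [hsS]
            refine e1.trans ?_
            gcongr
          have e5 : (S.card : ℝ) ≤ I.n := by
            have := Finset.card_le_card hS
            rw [Finset.card_range] at this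
            exact_mod_cast this
          calc u H + s ≤ (S.card + 1) * s := by linarith
            _ ≤ (I.n + 1) * s := by gcongr
            _ ≤ _ := by gcongr)
      have hp' : ((pick u q H : ℕ) : ℝ) = j + 1 := by rw [hp]; push_cast; rfl
      have hu1 : u (j + 1) = (solve I α H q k (near I x (2 * (pick u q H : ℝ) * δ) R)).1 := by
        rw [hu, hp']
        push_cast
        rfl
      rw [← hu1]
      rw [hp']
      set P := near I x (2 * ((j : ℝ) + 1) * δ) R with hP
      set P' := near I x (2 * (j : ℝ) * δ) R with hP'
      have hP'P : P' ⊆ P := by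
        intro z hz
        rw [mem_near] at hz ⊢
        refine ⟨hz.1, hz.2.trans ?_⟩
        have : 0 ≤ δ := hδ0
        gcongr
        linarith
      have hPR : P ⊆ R := near_subset _ _ _
      have hxP : x ∈ P := self_mem_near hxR (by positivity)
      refine ⟨Finset.sdiff_subset.trans h1, ?_⟩
      have hcard : (S \ (R \ P)).card = (S \ R).card + P.card := by
        rw [← Finset.card_union_of_disjoint]
        · congr 1
          ext z
          have := @hPR z
          have := @h1 z
          simp only [Finset.mem_sdiff, Finset.mem_union]
          tauto
        · rw [Finset.disjoint_left]
          intro z hz hz'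
          exact (Finset.mem_sdiff.1 hz).2 (hPR hz')
      have hcost : pairCost I α (𝓑 \ meeting I 𝓑 R) + pairCost I α (meeting I 𝓑 P') ≤
          pairCost I α (𝓑 \ meeting I 𝓑 (R \ P)) := by
        have hm' : ∀ {T T' : Finset ℕ}, T ⊆ T' → meeting I 𝓑 T ⊆ meeting I 𝓑 T' := by
          intro T T' hT p hp
          rw [mem_meeting] at hp ⊢
          obtain ⟨a, b, c, d⟩ := hp
          exact ⟨a, b, hT c, d⟩
        refine pairCost_add_le ?_ ?_ ?_
        · rw [Finset.disjoint_left]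
          intro p hp hp''
          exact (Finset.mem_sdiff.1 hp).2 (hm' (hP'P.trans hPR) hp'')
        · exact Finset.sdiff_subset_sdiff subset_rfl (hm' Finset.sdiff_subset)
        · intro p hp
          rw [Finset.mem_sdiff]
          refine ⟨meeting_subset _ _ hp, ?_⟩
          refine Finset.disjoint_left.1 (disjoint_meeting h𝓑 hδ hRn hx ?_) hp
          linarith
      have hP1 : (1 : ℝ) ≤ P.card := by
        have : 0 < P.card := Finset.card_pos.2 ⟨x, hxP⟩
        exact_mod_cast this
      have hPP : (P'.card : ℝ) ≤ P.card := by exact_mod_cast Finset.card_le_card hP'P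
      have hub' := hub j hj.le
      rw [hcard]
      push_cast
      have e1 : u (j + 1) ≤ (1 + 1 / (q : ℝ)) *
          (G * pairCost I α (meeting I 𝓑 P') + h * P.card) + 1 / (q : ℝ) * (s * P.card) := by
        refine hgrow.trans ?_
        have : u j ≤ G * pairCost I α (meeting I 𝓑 P') + h * P.card := hub'.trans (by gcongr)
        gcongr
        nlinarith
      calc t + u (j + 1) ≤ _ := add_le_add h2 e1
        _ = (1 + 1 / (q : ℝ)) * (G * (pairCost I α (𝓑 \ meeting I 𝓑 R) +
              pairCost I α (meeting I 𝓑 P')) + h * ((S \ R).card + P.card)) +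
            1 / (q : ℝ) * (s * ((S \ R).card + P.card)) := by ring
        _ ≤ _ := by gcongr)
  obtain ⟨-, h2⟩ := hinv
  change (carve I H q (solve I α H q k) δ S).2.1 ≤ (1 + 1 / (q : ℝ)) *
      (G * pairCost I α (𝓑 \ meeting I 𝓑 (carve I H q (solve I α H q k) δ S).1) +
        h * (S \ (carve I H q (solve I α H q k) δ S).1).card) +
        1 / (q : ℝ) * (s * (S \ (carve I H q (solve I α H q k) δ S).1).card) at h2
  rw [(carve_inv (α := α) hδ0 hS).1, Finset.sdiff_empty] at h2
  have h3 : s * S.card ≤ G * pairCost I α 𝓑 + h * S.card := by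
    rcases eq_or_ne (S.card : ℝ) 0 with h0 | h0
    · rw [h0] at hA ⊢
      simpa using hA
    · rw [hs, div_mul_cancel₀ _ h0]
  have h4 : (1 + 1 / (q : ℝ)) * (G * pairCost I α
        (𝓑 \ meeting I 𝓑 ∅) + h * S.card) ≤
      (1 + 1 / (q : ℝ)) * (G * pairCost I α 𝓑 + h * S.card) := by
    gcongr
    exact pairCost_mono Finset.sdiff_subset
  have h5 : 1 / (q : ℝ) * (s * S.card) ≤ 1 / (q : ℝ) * (G * pairCost I α 𝓑 + h * S.card) := by
    gcongr
  have h6 : (1 + 2 / (q : ℝ)) * (G * pairCost I α 𝓑 + h * S.card) =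
      (1 + 1 / (q : ℝ)) * (G * pairCost I α 𝓑 + h * S.card) +
        1 / (q : ℝ) * (G * pairCost I α 𝓑 + h * S.card) := by ring
  linarith

theorem solve_empty (hα : 1 ≤ α) (hm : 1 ≤ I.m) (k : ℕ) : (solve I α H q k ∅).1 ≤ 0 := by
  refine (solve_anti (Nat.zero_le k) ∅).trans ?_
  refine (leaf_le hα (Finset.empty_subset _) hm (y := 0) (by omega) le_rfl (by simp)).trans ?_
  rw [Real.zero_rpow (by linarith)]

/-- If all balls of a cover are small compared to `D`, then carving at the scale of the largest one
of them is a good move. -/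
theorem solve_succ_le_of_small (hα : 1 ≤ α) (hm : 1 ≤ I.m) (hq : 1 ≤ q) (hH : 1 ≤ H)
    (hn : (I.n : ℝ) + 1 ≤ (1 + 1 / (q : ℝ)) ^ H) {k : ℕ} {D G h : ℝ} (hG : 0 ≤ G) (hh : 0 ≤ h)
    (hB : Bound I α H q k D G h) {S : Finset ℕ} (hS : S ⊆ Finset.range I.n)
    {𝓑 : Finset (ℕ × ℕ)} (h𝓑 : 𝓑 ⊆ Finset.range I.m ×ˢ Finset.range I.n) (hc : Covers I 𝓑 S)
    (hD : ∀ p ∈ 𝓑, 4 * H * sd I p.1 p.2 ≤ D) :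
    (solve I α H q (k + 1) S).1 ≤ (1 + 2 / (q : ℝ)) * (G * pairCost I α 𝓑 + h * S.card) := by
  rcases 𝓑.eq_empty_or_nonempty with rfl | hne
  · have : S = ∅ := by
      rw [Finset.eq_empty_iff_forall_notMem]
      intro x hx
      simpa using hc x hx
    subst this
    refine (solve_empty hα hm _).trans ?_
    simp [pairCost]
  · obtain ⟨p, hp, hmax⟩ := 𝓑.exists_max_image (fun p => sd I p.1 p.2) hne
    have h1 := Finset.mem_product.1 (h𝓑 hp)
    exact (solve_le_carve k S (Finset.mem_range.1 h1.1) (Finset.mem_range.1 h1.2)).trans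
      (carve_le hm hq hH hn hG hh hB hS h𝓑 hc hmax (sd_nonneg I _ _) (hD p hp))

/-- The balls in `𝓛` may be bought one after the other. -/
theorem solve_add_card_le (𝓛 : Finset (ℕ × ℕ)) (h𝓛 : 𝓛 ⊆ Finset.range I.m ×ˢ Finset.range I.n)
    (k : ℕ) (S : Finset ℕ) : ∃ T ⊆ S, (∀ x ∈ T, ∀ p ∈ 𝓛, ¬ sd I p.1 x ≤ sd I p.1 p.2) ∧
      (solve I α H q (k + 𝓛.card) S).1 ≤ pairCost I α 𝓛 + (solve I α H q k T).1 := by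
  classical
  induction 𝓛 using Finset.induction_on generalizing S with
  | empty => exact ⟨S, subset_rfl, by simp, by simp [pairCost]⟩
  | insert p 𝓛 hp ih =>
    have h1 := Finset.mem_product.1 (h𝓛 (Finset.mem_insert_self _ _))
    obtain ⟨T, hT, hT', hle⟩ := ih ((Finset.subset_insert _ _).trans h𝓛)
      (S.filter fun x => ¬ sd I p.1 x ≤ sd I p.1 p.2)
    refine ⟨T, hT.trans (Finset.filter_subset _ _), fun x hx p' hp' => ?_, ?_⟩
    · rcases Finset.mem_insert.1 hp' with rfl | h
      · exact (Finset.mem_filter.1 (hT hx)).2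
      · exact hT' x hx p' h
    · rw [Finset.card_insert_of_notMem hp, ← add_assoc]
      refine (solve_le_cover _ S (Finset.mem_range.1 h1.1) (Finset.mem_range.1 h1.2)).trans ?_
      have : pairCost I α (insert p 𝓛) = sd I p.1 p.2 ^ α + pairCost I α 𝓛 :=
        Finset.sum_insert hp
      rw [this]
      linarith

/-- If a cover of a set of diameter at most `D` uses many balls of radius more than `D / (8 * H)`,
then a single ball is at least as cheap. -/
theorem leaf_le_of_many (hα : 1 ≤ α) (hm : 1 ≤ I.m) (hH : 1 ≤ H) {D : ℝ} {S : Finset ℕ}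
    (hS : S ⊆ Finset.range I.n) (hD : ∀ x ∈ S, ∀ x' ∈ S, I.entry x x' ≤ D)
    {𝓛 : Finset (ℕ × ℕ)} (h𝓛 : 𝓛 ⊆ Finset.range I.m ×ˢ Finset.range I.n)
    (hmeet : ∀ p ∈ 𝓛, ∃ x ∈ S, sd I p.1 x ≤ sd I p.1 p.2)
    (hlarge : ∀ p ∈ 𝓛, D ≤ 8 * H * sd I p.1 p.2) (hcard : ((16 * H : ℕ) : ℝ) ^ α ≤ 𝓛.card) :
    (solve I α H q 0 S).1 ≤ pairCost I α 𝓛 := by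
  have hH' : (1 : ℝ) ≤ H := by exact_mod_cast hH
  have hne : 𝓛.Nonempty := by
    rw [Finset.nonempty_iff_ne_empty]
    rintro rfl
    have : (0 : ℝ) < ((16 * H : ℕ) : ℝ) ^ α := by
      apply Real.rpow_pos_of_pos
      push_cast
      positivity
    simp only [Finset.card_empty, Nat.cast_zero] at hcard
    linarith
  obtain ⟨p, hp, hmin⟩ := 𝓛.exists_min_image (fun p => sd I p.1 p.2) hne
  have h1 := Finset.mem_product.1 (h𝓛 hp)
  have hr := sd_nonneg I p.1 p.2
  obtain ⟨x, hx, hxp⟩ := hmeet p hp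
  have h2 : (leaf I α S).1 ≤ (((16 * H : ℕ) : ℝ) * sd I p.1 p.2) ^ α := by
    refine leaf_le hα hS hm (Finset.mem_range.1 h1.1) (by positivity) fun x' hx' => ?_
    have h3 := sd_le_add I (Finset.mem_range.1 h1.1) (Finset.mem_range.1 (hS hx))
      (Finset.mem_range.1 (hS hx'))
    have h4 := hD x hx x' hx'
    have h5 := hlarge p hp
    push_cast
    nlinarith
  refine h2.trans ?_
  rw [Real.mul_rpow (by positivity) hr]
  calc ((16 * H : ℕ) : ℝ) ^ α * sd I p.1 p.2 ^ α ≤ 𝓛.card * sd I p.1 p.2 ^ α := by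
        gcongr
    _ = 𝓛.card • sd I p.1 p.2 ^ α := by rw [nsmul_eq_mul]
    _ ≤ pairCost I α 𝓛 := Finset.card_nsmul_le_sum _ _ _ fun p' hp' =>
        Real.rpow_le_rpow hr (hmin p' hp') (by linarith)

/-- Doubling the diameter costs a factor `1 + 2 / q` and `K + 1` levels of the recursion. At most
`K` balls of a cover have radius more than `D / (8 * H)`, or a single ball is good enough; they are
bought one after the other, and then carving at the scale of the others cuts the clients into
clusters of diameter at most `D / 2`. -/
theorem Bound.double (hα : 1 ≤ α) (hm : 1 ≤ I.m) (hq : 1 ≤ q) (hH : 1 ≤ H)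
    (hn : (I.n : ℝ) + 1 ≤ (1 + 1 / (q : ℝ)) ^ H) {k K : ℕ} (hK : ((16 * H : ℕ) : ℝ) ^ α ≤ K)
    {D G h : ℝ} (hG : 1 ≤ G) (hh : 0 ≤ h) (hB : Bound I α H q k (D / 2) G h) :
    Bound I α H q (k + (K + 1)) D ((1 + 2 / (q : ℝ)) * G) ((1 + 2 / (q : ℝ)) * h) := by
  classical
  intro S hS hD 𝓑 h𝓑 hc
  have hq' : (0 : ℝ) < q := by exact_mod_cast hq
  have hq1 : 1 ≤ 1 + 2 / (q : ℝ) := by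
    have : 0 < 2 / (q : ℝ) := by positivity
    linarith
  set 𝓛 := (meeting I 𝓑 S).filter fun p => D < 8 * H * sd I p.1 p.2 with h𝓛
  have h𝓛𝓑 : 𝓛 ⊆ 𝓑 := (Finset.filter_subset _ _).trans (meeting_subset _ _)
  have hc0 := pairCost_nonneg (I := I) (α := α) 𝓑
  by_cases hcard : ((16 * H : ℕ) : ℝ) ^ α ≤ 𝓛.card
  · refine (solve_anti (Nat.zero_le _) S).trans ?_
    refine (leaf_le_of_many hα hm hH hS hD (h𝓛𝓑.trans h𝓑)
      (fun p hp => (mem_meeting.1 (Finset.mem_filter.1 hp).1).2)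
      (fun p hp => (Finset.mem_filter.1 hp).2.le) hcard).trans ?_
    refine (pairCost_mono h𝓛𝓑).trans ?_
    have : 1 ≤ (1 + 2 / (q : ℝ)) * G := one_le_mul_of_one_le_of_one_le hq1 hG
    have : 0 ≤ (1 + 2 / (q : ℝ)) * h * S.card := by positivity
    nlinarith
  · have hcK : 𝓛.card ≤ K := by
      have : (𝓛.card : ℝ) ≤ K := (not_le.1 hcard).le.trans hK
      exact_mod_cast this
    obtain ⟨T, hT, hT', hle⟩ := solve_add_card_le (α := α) (H := H) (q := q) 𝓛 (h𝓛𝓑.trans h𝓑)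
      (k + 1) S
    refine (solve_anti (k := k + 1 + 𝓛.card) (by omega) S).trans (hle.trans ?_)
    have h1 : Covers I ((meeting I 𝓑 S) \ 𝓛) T := by
      intro x hx
      obtain ⟨p, hp, hp'⟩ := (hc.meeting subset_rfl) x (hT hx)
      exact ⟨p, Finset.mem_sdiff.2 ⟨hp, fun h => hT' x hx p h hp'⟩, hp'⟩
    have h2 := solve_succ_le_of_small hα hm hq hH hn (by linarith) hh hB (hT.trans hS)
      (Finset.sdiff_subset.trans ((meeting_subset 𝓑 S).trans h𝓑)) h1 (fun p hp => by
        rw [Finset.mem_sdiff, h𝓛, Finset.mem_filter] at hp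
        have : ¬ D < 8 * H * sd I p.1 p.2 := fun h => hp.2 ⟨hp.1, h⟩
        linarith)
    have h3 : pairCost I α 𝓛 + pairCost I α ((meeting I 𝓑 S) \ 𝓛) ≤ pairCost I α 𝓑 :=
      pairCost_add_le Finset.disjoint_sdiff h𝓛𝓑
        (Finset.sdiff_subset.trans (meeting_subset 𝓑 S))
    have h4 : (T.card : ℝ) ≤ S.card := by exact_mod_cast Finset.card_le_card hT
    have h5 := pairCost_nonneg (I := I) (α := α) 𝓛
    calc _ ≤ (1 + 2 / (q : ℝ)) * (G * pairCost I α 𝓛) +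
          (1 + 2 / (q : ℝ)) * (G * pairCost I α ((meeting I 𝓑 S) \ 𝓛) + h * T.card) := by
          refine add_le_add ?_ h2
          have : 1 ≤ (1 + 2 / (q : ℝ)) * G := one_le_mul_of_one_le_of_one_le hq1 hG
          nlinarith
      _ = (1 + 2 / (q : ℝ)) * (G * (pairCost I α 𝓛 + pairCost I α ((meeting I 𝓑 S) \ 𝓛)) +
            h * T.card) := by ring
      _ ≤ (1 + 2 / (q : ℝ)) * (G * pairCost I α 𝓑 + h * S.card) := by gcongr
      _ = _ := by ring

/-- The guarantee after `Λ` doublings of the diameter. -/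
theorem Bound.iterate (hα : 1 ≤ α) (hm : 1 ≤ I.m) (hq : 1 ≤ q) (hH : 1 ≤ H)
    (hn : (I.n : ℝ) + 1 ≤ (1 + 1 / (q : ℝ)) ^ H) {K : ℕ} (hK : ((16 * H : ℕ) : ℝ) ^ α ≤ K)
    {G h : ℝ} (hG : 1 ≤ G) (hh : 0 ≤ h) (Λ : ℕ) {D : ℝ} (hB : Bound I α H q 0 (D / 2 ^ Λ) G h) :
    Bound I α H q (Λ * (K + 1)) D ((1 + 2 / (q : ℝ)) ^ Λ * G) ((1 + 2 / (q : ℝ)) ^ Λ * h) := by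
  induction Λ generalizing D with
  | zero => simpa using hB
  | succ Λ ih =>
    have h1 := ih (D := D / 2) (by rwa [div_div, ← pow_succ'])
    have hq1 : 1 ≤ 1 + 2 / (q : ℝ) := by
      have : 0 ≤ 2 / (q : ℝ) := by positivity
      linarith
    have h2 := h1.double hα hm hq hH hn hK (one_le_mul_of_one_le_of_one_le (one_le_pow₀ hq1) hG)
      (by positivity)
    rw [add_mul, one_mul, pow_succ', mul_assoc, mul_assoc]
    exact h2

/-- Sets whose diameter is below all distances contain at most one client, so a single ball is
optimal for them. -/
theorem bound_zero_of_isolated (hα : 1 ≤ α) (hm : 1 ≤ I.m) {D : ℝ}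
    (hD : ∀ x < I.n, ∀ x' < I.n, I.entry x x' ≤ D → x = x') : Bound I α H q 0 D 1 0 := by
  intro S hS hSD 𝓑 h𝓑 hc
  rcases S.eq_empty_or_nonempty with rfl | ⟨x, hx⟩
  · refine (solve_empty hα hm 0).trans ?_
    simpa using pairCost_nonneg _
  · obtain ⟨p, hp, hxp⟩ := hc x hx
    have h1 := Finset.mem_product.1 (h𝓑 hp)
    have h2 : (leaf I α S).1 ≤ sd I p.1 p.2 ^ α := by
      refine leaf_le hα hS hm (Finset.mem_range.1 h1.1) (sd_nonneg I _ _) fun x' hx' => ?_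
      rwa [← hD x (Finset.mem_range.1 (hS hx)) x' (Finset.mem_range.1 (hS hx')) (hSD x hx x' hx')]
    rw [one_mul, zero_mul, add_zero]
    refine h2.trans ?_
    exact Finset.single_le_sum (f := fun p : ℕ × ℕ => sd I p.1 p.2 ^ α)
      (fun p _ => Real.rpow_nonneg (sd_nonneg I _ _) _) hp

/-- A single ball around the server of any ball of a cover, with the radius enlarged by the diameter
`D`. The enlargement is paid for by the cost of the ball if its radius is at least `D / β`, and by
the additive error otherwise. -/
theorem bound_zero (hα : 1 ≤ α) (hm : 1 ≤ I.m) {D β : ℝ} (hD : 0 ≤ D) (hβ : 0 < β) :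
    Bound I α H q 0 D ((1 + β) ^ α) (((1 + 1 / β) * D) ^ α) := by
  intro S hS hSD 𝓑 h𝓑 hc
  have hc0 := pairCost_nonneg (I := I) (α := α) 𝓑
  rcases S.eq_empty_or_nonempty with rfl | ⟨x, hx⟩
  · refine (solve_empty hα hm 0).trans ?_
    positivity
  · obtain ⟨p, hp, hxp⟩ := hc x hx
    have h1 := Finset.mem_product.1 (h𝓑 hp)
    have h0 := sd_nonneg I p.1 p.2
    have h2 : (leaf I α S).1 ≤ (sd I p.1 p.2 + D) ^ α := by
      refine leaf_le hα hS hm (Finset.mem_range.1 h1.1) (by positivity) fun x' hx' => ?_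
      refine (sd_le_add I (Finset.mem_range.1 h1.1) (Finset.mem_range.1 (hS hx))
        (Finset.mem_range.1 (hS hx'))).trans ?_
      exact add_le_add hxp (hSD x hx x' hx')
    refine h2.trans ?_
    have h3 : sd I p.1 p.2 ^ α ≤ pairCost I α 𝓑 :=
      Finset.single_le_sum (f := fun p : ℕ × ℕ => sd I p.1 p.2 ^ α)
        (fun p _ => Real.rpow_nonneg (sd_nonneg I _ _) _) hp
    have h4 : (1 : ℝ) ≤ S.card := by
      have : 0 < S.card := Finset.card_pos.2 ⟨x, hx⟩
      exact_mod_cast this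
    rcases le_total D (β * sd I p.1 p.2) with h | h
    · calc (sd I p.1 p.2 + D) ^ α ≤ ((1 + β) * sd I p.1 p.2) ^ α := by
            refine Real.rpow_le_rpow (by positivity) ?_ (by linarith)
            linarith
        _ = (1 + β) ^ α * sd I p.1 p.2 ^ α := Real.mul_rpow (by positivity) h0
        _ ≤ (1 + β) ^ α * pairCost I α 𝓑 := by gcongr
        _ ≤ _ := le_add_of_nonneg_right (by positivity)
    · calc (sd I p.1 p.2 + D) ^ α ≤ ((1 + 1 / β) * D) ^ α := by
            refine Real.rpow_le_rpow (by positivity) ?_ (by linarith)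
            have : sd I p.1 p.2 ≤ D / β := by
              rw [le_div_iff₀ hβ]
              linarith
            have e : (1 + 1 / β) * D = D / β + D := by ring
            linarith
        _ = ((1 + 1 / β) * D) ^ α * 1 := (mul_one _).symm
        _ ≤ ((1 + 1 / β) * D) ^ α * S.card := by gcongr
        _ ≤ _ := le_add_of_nonneg_left (by positivity)

/-- A quantity that grows by the factor `1 + 1 / q` doubles within `q` steps by Bernoulli's
inequality. -/
theorem growth {n ℓ q : ℕ} (hn : 1 ≤ n) (hℓ : n ≤ 2 ^ ℓ) (hq : 1 ≤ q) :
    (n : ℝ) + 1 ≤ (1 + 1 / (q : ℝ)) ^ (q * (ℓ + 1)) := by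
  have hq' : (0 : ℝ) < q := by exact_mod_cast hq
  have h1 : (2 : ℝ) ≤ (1 + 1 / (q : ℝ)) ^ q := by
    have := one_add_mul_le_pow (a := 1 / (q : ℝ)) (by
      have : 0 < 1 / (q : ℝ) := by positivity
      linarith) q
    have e : (q : ℝ) * (1 / (q : ℝ)) = 1 := by field_simp
    linarith
  have h2 : (n : ℝ) ≤ 2 ^ ℓ := by exact_mod_cast hℓ
  have h3 : (1 : ℝ) ≤ n := by exact_mod_cast hn
  calc (n : ℝ) + 1 ≤ 2 ^ (ℓ + 1) := by
        rw [pow_succ]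
        linarith
    _ ≤ ((1 + 1 / (q : ℝ)) ^ q) ^ (ℓ + 1) := by gcongr
    _ = _ := by rw [pow_mul]

theorem one_add_pow_le {x y : ℝ} {N : ℕ} (hx : 0 ≤ x) (hN : N * x ≤ y) (hy : y ≤ 1) :
    (1 + x) ^ N ≤ 1 + 2 * y := by
  have h1 : (1 + x) ^ N ≤ Real.exp (N * x) := by
    rw [Real.exp_nat_mul]
    have := Real.add_one_le_exp x
    gcongr
    linarith
  have h2 : Real.exp (N * x) ≤ Real.exp y := Real.exp_le_exp.2 hN
  have h0 : 0 ≤ y := le_trans (by positivity) hN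
  have h3 := Real.abs_exp_sub_one_le (x := y) (by rwa [abs_of_nonneg h0])
  rw [abs_of_nonneg h0] at h3
  have := (abs_le.1 h3).2
  linarith

theorem one_add_rpow_le {x y : ℝ} (hx : 0 ≤ x) (hα : 0 ≤ α) (hN : α * x ≤ y) (hy : y ≤ 1) :
    (1 + x) ^ α ≤ 1 + 2 * y := by
  have h1 : (1 + x) ^ α ≤ Real.exp (α * x) := by
    rw [mul_comm, Real.exp_mul]
    have := Real.add_one_le_exp x
    refine Real.rpow_le_rpow (by positivity) (by linarith) hα
  have h2 : Real.exp (α * x) ≤ Real.exp y := Real.exp_le_exp.2 hN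
  have h0 : 0 ≤ y := le_trans (by positivity) hN
  have h3 := Real.abs_exp_sub_one_le (x := y) (by rwa [abs_of_nonneg h0])
  rw [abs_of_nonneg h0] at h3
  have := (abs_le.1 h3).2
  linarith

/-! ### Approximation factors for suitable parameters -/

/-- The approximation guarantee for bounded aspect ratio: after `Λ` halvings of the diameter, no two
clients are left together. -/
theorem solve_le_of_ratio (hα : 1 ≤ α) (hm : 1 ≤ I.m) (hn : 1 ≤ I.n) {Λ e ℓ K : ℕ} (hΛ : 1 ≤ Λ)
    (he : 1 ≤ e) (hℓ : I.n ≤ 2 ^ ℓ) (hq : q = 16 * Λ * e) (hH : H = q * (ℓ + 1))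
    (hK : ((16 * H : ℕ) : ℝ) ^ α ≤ K) {Δ : ℝ} (hΔ : ∀ x < I.n, ∀ x' < I.n, I.entry x x' ≤ Δ)
    (hsep : ∀ x < I.n, ∀ x' < I.n, x ≠ x' → Δ < 2 ^ Λ * I.entry x x') {𝓑 : Finset (ℕ × ℕ)}
    (h𝓑 : 𝓑 ⊆ Finset.range I.m ×ˢ Finset.range I.n) (hc : Covers I 𝓑 (Finset.range I.n)) :
    (solve I α H q (Λ * (K + 1) + 1) (Finset.range I.n)).1 ≤
      (1 + 1 / (e : ℝ)) * pairCost I α 𝓑 := by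
  have hΛ' : (0 : ℝ) < Λ := by exact_mod_cast hΛ
  have he' : (1 : ℝ) ≤ e := by exact_mod_cast he
  have hq1 : 1 ≤ q := by
    rw [hq]
    have := Nat.mul_le_mul hΛ he
    nlinarith
  have hH1 : 1 ≤ H := by
    rw [hH]
    nlinarith
  have hg := growth hn hℓ hq1
  rw [← hH] at hg
  have hB := Bound.iterate (H := H) hα hm hq1 hH1 hg hK (G := 1) (h := 0) le_rfl le_rfl Λ (D := Δ)
    (bound_zero_of_isolated hα hm fun x hx x' hx' h => by
      by_contra hne
      have := hsep x hx x' hx' hne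
      rw [le_div_iff₀ (by positivity)] at h
      linarith)
  have h1 := hB (Finset.range I.n) subset_rfl (fun x hx x' hx' =>
    hΔ x (Finset.mem_range.1 hx) x' (Finset.mem_range.1 hx')) 𝓑 h𝓑 hc
  refine (solve_succ_le _ _).trans (h1.trans ?_)
  rw [mul_one, mul_zero, zero_mul, add_zero]
  refine mul_le_mul_of_nonneg_right ?_ (pairCost_nonneg _)
  have h2 := one_add_pow_le (x := 2 / (q : ℝ)) (y := 1 / (2 * e)) (N := Λ) (by positivity) (by
    rw [hq]
    push_cast
    rw [show (Λ : ℝ) * (2 / (16 * Λ * e)) = 1 / (8 * e) by field_simp; norm_num]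
    apply one_div_le_one_div_of_le <;> linarith) (by
    rw [div_le_one (by positivity)]
    linarith)
  refine h2.trans (le_of_eq ?_)
  field_simp

/-- The approximation guarantee for arbitrary aspect ratio: no optimal ball is cut by a carving at a
scale far above the largest radius `R`, and after `Λ` halvings the diameter is negligible
against `R`. -/
theorem solve_le_of_levels (hα : 1 ≤ α) (hm : 1 ≤ I.m) (hn : 1 ≤ I.n) {Λ e ℓ a K : ℕ}
    (he : 1 ≤ e) (ha : α ≤ a) (hℓ : I.n ≤ 2 ^ ℓ) (hΛ : Λ = 2 * (14 + a + 2 * ℓ + 3 * e))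
    (hq : q = 16 * Λ * e) (hH : H = q * (ℓ + 1)) (hK : ((16 * H : ℕ) : ℝ) ^ α ≤ K)
    {𝓑 : Finset (ℕ × ℕ)} (h𝓑 : 𝓑 ⊆ Finset.range I.m ×ˢ Finset.range I.n)
    (hc : Covers I 𝓑 (Finset.range I.n)) :
    (solve I α H q (Λ * (K + 1) + 1) (Finset.range I.n)).1 ≤
      (1 + 1 / (e : ℝ)) * pairCost I α 𝓑 := by
  have hΛ1 : 28 ≤ Λ := by omega
  have hΛ' : (28 : ℝ) ≤ Λ := by exact_mod_cast hΛ1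
  have he' : (1 : ℝ) ≤ e := by exact_mod_cast he
  have hq1 : 1 ≤ q := by
    rw [hq]
    nlinarith
  have hH1 : 1 ≤ H := by
    rw [hH]
    nlinarith
  have hg := growth hn hℓ hq1
  rw [← hH] at hg
  have hne : 𝓑.Nonempty := by
    obtain ⟨p, hp, -⟩ := hc 0 (Finset.mem_range.2 hn)
    exact ⟨p, hp⟩
  obtain ⟨p, hp, hmax⟩ := 𝓑.exists_max_image (fun p => sd I p.1 p.2) hne
  set R := sd I p.1 p.2 with hR
  have hR0 : 0 ≤ R := sd_nonneg I _ _
  have hRc : R ^ α ≤ pairCost I α 𝓑 :=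
    Finset.single_le_sum (f := fun p : ℕ × ℕ => sd I p.1 p.2 ^ α)
      (fun p _ => Real.rpow_nonneg (sd_nonneg I _ _) _) hp
  have hc0 := pairCost_nonneg (I := I) (α := α) 𝓑
  -- the relative enlargement of a ball that costs a factor of about `1 + 1 / (16 * e)` only
  set β : ℝ := 1 / (16 * e * α) with hβ
  have hβ0 : 0 < β := by positivity
  set D : ℝ := 4 * H * R / 2 ^ Λ with hD
  have hB0 := bound_zero (I := I) (H := H) (q := q) hα hm (D := D) (by positivity) hβ0
  have hG1 : 1 ≤ (1 + β) ^ α := Real.one_le_rpow (by linarith) (by linarith)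
  have hB := Bound.iterate (H := H) hα hm hq1 hH1 hg hK hG1
    (Real.rpow_nonneg (by positivity) _) Λ (D := 4 * H * R) hB0
  have hq0 : (0 : ℝ) ≤ 2 / q := by positivity
  -- The first carving, at the scale of `R`, brings the diameter down to `4 * H * R`.
  have h1 := solve_succ_le_of_small hα hm hq1 hH1 hg (by positivity)
    (mul_nonneg (by positivity) (Real.rpow_nonneg (by positivity) _)) hB subset_rfl h𝓑 hc
    (fun p' hp' => by
      have := hmax p' hp'
      gcongr)
  refine h1.trans ?_
  rw [Finset.card_range]
  have h2 : (1 + β) ^ α ≤ 1 + 2 * (1 / (16 * e)) := by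
    refine one_add_rpow_le hβ0.le (by linarith) (le_of_eq ?_) ?_
    · rw [hβ]
      field_simp
    · rw [div_le_one (by positivity)]
      linarith
  have h3 : (1 + 2 / (q : ℝ)) ^ (Λ + 1) ≤ 1 + 2 * (1 / (4 * e)) := by
    refine one_add_pow_le hq0 ?_ ?_
    · rw [hq]
      push_cast
      rw [mul_div_assoc', div_le_div_iff₀ (by positivity) (by positivity)]
      nlinarith
    · rw [div_le_one (by positivity)]
      linarith
  -- the additive error of all clients together is a small fraction of the largest ball
  have h4 : I.n * ((1 + 1 / β) * D) ^ α ≤ 1 / (8 * e) * R ^ α := by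
    have hpow : (32 * e * α) * (4 * H) * (8 * e * I.n) ≤ (2 : ℝ) ^ Λ := by
      have e1 : Λ ≤ 2 ^ (Λ / 2) := by
        have h5 : ∀ t, 5 ≤ t → 2 * t + 1 ≤ 2 ^ t := by
          intro t ht
          induction t, ht using Nat.le_induction with
          | base => norm_num
          | succ t ht ih =>
            rw [pow_succ]
            omega
        have := h5 (Λ / 2) (by omega)
        omega
      have e2 : a ≤ 2 ^ a := Nat.lt_two_pow_self.le
      have e3 : e ≤ 2 ^ e := Nat.lt_two_pow_self.le
      have e4 : ℓ + 1 ≤ 2 ^ ℓ := Nat.lt_two_pow_self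
      have e5 : (32 * e * a) * (4 * H) * (8 * e * I.n) ≤ 2 ^ Λ := by
        rw [hH, hq]
        calc (32 * e * a) * (4 * (16 * Λ * e * (ℓ + 1))) * (8 * e * I.n)
            = 2 ^ 14 * (Λ * a * (e * e * e) * (ℓ + 1) * I.n) := by ring
          _ ≤ 2 ^ 14 * (2 ^ (Λ / 2) * 2 ^ a * (2 ^ e * 2 ^ e * 2 ^ e) * 2 ^ ℓ * 2 ^ ℓ) := by gcongr
          _ = 2 ^ (14 + a + 2 * ℓ + 3 * e + Λ / 2) := by ring
          _ = 2 ^ Λ := by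
            congr 1
            omega
      have e6 : ((32 * e * a) * (4 * H) * (8 * e * I.n) : ℝ) ≤ 2 ^ Λ := by exact_mod_cast e5
      refine le_trans ?_ e6
      gcongr
    have hn0 : (1 : ℝ) ≤ I.n := by exact_mod_cast hn
    have e1 : (1 + 1 / β) * D ≤ 1 / (8 * e * I.n) * R := by
      have hb : 1 + 1 / β ≤ 32 * e * α := by
        rw [hβ, one_div_one_div]
        nlinarith [mul_le_mul he' hα zero_le_one (by linarith)]
      calc (1 + 1 / β) * D ≤ 32 * e * α * D := by gcongr
        _ = ((32 * e * α) * (4 * H) * (8 * e * I.n)) / 2 ^ Λ * (1 / (8 * e * I.n) * R) := by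
          rw [hD]
          field_simp
        _ ≤ 1 * (1 / (8 * e * I.n) * R) := by
          gcongr
          rw [div_le_one (by positivity)]
          exact hpow
        _ = _ := one_mul _
    have e2 : (1 / (8 * e * I.n : ℝ)) ^ α ≤ 1 / (8 * e * I.n) := by
      have := Real.rpow_le_rpow_of_exponent_ge (x := 1 / (8 * e * I.n : ℝ)) (by positivity) (by
        rw [div_le_one (by positivity)]
        nlinarith) hα
      rwa [Real.rpow_one] at this
    calc I.n * ((1 + 1 / β) * D) ^ α ≤ I.n * (1 / (8 * e * I.n) * R) ^ α := by
          gcongr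
      _ = I.n * ((1 / (8 * e * I.n)) ^ α * R ^ α) := by
          rw [Real.mul_rpow (by positivity) hR0]
      _ ≤ I.n * (1 / (8 * e * I.n) * R ^ α) := by gcongr
      _ = _ := by field_simp
  have h5 : (1 + β) ^ α * pairCost I α 𝓑 + I.n * ((1 + 1 / β) * D) ^ α ≤
      (1 + 1 / (4 * e)) * pairCost I α 𝓑 := by
    have e1 : (1 + β) ^ α * pairCost I α 𝓑 ≤ (1 + 2 * (1 / (16 * e))) * pairCost I α 𝓑 := by gcongr
    have e2 : 1 / (8 * e) * R ^ α ≤ 1 / (8 * e) * pairCost I α 𝓑 := by gcongr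
    have e3 : (1 + 1 / (4 * e)) * pairCost I α 𝓑 =
        (1 + 2 * (1 / (16 * e))) * pairCost I α 𝓑 + 1 / (8 * e) * pairCost I α 𝓑 := by
      field_simp
      ring
    linarith
  calc _ = (1 + 2 / (q : ℝ)) ^ (Λ + 1) *
        ((1 + β) ^ α * pairCost I α 𝓑 + I.n * ((1 + 1 / β) * D) ^ α) := by ring
    _ ≤ (1 + 2 * (1 / (4 * e))) * ((1 + 1 / (4 * e)) * pairCost I α 𝓑) := by gcongr
    _ = ((1 + 2 * (1 / (4 * e))) * (1 + 1 / (4 * e))) * pairCost I α 𝓑 := by ring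
    _ ≤ _ := by
      gcongr
      rw [show (1 + 2 * (1 / (4 * (e : ℝ)))) * (1 + 1 / (4 * e)) =
        1 + 1 / e * (3 / 4 + 1 / (8 * e)) by field_simp; ring]
      have e1 : 1 / (8 * (e : ℝ)) ≤ 1 / 8 := by
        apply one_div_le_one_div_of_le <;> linarith
      have e2 : (0 : ℝ) ≤ 1 / e := by positivity
      nlinarith

/-- Recursion depth zero is exact for a single client. -/
theorem solve_zero_le (hα : 1 ≤ α) (hm : 1 ≤ I.m) (hn : I.n ≤ 1) {𝓑 : Finset (ℕ × ℕ)}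
    (h𝓑 : 𝓑 ⊆ Finset.range I.m ×ˢ Finset.range I.n) (hc : Covers I 𝓑 (Finset.range I.n)) :
    (solve I α H q 0 (Finset.range I.n)).1 ≤ pairCost I α 𝓑 := by
  have := bound_zero_of_isolated (I := I) (H := H) (q := q) (D := 0) hα hm
    (fun x hx x' hx' _ => by omega) (Finset.range I.n) subset_rfl (fun x hx x' hx' => by
      rw [Finset.mem_range] at hx hx'
      obtain rfl : x = x' := by omega
      rw [entry_self]) 𝓑 h𝓑 hc
  simpa using this

/-! ### Covers and assignments -/

/-- Shrinking the balls of a cover until a client lies on their boundary. -/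
theorem exists_pair_cover (hα : 1 ≤ α) {B : Finset I.Ball} (hB : MCCInstance.IsCover B) :
    ∃ 𝓑 ⊆ Finset.range I.m ×ˢ Finset.range I.n, Covers I 𝓑 (Finset.range I.n) ∧
      pairCost I α 𝓑 ≤ MCCInstance.cost α B := by
  classical
  have hw : ∀ b : I.Ball, ∃ w : ℕ, (∃ x < I.n, sd I b.1 x ≤ b.2) →
      w < I.n ∧ sd I b.1 w ≤ b.2 ∧ ∀ x < I.n, sd I b.1 x ≤ b.2 → sd I b.1 x ≤ sd I b.1 w := by
    intro b
    by_cases h : ∃ x < I.n, sd I b.1 x ≤ b.2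
    · obtain ⟨x, hx, hx'⟩ := h
      obtain ⟨w, hw, hmax⟩ := ((Finset.range I.n).filter fun x => sd I b.1 x ≤ b.2).exists_max_image
        (fun x => sd I b.1 x) ⟨x, by simp [hx, hx']⟩
      simp only [Finset.mem_filter, Finset.mem_range] at hw hmax
      exact ⟨w, fun _ => ⟨hw.1, hw.2, fun x hx hx' => hmax x ⟨hx, hx'⟩⟩⟩
    · exact ⟨0, fun h' => absurd h' h⟩
  choose w hw using hw
  set B' := B.filter fun b => ∃ x < I.n, sd I b.1 x ≤ b.2 with hB'
  refine ⟨B'.image fun b => ((b.1 : ℕ), w b), ?_, ?_, ?_⟩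
  · intro p hp
    obtain ⟨b, hb, rfl⟩ := Finset.mem_image.1 hp
    simpa using (hw b (Finset.mem_filter.1 hb).2).1
  · intro x hx
    rw [Finset.mem_range] at hx
    obtain ⟨b, hb, hbx⟩ := hB ⟨x, hx⟩
    have h1 : sd I b.1 x ≤ b.2 := by rwa [sd_eq I b.1.2 hx]
    exact ⟨_, Finset.mem_image_of_mem _ (Finset.mem_filter.2 ⟨hb, x, hx, h1⟩),
      (hw b ⟨x, hx, h1⟩).2.2 x hx h1⟩
  · refine (Finset.sum_image_le_of_nonneg fun _ _ => Real.rpow_nonneg (sd_nonneg I _ _) _).trans ?_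
    refine (Finset.sum_le_sum fun b hb => ?_).trans (Finset.sum_le_sum_of_subset_of_nonneg
      (Finset.filter_subset _ B) fun b _ _ => Real.rpow_nonneg b.2.2 α)
    exact Real.rpow_le_rpow (sd_nonneg I _ _) (hw b (Finset.mem_filter.1 hb).2).2.1 (by linarith)

/-- An upper bound in terms of all covers by balls with clients on the boundary is an upper bound in
terms of the optimum. -/
theorem le_opt (hα : 1 ≤ α) (hm : 1 ≤ I.m) {v c : ℝ} (hc : 0 < c)
    (h : ∀ 𝓑 ⊆ Finset.range I.m ×ˢ Finset.range I.n, Covers I 𝓑 (Finset.range I.n) →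
      v ≤ c * pairCost I α 𝓑) : v ≤ c * I.opt α := by
  rw [mul_comm, ← div_le_iff₀ hc]
  refine le_csInf ?_ ?_
  · refine ⟨_, Finset.univ.image fun i : Fin I.n => ((⟨0, hm⟩ : Fin I.m),
      (⟨dist (I.server ⟨0, hm⟩) (I.client i), dist_nonneg⟩ : ℝ≥0)), fun i => ?_, rfl⟩
    exact ⟨_, Finset.mem_image_of_mem _ (Finset.mem_univ i), le_rfl⟩
  · rintro _ ⟨B, hB, rfl⟩
    obtain ⟨𝓑, h1, h2, h3⟩ := exists_pair_cover hα hB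
    rw [div_le_iff₀ hc, mul_comm]
    exact (h 𝓑 h1 h2).trans (by gcongr)

open Classical in
/-- The set of balls given by an assignment; clients that are assigned no server are ignored. -/
def ballsOf (I : MCCInstance) (r : ℕ → ℕ × ℕ) : Finset I.Ball :=
  Finset.univ.biUnion fun i : Fin I.n => if h : (r i).1 < I.m then
    {((⟨(r i).1, h⟩, (sd I (r i).1 (r i).2).toNNReal) : I.Ball)} else ∅

theorem mem_ballsOf {r : ℕ → ℕ × ℕ} (hr : ∀ x < I.n, (r x).1 < I.m) {b : I.Ball} :
    b ∈ ballsOf I r ↔ ∃ x < I.n, (b.1 : ℕ) = (r x).1 ∧ (b.2 : ℝ) = sd I (r x).1 (r x).2 := by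
  classical
  simp only [ballsOf, Finset.mem_biUnion, Finset.mem_univ, true_and]
  constructor
  · rintro ⟨i, hi⟩
    rw [dif_pos (hr i i.2), Finset.mem_singleton] at hi
    subst hi
    exact ⟨i, i.2, rfl, Real.coe_toNNReal _ (sd_nonneg I _ _)⟩
  · rintro ⟨x, hx, h1, h2⟩
    refine ⟨⟨x, hx⟩, ?_⟩
    rw [dif_pos (hr x hx), Finset.mem_singleton]
    exact Prod.ext (Fin.ext h1) (NNReal.eq (h2.trans (Real.coe_toNNReal _ (sd_nonneg I _ _)).symm))

/-- The balls of a valid assignment form a cover of the promised cost, and they are listed by the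
clients. -/
theorem ballsOf_spec {r : ℝ × (ℕ → ℕ × ℕ)} (hr : Valid I α (Finset.range I.n) r) :
    MCCInstance.IsCover (ballsOf I r.2) ∧ MCCInstance.cost α (ballsOf I r.2) ≤ r.1 ∧
      {p : ℕ × ℝ | ∃ b ∈ ballsOf I r.2, p = ((b.1 : ℕ), (b.2 : ℝ))} =
        {p : ℕ × ℝ | ∃ j < I.n, p = ((r.2 j).1, sd I (r.2 j).1 (r.2 j).2)} := by
  classical
  obtain ⟨h1, h2⟩ := hr
  have hm : ∀ x < I.n, (r.2 x).1 < I.m := fun x hx => (h1 x (Finset.mem_range.2 hx)).1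
  have hmem := fun b => mem_ballsOf (b := b) hm
  refine ⟨fun i => ?_, ?_, ?_⟩
  · refine ⟨((⟨(r.2 i).1, hm i i.2⟩ : Fin I.m),
      (⟨sd I (r.2 i).1 (r.2 i).2, sd_nonneg I _ _⟩ : ℝ≥0)), (hmem _).2 ⟨i, i.2, rfl, rfl⟩, ?_⟩
    have := (h1 i (Finset.mem_range.2 i.2)).2.2
    rwa [sd_eq I (hm i i.2) i.2] at this
  · refine le_trans ?_ h2
    have hsub : (ballsOf I r.2).image (fun b => ((b.1 : ℕ), (b.2 : ℝ))) ⊆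
        ((Finset.range I.n).image r.2).image (fun p => (p.1, sd I p.1 p.2)) := by
      intro p hp
      obtain ⟨b, hb, rfl⟩ := Finset.mem_image.1 hp
      obtain ⟨x, hx, e1, e2⟩ := (hmem b).1 hb
      rw [e1, e2]
      exact Finset.mem_image_of_mem _ (Finset.mem_image_of_mem _ (Finset.mem_range.2 hx))
    calc MCCInstance.cost α (ballsOf I r.2) =
          ∑ p ∈ (ballsOf I r.2).image (fun b => ((b.1 : ℕ), (b.2 : ℝ))), max p.2 0 ^ α := by
          rw [Finset.sum_image]
          · exact Finset.sum_congr rfl fun b _ =>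
              congrArg (· ^ α) (max_eq_left b.2.coe_nonneg).symm
          · intro b _ b' _ h
            exact Prod.ext (Fin.ext (Prod.ext_iff.1 h).1) (NNReal.eq (Prod.ext_iff.1 h).2)
      _ ≤ ∑ p ∈ ((Finset.range I.n).image r.2).image (fun p => (p.1, sd I p.1 p.2)),
            max p.2 0 ^ α :=
          Finset.sum_le_sum_of_subset_of_nonneg hsub fun _ _ _ =>
            Real.rpow_nonneg (le_max_right _ _) _
      _ ≤ ∑ p ∈ (Finset.range I.n).image r.2, max (sd I p.1 p.2) 0 ^ α :=
          Finset.sum_image_le_of_nonneg (f := fun p : ℕ × ℝ => max p.2 0 ^ α)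
            fun _ _ => Real.rpow_nonneg (le_max_right _ _) _
      _ = _ := Finset.sum_congr rfl fun p _ => by rw [max_eq_left (sd_nonneg I _ _)]
  · ext p
    simp only [Set.mem_ofPred_eq]
    constructor
    · rintro ⟨b, hb, rfl⟩
      obtain ⟨x, hx, e1, e2⟩ := (hmem b).1 hb
      exact ⟨x, hx, by rw [e1, e2]⟩
    · rintro ⟨j, hj, rfl⟩
      exact ⟨((⟨(r.2 j).1, hm j hj⟩ : Fin I.m),
        (⟨sd I (r.2 j).1 (r.2 j).2, sd_nonneg I _ _⟩ : ℝ≥0)), (hmem _).2 ⟨j, hj, rfl, rfl⟩, rfl⟩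

end Analysis

/-! ### Working memory and program logic for the machine -/

open RealRAM

/-- The working memory: arrays of natural numbers (with numbers below 32) and arrays of real numbers
(with numbers below 8).

The integer arrays `0`, …, `5` hold one entry per recursion depth and client: the set of clients to
be covered, the clients not yet carved, server and boundary client of the best solution, and server
and boundary client of the solution that is being carved. The integer arrays `6`, …, `10` hold one
entry per recursion depth: current server, current boundary client, carving centre, radius index and
best radius index. The arrays `11`, …, `19` hold temporary values, and the arrays from `20` on
global ones: recursion depth, `H`, `q`, and the numbers from which these are computed. The real
arrays `0`, …, `3` hold one entry per recursion depth: cost of the best solution, cost of the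
solution that is being carved, last value and smallest excess of the scan; the remaining ones are
temporary. -/
@[ext] structure Mem where
  a : ℕ → ℕ → ℕ
  r : ℕ → ℕ → ℝ

/-- Everything that stays fixed during a computation. -/
structure Env where
  I : MCCInstance
  α : ℝ
  ε : ℝ
  ω : Tape
  procs : List Stmt

/-- Writing into an array of natural numbers. -/
def Mem.setA (σ : Mem) (q i v : ℕ) : Mem :=
  { σ with a := fun q' i' => if q' = q ∧ i' = i then v else σ.a q' i' }

/-- Writing into an array of real numbers. -/
def Mem.setR (σ : Mem) (q i : ℕ) (v : ℝ) : Mem :=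
  { σ with r := fun q' i' => if q' = q ∧ i' = i then v else σ.r q' i' }

@[simp] theorem Mem.setA_a (σ : Mem) (q i v q' i' : ℕ) :
    (σ.setA q i v).a q' i' = if q' = q ∧ i' = i then v else σ.a q' i' := rfl

@[simp] theorem Mem.setA_r (σ : Mem) (q i v : ℕ) : (σ.setA q i v).r = σ.r := rfl

@[simp] theorem Mem.setR_a (σ : Mem) (q i : ℕ) (v : ℝ) : (σ.setR q i v).a = σ.a := rfl

@[simp] theorem Mem.setR_r (σ : Mem) (q i : ℕ) (v : ℝ) (q' i' : ℕ) :
    (σ.setR q i v).r q' i' = if q' = q ∧ i' = i then v else σ.r q' i' := rfl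

/-- The machine state that holds the input and the working memory `σ`. The integer arrays are
interleaved from address `n + 2` on, so that the cells `0`, …, `n` remain free for the output; the
real arrays are interleaved behind the distance matrix. No random number has been drawn. -/
def conc (Γ : Env) (σ : Mem) : State where
  nat c := if c = 0 then Γ.I.n else if c = 1 then Γ.I.m else if c < Γ.I.n + 2 then 0
    else σ.a ((c - (Γ.I.n + 2)) % 32) ((c - (Γ.I.n + 2)) / 32)
  real c := if c < (Γ.I.n + Γ.I.m) * (Γ.I.n + Γ.I.m) + 2 then (Γ.I.input Γ.α Γ.ε).real c
    else σ.r ((c - ((Γ.I.n + Γ.I.m) * (Γ.I.n + Γ.I.m) + 2)) % 8)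
      ((c - ((Γ.I.n + Γ.I.m) * (Γ.I.n + Γ.I.m) + 2)) / 8)
  drawn := 0

/-- The number of clients. -/
def nN : NExpr := .mem (.const 0)
/-- The number of servers. -/
def nM : NExpr := .mem (.const 1)
/-- The number of points. -/
def nP : NExpr := .add nN nM
/-- The address of a cell of an integer array. -/
def addrA (q : ℕ) (e : NExpr) : NExpr := .add (.add nN (.const (q + 2))) (.mul (.const 32) e)
/-- The address of a cell of a real array. -/
def addrR (q : ℕ) (e : NExpr) : NExpr :=
  .add (.add (.mul nP nP) (.const (q + 2))) (.mul (.const 8) e)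
/-- A cell of an integer array. -/
def A (q : ℕ) (e : NExpr) : NExpr := .mem (addrA q e)
/-- A cell of a real array. -/
def R (q : ℕ) (e : NExpr) : RExpr := .mem (addrR q e)
/-- An entry of the distance matrix. -/
def entryE (e f : NExpr) : RExpr := .mem (.add (.const 2) (.add (.mul e nP) f))
/-- The distance between a server and a client. -/
def sdE (y x : NExpr) : RExpr := entryE (.add nN y) x
/-- Assignment to a cell of an integer array. -/
def putA (q : ℕ) (i e : NExpr) : Stmt := .setN (addrA q i) e
/-- Assignment to a cell of a real array. -/
def putR (q : ℕ) (i : NExpr) (e : RExpr) : Stmt := .setR (addrR q i) e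
/-- The real number zero. -/
def zeroE : RExpr := .cast (.const 0)
/-- Strict comparison of integers. -/
def ltN (e f : NExpr) : Test := .leN (.add e (.const 1)) f
/-- Strict comparison of reals. -/
def ltR (e f : RExpr) : Test := .not (.leR f e)
/-- Disjunction of tests. -/
def orT (b c : Test) : Test := .not (.and (.not b) (.not c))
/-- A loop in which cell `i` of array `q` counts from `0` up to the bound. -/
def forL (q : ℕ) (i bound : NExpr) (body : Stmt) : Stmt :=
  .seq (putA q i (.const 0))
    (.while (ltN (A q i) bound) (.seq body (putA q i (.add (A q i) (.const 1)))))

section Eval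

variable {Γ : Env} {σ : Mem}

theorem conc_nat_addr (q i : ℕ) (hq : q < 32) :
    (conc Γ σ).nat (Γ.I.n + (q + 2) + 32 * i) = σ.a q i := by
  simp only [conc]
  rw [if_neg (by omega), if_neg (by omega), if_neg (by omega)]
  congr 1 <;> omega

theorem conc_real_addr (q i : ℕ) (hq : q < 8) :
    (conc Γ σ).real ((Γ.I.n + Γ.I.m) * (Γ.I.n + Γ.I.m) + (q + 2) + 8 * i) = σ.r q i := by
  simp only [conc]
  rw [if_neg (by omega)]
  congr 1 <;> omega

@[simp] theorem eval_const (k : ℕ) : (NExpr.const k).eval (conc Γ σ) = k := rfl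

@[simp] theorem eval_nN : nN.eval (conc Γ σ) = Γ.I.n := rfl

@[simp] theorem eval_nM : nM.eval (conc Γ σ) = Γ.I.m := rfl

@[simp] theorem eval_add (s : State) (e f : NExpr) :
    (NExpr.add e f).eval s = e.eval s + f.eval s := rfl

@[simp] theorem eval_sub (s : State) (e f : NExpr) :
    (NExpr.sub e f).eval s = e.eval s - f.eval s := rfl

@[simp] theorem eval_mul (s : State) (e f : NExpr) :
    (NExpr.mul e f).eval s = e.eval s * f.eval s := rfl

@[simp] theorem eval_A {q : ℕ} {e : NExpr} (hq : q < 32) :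
    (A q e).eval (conc Γ σ) = σ.a q (e.eval (conc Γ σ)) :=
  conc_nat_addr q _ hq

@[simp] theorem eval_R {α : ℝ} {q : ℕ} {e : NExpr} (hq : q < 8) :
    (R q e).eval α (conc Γ σ) = σ.r q (e.eval (conc Γ σ)) :=
  conc_real_addr q _ hq

theorem eval_entryE {α : ℝ} {e f : NExpr} (he : e.eval (conc Γ σ) < Γ.I.n + Γ.I.m)
    (hf : f.eval (conc Γ σ) < Γ.I.n + Γ.I.m) :
    (entryE e f).eval α (conc Γ σ) = Γ.I.entry (e.eval (conc Γ σ)) (f.eval (conc Γ σ)) := by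
  change (conc Γ σ).real (2 + (e.eval (conc Γ σ) * (Γ.I.n + Γ.I.m) + f.eval (conc Γ σ))) = _
  set i := e.eval (conc Γ σ)
  set j := f.eval (conc Γ σ)
  have h1 : i * (Γ.I.n + Γ.I.m) + j < (Γ.I.n + Γ.I.m) * (Γ.I.n + Γ.I.m) := by
    have := Nat.mul_le_mul_right (Γ.I.n + Γ.I.m) he
    rw [Nat.succ_mul] at this
    omega
  simp only [conc, MCCInstance.input]
  rw [if_pos (by omega), if_neg (by omega), if_neg (by omega), Nat.add_sub_cancel_left]
  congr 1
  · rw [mul_comm, Nat.mul_add_div (by omega), Nat.div_eq_of_lt hf, add_zero]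
  · rw [mul_comm, Nat.mul_add_mod, Nat.mod_eq_of_lt hf]

theorem eval_sdE {α : ℝ} {y x : NExpr} (hy : y.eval (conc Γ σ) < Γ.I.m)
    (hx : x.eval (conc Γ σ) < Γ.I.n) :
    (sdE y x).eval α (conc Γ σ) = sd Γ.I (y.eval (conc Γ σ)) (x.eval (conc Γ σ)) :=
  eval_entryE (e := .add nN y) (f := x) (by simpa using hy) (by omega)

@[simp] theorem evalR_cast (α : ℝ) (s : State) (e : NExpr) :
    (RExpr.cast e).eval α s = (e.eval s : ℝ) := rfl

@[simp] theorem evalR_add (α : ℝ) (s : State) (e f : RExpr) :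
    (RExpr.add e f).eval α s = e.eval α s + f.eval α s := rfl

@[simp] theorem evalR_sub (α : ℝ) (s : State) (e f : RExpr) :
    (RExpr.sub e f).eval α s = e.eval α s - f.eval α s := rfl

@[simp] theorem evalR_mul (α : ℝ) (s : State) (e f : RExpr) :
    (RExpr.mul e f).eval α s = e.eval α s * f.eval α s := rfl

@[simp] theorem evalR_pow (α : ℝ) (s : State) (e : RExpr) :
    (RExpr.pow e).eval α s = max (e.eval α s) 0 ^ α := rfl

@[simp] theorem evalR_zeroE (α : ℝ) (s : State) : zeroE.eval α s = 0 := Nat.cast_zero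

@[simp] theorem holds_leN (α : ℝ) (s : State) (e f : NExpr) :
    (Test.leN e f).Holds α s ↔ e.eval s ≤ f.eval s := Iff.rfl

@[simp] theorem holds_leR (α : ℝ) (s : State) (e f : RExpr) :
    (Test.leR e f).Holds α s ↔ e.eval α s ≤ f.eval α s := Iff.rfl

@[simp] theorem holds_not (α : ℝ) (s : State) (b : Test) :
    (Test.not b).Holds α s ↔ ¬ b.Holds α s := Iff.rfl

@[simp] theorem holds_and (α : ℝ) (s : State) (b c : Test) :
    (Test.and b c).Holds α s ↔ b.Holds α s ∧ c.Holds α s := Iff.rfl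

@[simp] theorem holds_ltN (α : ℝ) (s : State) (e f : NExpr) :
    (ltN e f).Holds α s ↔ e.eval s < f.eval s := Iff.rfl

@[simp] theorem holds_ltR (α : ℝ) (s : State) (e f : RExpr) :
    (ltR e f).Holds α s ↔ e.eval α s < f.eval α s := not_le

@[simp] theorem holds_orT (α : ℝ) (s : State) (b c : Test) :
    (orT b c).Holds α s ↔ b.Holds α s ∨ c.Holds α s := by
  simp [orT, or_iff_not_and_not]

end Eval

/-- Upper bound for the time of a statement without loops and calls. -/
def flat : Stmt → ℕ
  | .skip => 1
  | .setN a e => a.size + e.size + 1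
  | .setR a e => a.size + e.size + 1
  | .draw a => a.size + 1
  | .seq p q => flat p + flat q
  | .ite b p q => b.size + max (flat p) (flat q) + 1
  | .while _ _ => 0
  | .call _ => 0

/-- Started with working memory `σ`, the statement `p` halts within `T` steps with working memory
`σ'`. -/
def Run (Γ : Env) (p : Stmt) (σ : Mem) (T : ℕ) (σ' : Mem) : Prop :=
  ∃ t ≤ T, Exec Γ.α Γ.ω Γ.procs p (conc Γ σ) t (conc Γ σ')

section Rules

variable {Γ : Env} {σ σ₁ σ₂ : Mem} {T U : ℕ}

theorem Run.mono {p : Stmt} (h : Run Γ p σ T σ₁) (hT : T ≤ U) : Run Γ p σ U σ₁ := by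
  obtain ⟨t, ht, h⟩ := h
  exact ⟨t, ht.trans hT, h⟩

theorem Run.congr {p : Stmt} (h : Run Γ p σ T σ₁) (e : σ₁ = σ₂) : Run Γ p σ T σ₂ := e ▸ h

theorem Run.skip : Run Γ .skip σ 1 σ := ⟨1, le_rfl, Exec.skip _⟩

theorem conc_setA (q i v : ℕ) (hq : q < 32) : { conc Γ σ with
    nat := Function.update (conc Γ σ).nat (Γ.I.n + (q + 2) + 32 * i) v } =
      conc Γ (σ.setA q i v) := by
  simp only [conc, State.mk.injEq, Mem.setA_r, and_true]
  funext c
  rcases eq_or_ne c (Γ.I.n + (q + 2) + 32 * i) with rfl | hc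
  · rw [Function.update_self, if_neg (by omega), if_neg (by omega), if_neg (by omega),
      Mem.setA_a, if_pos (by omega)]
  · rw [Function.update_of_ne hc, Mem.setA_a]
    split_ifs
    · rfl
    · rfl
    · rfl
    · omega
    · rfl

theorem conc_setR (q i : ℕ) (v : ℝ) (hq : q < 8) : { conc Γ σ with
    real := Function.update (conc Γ σ).real
      ((Γ.I.n + Γ.I.m) * (Γ.I.n + Γ.I.m) + (q + 2) + 8 * i) v } =
      conc Γ (σ.setR q i v) := by
  simp only [conc, State.mk.injEq, Mem.setR_a, and_true, true_and]
  funext c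
  rcases eq_or_ne c ((Γ.I.n + Γ.I.m) * (Γ.I.n + Γ.I.m) + (q + 2) + 8 * i) with rfl | hc
  · rw [Function.update_self, if_neg (by omega), Mem.setR_r, if_pos (by omega)]
  · rw [Function.update_of_ne hc, Mem.setR_r]
    split_ifs
    · rfl
    · omega
    · rfl

theorem Run.putA {q : ℕ} {i e : NExpr} (hq : q < 32) : Run Γ (putA q i e) σ
    (flat (putA q i e)) (σ.setA q (i.eval (conc Γ σ)) (e.eval (conc Γ σ))) := by
  refine ⟨_, le_rfl, ?_⟩
  rw [← conc_setA _ _ _ hq]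
  exact Exec.setN _ _ _

theorem Run.putR {q : ℕ} {i : NExpr} {e : RExpr} (hq : q < 8) : Run Γ (putR q i e) σ
    (flat (putR q i e)) (σ.setR q (i.eval (conc Γ σ)) (e.eval Γ.α (conc Γ σ))) := by
  refine ⟨_, le_rfl, ?_⟩
  rw [← conc_setR _ _ _ hq]
  exact Exec.setR _ _ _

theorem Run.seq {p p' : Stmt} (h : Run Γ p σ T σ₁) (h' : Run Γ p' σ₁ U σ₂) :
    Run Γ (.seq p p') σ (T + U) σ₂ := by
  obtain ⟨t, ht, h⟩ := h
  obtain ⟨u, hu, h'⟩ := h'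
  exact ⟨t + u, by omega, Exec.seq h h'⟩

theorem Run.ite_pos {b : Test} {p p' : Stmt} (hb : b.Holds Γ.α (conc Γ σ)) (h : Run Γ p σ T σ₁) :
    Run Γ (.ite b p p') σ (b.size + T + 1) σ₁ := by
  obtain ⟨t, ht, h⟩ := h
  exact ⟨_, by omega, Exec.ite_true hb h⟩

theorem Run.ite_neg {b : Test} {p p' : Stmt} (hb : ¬ b.Holds Γ.α (conc Γ σ))
    (h : Run Γ p' σ T σ₁) : Run Γ (.ite b p p') σ (b.size + T + 1) σ₁ := by
  obtain ⟨t, ht, h⟩ := h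
  exact ⟨_, by omega, Exec.ite_false hb h⟩

theorem Run.call {j : ℕ} {p : Stmt} (hp : Γ.procs[j]? = some p) (h : Run Γ p σ T σ₁) :
    Run Γ (.call j) σ (T + 1) σ₁ := by
  obtain ⟨t, ht, h⟩ := h
  exact ⟨t + 1, by omega, Exec.call hp h⟩

/-- The time spent on the administration of a counting loop, per iteration. -/
def forTime (q : ℕ) (i bound : NExpr) : ℕ :=
  flat (putA q i (.const 0)) + flat (putA q i (.add (A q i) (.const 1))) +
    (ltN (A q i) bound).size + 1

/-- Loops with an invariant and a variant. -/
theorem while_rule {b : Test} {p : Stmt} {Inv : ℕ → Mem → Prop} {N : ℕ}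
    (hb : ∀ z ≤ N, ∀ σ, Inv z σ → (b.Holds Γ.α (conc Γ σ) ↔ z < N))
    (hp : ∀ z < N, ∀ σ, Inv z σ → ∃ σ', Run Γ p σ T σ' ∧ Inv (z + 1) σ') {z : ℕ} (hz : z ≤ N)
    (hσ : Inv z σ) : ∃ σ', Run Γ (.while b p) σ ((N - z) * (b.size + T + 1) + (b.size + 1)) σ' ∧
      Inv N σ' := by
  induction hd : N - z generalizing z σ with
  | zero =>
    obtain rfl : z = N := by omega
    refine ⟨σ, ⟨b.size + 1, by omega, Exec.while_false ?_⟩, hσ⟩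
    rw [hb z le_rfl σ hσ]
    omega
  | succ d ih =>
    obtain ⟨σ', ⟨t, ht, h1⟩, h2⟩ := hp z (by omega) σ hσ
    obtain ⟨σ'', ⟨u, hu, h3⟩, h4⟩ := ih (z := z + 1) (by omega) h2 (by omega)
    refine ⟨σ'', ⟨_, ?_, Exec.while_true ((hb z hz σ hσ).2 (by omega)) h1 h3⟩, h4⟩
    rw [Nat.succ_mul]
    omega

/-- Counting loops with an invariant. -/
theorem for_rule {q : ℕ} {i bound : NExpr} {body : Stmt} {Inv : ℕ → Mem → Prop} {N j : ℕ}
    (hq : q < 32) (hT : T + forTime q i bound ≤ U) (h0 : Inv 0 (σ.setA q (i.eval (conc Γ σ)) 0))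
    (hI : ∀ z σ, Inv z σ → i.eval (conc Γ σ) = j ∧ bound.eval (conc Γ σ) = N ∧ σ.a q j = z)
    (hb : ∀ z < N, ∀ σ, Inv z σ → ∃ σ', Run Γ body σ T σ' ∧ i.eval (conc Γ σ') = j ∧
      σ'.a q j = z ∧ Inv (z + 1) (σ'.setA q j (z + 1))) :
    ∃ σ', Run Γ (forL q i bound body) σ ((N + 1) * U) σ' ∧ Inv N σ' := by
  obtain ⟨σ', h1, h2⟩ := while_rule (Γ := Γ) (b := ltN (A q i) bound)
    (p := .seq body (CoverAlg.putA q i (.add (A q i) (.const 1)))) (Inv := Inv) (N := N)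
    (T := T + flat (CoverAlg.putA q i (.add (A q i) (.const 1)))) (fun z hz σ hσ => by
      obtain ⟨e1, e2, e3⟩ := hI z σ hσ
      simp [hq, e1, e2, e3]) (fun z hz σ hσ => by
      obtain ⟨σ', e1, e2, e3, e4⟩ := hb z hz σ hσ
      refine ⟨_, e1.seq (Run.putA hq), ?_⟩
      simpa [hq, e2, e3] using e4) (Nat.zero_le N) h0
  refine ⟨σ', ((Run.putA hq).seq h1).mono (le_trans ?_ (Nat.mul_le_mul_left (N + 1) hT)), h2⟩
  simp only [Nat.sub_zero, forTime]
  ring_nf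
  omega

end Rules

/-- Working memory in which the first `z` entries behind address `b` of the arrays in `As` are given
by `G`. -/
def fillMem (σ : Mem) (As : List ℕ) (b : ℕ) (G : ℕ → ℕ → ℕ) (z : ℕ) : Mem :=
  { σ with a := fun q j => if q ∈ As ∧ b ≤ j ∧ j < b + z then G q (j - b) else σ.a q j }

@[simp] theorem fillMem_a (σ : Mem) (As : List ℕ) (b : ℕ) (G : ℕ → ℕ → ℕ) (z q j : ℕ) :
    (fillMem σ As b G z).a q j = if q ∈ As ∧ b ≤ j ∧ j < b + z then G q (j - b) else σ.a q j := rfl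

@[simp] theorem fillMem_r (σ : Mem) (As : List ℕ) (b : ℕ) (G : ℕ → ℕ → ℕ) (z : ℕ) :
    (fillMem σ As b G z).r = σ.r := rfl

/-- A loop over all clients, counted by array `11`. -/
def fillL (body : Stmt) : Stmt := forL 11 (.const 0) nN body

/-- The current client in `fillL`. -/
def zE : NExpr := A 11 (.const 0)

/-- The working memory during a run of `fillL` that fills the arrays in `As`. -/
def fs (σ : Mem) (As : List ℕ) (b : ℕ) (G : ℕ → ℕ → ℕ) (z : ℕ) : Mem :=
  (fillMem σ As b G z).setA 11 0 z

@[simp] theorem fs_a (σ : Mem) (As : List ℕ) (b : ℕ) (G : ℕ → ℕ → ℕ) (z q j : ℕ) :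
    (fs σ As b G z).a q j = if q = 11 ∧ j = 0 then z else
      if q ∈ As ∧ b ≤ j ∧ j < b + z then G q (j - b) else σ.a q j := rfl

@[simp] theorem fs_r (σ : Mem) (As : List ℕ) (b : ℕ) (G : ℕ → ℕ → ℕ) (z : ℕ) :
    (fs σ As b G z).r = σ.r := rfl

/-- A loop over all clients whose body writes one entry of each of the arrays in `As`. -/
theorem fill_rule {Γ : Env} {σ : Mem} {T U : ℕ} {body : Stmt} (As : List ℕ) (b : ℕ)
    (G : ℕ → ℕ → ℕ) (hT : T + forTime 11 (.const 0) nN ≤ U)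
    (h : ∀ z < Γ.I.n, Run Γ body (fs σ As b G z) T ((fillMem σ As b G (z + 1)).setA 11 0 z)) :
    Run Γ (fillL body) σ ((Γ.I.n + 1) * U) (fs σ As b G Γ.I.n) := by
  obtain ⟨σ', h1, h2⟩ := for_rule (Γ := Γ) (σ := σ) (T := T) (q := 11) (i := .const 0) (bound := nN)
    (body := body) (Inv := fun z σ' => σ' = fs σ As b G z) (N := Γ.I.n) (j := 0)
    (by norm_num) hT (by
      ext q j
      · simp only [Mem.setA_a, fs_a, eval_const]
        grind
      · rfl) (by
      rintro z _ rfl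
      simp) (by
      rintro z hz _ rfl
      refine ⟨_, h z hz, by simp, by simp, ?_⟩
      ext q j
      · simp only [Mem.setA_a, fs_a, fillMem_a]
        grind
      · rfl)
  rw [h2] at h1
  exact h1

/-- The loop body of `fillL` that writes one array. -/
theorem put_run₁ {Γ : Env} {σ : Mem} {q b z : ℕ} {G : ℕ → ℕ → ℕ} {i e : NExpr} (hq : q < 32)
    (hq' : q ≠ 11) (hi : i.eval (conc Γ (fs σ [q] b G z)) = b + z)
    (he : e.eval (conc Γ (fs σ [q] b G z)) = G q z) :
    Run Γ (putA q i e) (fs σ [q] b G z) (flat (putA q i e))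
      ((fillMem σ [q] b G (z + 1)).setA 11 0 z) := by
  have h := Run.putA (Γ := Γ) (σ := fs σ [q] b G z) (i := i) (e := e) hq
  rw [hi, he] at h
  refine h.congr ?_
  ext q' j
  · simp only [Mem.setA_a, fillMem_a, fs_a, List.mem_singleton]
    grind
  · rfl

/-- The loop body of `fillL` that writes two arrays. -/
theorem put_run₂ {Γ : Env} {σ : Mem} {q q' b z : ℕ} {G : ℕ → ℕ → ℕ} {i e e' : NExpr}
    (hq : q < 32 ∧ q ≠ 11) (hq' : q' < 32 ∧ q' ≠ 11) (hqq : q ≠ q')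
    (hi : i.eval (conc Γ (fs σ [q, q'] b G z)) = b + z)
    (he : e.eval (conc Γ (fs σ [q, q'] b G z)) = G q z)
    (hi' : i.eval (conc Γ ((fs σ [q, q'] b G z).setA q (b + z) (G q z))) = b + z)
    (he' : e'.eval (conc Γ ((fs σ [q, q'] b G z).setA q (b + z) (G q z))) = G q' z) :
    Run Γ (.seq (putA q i e) (putA q' i e')) (fs σ [q, q'] b G z)
      (flat (.seq (putA q i e) (putA q' i e')))
      ((fillMem σ [q, q'] b G (z + 1)).setA 11 0 z) := by
  have h := Run.putA (Γ := Γ) (σ := fs σ [q, q'] b G z) (i := i) (e := e) hq.1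
  rw [hi, he] at h
  have h' := Run.putA (Γ := Γ) (σ := (fs σ [q, q'] b G z).setA q (b + z) (G q z)) (i := i)
    (e := e') hq'.1
  rw [hi', he'] at h'
  refine Run.congr (h.seq h') ?_
  ext q' j
  · simp only [Mem.setA_a, fillMem_a, fs_a, List.mem_cons, List.not_mem_nil]
    grind
  · rfl

/-- The loop body of `fillL` that writes three arrays. -/
theorem put_run₃ {Γ : Env} {σ : Mem} {q q' q'' b z : ℕ} {G : ℕ → ℕ → ℕ} {i e e' e'' : NExpr}
    (hq : q < 32 ∧ q ≠ 11) (hq' : q' < 32 ∧ q' ≠ 11) (hq'' : q'' < 32 ∧ q'' ≠ 11)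
    (h₁ : q ≠ q') (h₂ : q ≠ q'') (h₃ : q' ≠ q'')
    (hi : i.eval (conc Γ (fs σ [q, q', q''] b G z)) = b + z)
    (he : e.eval (conc Γ (fs σ [q, q', q''] b G z)) = G q z)
    (hi' : i.eval (conc Γ ((fs σ [q, q', q''] b G z).setA q (b + z) (G q z))) = b + z)
    (he' : e'.eval (conc Γ ((fs σ [q, q', q''] b G z).setA q (b + z) (G q z))) = G q' z)
    (hi'' : i.eval (conc Γ (((fs σ [q, q', q''] b G z).setA q (b + z) (G q z)).setA
      q' (b + z) (G q' z))) = b + z)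
    (he'' : e''.eval (conc Γ (((fs σ [q, q', q''] b G z).setA q (b + z) (G q z)).setA
      q' (b + z) (G q' z))) = G q'' z) :
    Run Γ (.seq (putA q i e) (.seq (putA q' i e') (putA q'' i e''))) (fs σ [q, q', q''] b G z)
      (flat (.seq (putA q i e) (.seq (putA q' i e') (putA q'' i e''))))
      ((fillMem σ [q, q', q''] b G (z + 1)).setA 11 0 z) := by
  have h := Run.putA (Γ := Γ) (σ := fs σ [q, q', q''] b G z) (i := i) (e := e) hq.1
  rw [hi, he] at h
  have h' := Run.putA (Γ := Γ) (σ := (fs σ [q, q', q''] b G z).setA q (b + z) (G q z)) (i := i)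
    (e := e') hq'.1
  rw [hi', he'] at h'
  have h'' := Run.putA (Γ := Γ) (σ := ((fs σ [q, q', q''] b G z).setA q (b + z) (G q z)).setA
    q' (b + z) (G q' z)) (i := i) (e := e'') hq''.1
  rw [hi'', he''] at h''
  refine Run.congr (h.seq (h'.seq h'')) ?_
  ext q' j
  · simp only [Mem.setA_a, fillMem_a, fs_a, List.mem_cons, List.not_mem_nil]
    grind
  · rfl

/-- The initial state of the machine is the one with empty working memory. -/
theorem input_eq (I : MCCInstance) (α ε : ℝ) (ω : Tape) (procs : List Stmt) (hm : 1 ≤ I.m) :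
    I.input α ε = conc ⟨I, α, ε, ω, procs⟩ ⟨fun _ _ => 0, fun _ _ => 0⟩ := by
  simp only [conc, MCCInstance.input, State.mk.injEq, and_true]
  constructor
  · funext c
    split_ifs <;> rfl
  · funext c
    split_ifs with h1 h2 h3 h4
    · rfl
    · omega
    · rfl
    · omega
    · rfl
    · rw [MCCInstance.entry, dif_neg]
      rintro ⟨h, -⟩
      rw [Nat.div_lt_iff_lt_mul (by omega)] at h
      omega

/-! ### The program of the recursive algorithm -/

/-- The current recursion depth. -/
def kE : NExpr := A 20 (.const 0)
/-- The recursion depth of the recursive calls. -/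
def kE' : NExpr := .sub kE (.const 1)
/-- The number of radii that are tried in a carving step. -/
def hE : NExpr := A 21 (.const 0)
/-- The inverse of the growth that is tolerated in a carving step. -/
def qE : NExpr := A 22 (.const 0)
/-- The position of the current client in the frame of the current call. -/
def own : NExpr := .add (.mul kE nN) zE
/-- The position of the current client in the frame of the recursive calls. -/
def kid : NExpr := .add (.mul kE' nN) zE
/-- The current server. -/
def yE : NExpr := A 6 kE
/-- The current client on the boundary of a ball. -/
def wE : NExpr := A 7 kE
/-- The current carving centre. -/
def xE : NExpr := A 8 kE
/-- The current radius index of a carving step. -/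
def iE : NExpr := A 9 kE
/-- The best radius index of a carving step. -/
def bE : NExpr := A 10 kE
/-- The radius of the current ball. -/
def dE : RExpr := sdE yE wE

/-- The search for the farthest client from the server in cell `0` of array `12`. -/
def farCode : Stmt :=
  .seq (putR 4 (.const 0) zeroE) (.seq (putA 14 (.const 0) (.const 0))
    (forL 13 (.const 0) nN
      (.ite (.and (.leN (.const 1) (A 0 (.add (.mul kE nN) (A 13 (.const 0)))))
          (.leR (R 4 (.const 0)) (sdE (A 12 (.const 0)) (A 13 (.const 0)))))
        (.seq (putR 4 (.const 0) (sdE (A 12 (.const 0)) (A 13 (.const 0))))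
          (putA 14 (.const 0) (A 13 (.const 0))))
        .skip)))

/-- The procedure for recursion depth zero. -/
def leafCode : Stmt :=
  .seq (putR 0 kE zeroE) (.seq (putA 15 (.const 0) (.const 0)) (.seq (putA 16 (.const 0) (.const 0))
    (.seq (forL 12 (.const 0) nM (.seq farCode
      (.ite (orT (.leN (A 12 (.const 0)) (.const 0)) (ltR (.pow (R 4 (.const 0))) (R 0 kE)))
        (.seq (putR 0 kE (.pow (R 4 (.const 0)))) (.seq (putA 15 (.const 0) (A 12 (.const 0)))
          (putA 16 (.const 0) (A 14 (.const 0)))))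
        .skip)))
    (fillL (.seq (putA 2 own (A 15 (.const 0))) (putA 3 own (A 16 (.const 0))))))))

/-- A recursive call. -/
def callChild : Stmt :=
  .seq (putA 20 (.const 0) kE') (.seq (.call 0) (putA 20 (.const 0) (.add kE (.const 1))))

/-- The candidate solution that buys the current ball. -/
def coverCode : Stmt :=
  .seq (.seq (fillL (.ite (.leR (sdE yE zE) dE) (putA 0 kid (.const 0)) (putA 0 kid (A 0 own))))
      callChild)
    (.ite (ltR (.add (.pow dE) (R 0 kE')) (R 0 kE))
      (.seq (fillL (.ite (.leR (sdE yE zE) dE) (.seq (putA 2 own yE) (putA 3 own wE))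
          (.seq (putA 2 own (A 2 kid)) (putA 3 own (A 3 kid)))))
        (putR 0 kE (.add (.pow dE) (R 0 kE'))))
      .skip)

/-- The recursive call for the remaining clients in the ball of radius `2 * e * dE` around the
current carving centre. -/
def probe (e : NExpr) : Stmt :=
  .seq (fillL (.ite (.and (.leN (.const 1) (A 1 own))
      (.leR (entryE xE zE) (.mul (.cast (.mul (.const 2) e)) dE)))
    (putA 0 kid (.const 1)) (putA 0 kid (.const 0)))) callChild

/-- One step of the search for the radius of a carving step. -/
def scanCode : Stmt :=
  .seq (probe (.add iE (.const 1)))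
    (.seq (.ite (orT (.leN iE (.const 0))
          (ltR (.sub (.mul (.cast qE) (R 0 kE')) (.mul (.cast (.add qE (.const 1))) (R 2 kE)))
            (R 3 kE)))
        (.seq (putR 3 kE
            (.sub (.mul (.cast qE) (R 0 kE')) (.mul (.cast (.add qE (.const 1))) (R 2 kE))))
          (putA 10 kE (.add iE (.const 1))))
        .skip)
      (putR 2 kE (R 0 kE')))

/-- A carving step. -/
def stepCode : Stmt :=
  .seq (probe (.const 0)) (.seq (putR 2 kE (R 0 kE')) (.seq (putR 3 kE zeroE)
    (.seq (putA 10 kE (.const 0)) (.seq (forL 9 kE hE scanCode) (.seq (probe bE)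
      (.seq (putR 1 kE (.add (R 1 kE) (R 0 kE')))
        (fillL (.ite (.leN (.const 1) (A 0 kid))
          (.seq (putA 4 own (A 2 kid)) (.seq (putA 5 own (A 3 kid)) (putA 1 own (.const 0))))
          (.seq (putA 4 own (A 4 own)) (.seq (putA 5 own (A 5 own)) (putA 1 own (A 1 own))))))))))))

/-- The candidate solution that carves at the scale of the current ball. -/
def carveCode : Stmt :=
  .seq (fillL (.seq (putA 4 own (.const 0)) (.seq (putA 5 own (.const 0)) (putA 1 own (A 0 own)))))
    (.seq (putR 1 kE zeroE) (.seq
      (forL 8 kE nN (.ite (.leN (.const 1) (A 1 (.add (.mul kE nN) xE))) stepCode .skip))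
      (.ite (ltR (R 1 kE) (R 0 kE))
        (.seq (fillL (.seq (putA 2 own (A 4 own)) (putA 3 own (A 5 own)))) (putR 0 kE (R 1 kE)))
        .skip)))

/-- The procedure for positive recursion depth. -/
def nodeCode : Stmt :=
  .seq (.seq (fillL (putA 0 kid (A 0 own))) callChild)
    (.seq (.seq (fillL (.seq (putA 2 own (A 2 kid)) (putA 3 own (A 3 kid)))) (putR 0 kE (R 0 kE')))
      (forL 6 kE nM (forL 7 kE nN (.seq coverCode carveCode))))

/-- The recursive procedure. -/
def solveProc : Stmt := .ite (.leN kE (.const 0)) leafCode nodeCode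

/-! ### Stack frames and recursive calls -/

/-- The two working memories differ only in temporary cells and in the frames of recursion depth at
most `κ`. -/
structure Fr (n κ : ℕ) (σ σ' : Mem) : Prop where
  vec : ∀ q < 6, ∀ j, (κ + 1) * n ≤ j → σ'.a q j = σ.a q j
  sc : ∀ q, 6 ≤ q → q < 11 → ∀ j, κ < j → σ'.a q j = σ.a q j
  glob : ∀ q, 20 ≤ q → ∀ j, σ'.a q j = σ.a q j
  re : ∀ q < 4, ∀ j, κ < j → σ'.r q j = σ.r q j

/-- The set stored in array `q` of the frame of recursion depth `κ`. -/
def slice (n q : ℕ) (σ : Mem) (κ : ℕ) : Finset ℕ :=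
  (Finset.range n).filter fun z => 1 ≤ σ.a q (κ * n + z)

/-- The solution `r` is stored in the frame of recursion depth `κ`. -/
def Res (n : ℕ) (σ : Mem) (κ : ℕ) (r : ℝ × (ℕ → ℕ × ℕ)) : Prop :=
  σ.r 0 κ = r.1 ∧ ∀ z < n, σ.a 2 (κ * n + z) = (r.2 z).1 ∧ σ.a 3 (κ * n + z) = (r.2 z).2

theorem slice_eq {n q : ℕ} {σ : Mem} {κ : ℕ} {S : Finset ℕ} (hS : S ⊆ Finset.range n)
    (h : ∀ z < n, (1 ≤ σ.a q (κ * n + z) ↔ z ∈ S)) : slice n q σ κ = S := by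
  ext z
  simp only [slice, Finset.mem_filter, Finset.mem_range]
  constructor
  · rintro ⟨h1, h2⟩
    exact (h z h1).1 h2
  · intro hz
    have h1 := Finset.mem_range.1 (hS hz)
    exact ⟨h1, (h z h1).2 hz⟩

theorem mem_slice {n q : ℕ} {σ : Mem} {κ z : ℕ} (hz : z < n) :
    z ∈ slice n q σ κ ↔ 1 ≤ σ.a q (κ * n + z) := by
  simp [slice, hz]

section Frames

variable {n κ : ℕ} {σ σ₁ σ₂ : Mem}

theorem Fr.refl : Fr n κ σ σ := ⟨by simp, by simp, by simp, by simp⟩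

theorem Fr.trans (h : Fr n κ σ σ₁) (h' : Fr n κ σ₁ σ₂) : Fr n κ σ σ₂ where
  vec q hq j hj := (h'.vec q hq j hj).trans (h.vec q hq j hj)
  sc q hq hq' j hj := (h'.sc q hq hq' j hj).trans (h.sc q hq hq' j hj)
  glob q hq j := (h'.glob q hq j).trans (h.glob q hq j)
  re q hq j hj := (h'.re q hq j hj).trans (h.re q hq j hj)

theorem Fr.succ (h : Fr n κ σ σ₁) : Fr n (κ + 1) σ σ₁ where
  vec q hq j hj := h.vec q hq j (le_trans (by gcongr; omega) hj)
  sc q hq hq' j hj := h.sc q hq hq' j (by omega)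
  glob q hq j := h.glob q hq j
  re q hq j hj := h.re q hq j (by omega)

theorem Fr.setA {q v : ℕ} (hq : 6 ≤ q) (hq' : q < 11) : Fr n κ σ (σ.setA q κ v) where
  vec q' h j hj := by simp only [Mem.setA_a]; rw [if_neg]; omega
  sc q' h h' j hj := by simp only [Mem.setA_a]; rw [if_neg]; omega
  glob q' h j := by simp only [Mem.setA_a]; rw [if_neg]; omega
  re q' h j hj := rfl

theorem Fr.setTemp {q i v : ℕ} (hq : 11 ≤ q) (hq' : q < 20) : Fr n κ σ (σ.setA q i v) where
  vec q' h j hj := by simp only [Mem.setA_a]; rw [if_neg]; omega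
  sc q' h h' j hj := by simp only [Mem.setA_a]; rw [if_neg]; omega
  glob q' h j := by simp only [Mem.setA_a]; rw [if_neg]; omega
  re q' h j hj := rfl

theorem Fr.setR {q : ℕ} {v : ℝ} : Fr n κ σ (σ.setR q κ v) where
  vec q' h j hj := rfl
  sc q' h h' j hj := rfl
  glob q' h j := rfl
  re q' h j hj := by simp only [Mem.setR_r]; rw [if_neg]; omega

theorem Fr.setRTemp {q i : ℕ} {v : ℝ} (hq : 4 ≤ q) : Fr n κ σ (σ.setR q i v) where
  vec q' h j hj := rfl
  sc q' h h' j hj := rfl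
  glob q' h j := rfl
  re q' h j hj := by simp only [Mem.setR_r]; rw [if_neg]; omega

theorem Fr.fs {As : List ℕ} {G : ℕ → ℕ → ℕ} (hAs : ∀ q ∈ As, q < 6) :
    Fr n κ σ (fs σ As (κ * n) G n) where
  vec q h j hj := by
    rw [Nat.succ_mul] at hj
    simp only [fs_a]
    rw [if_neg (by omega), if_neg (by omega)]
  sc q h h' j hj := by
    simp only [fs_a]
    rw [if_neg (by omega), if_neg]
    rintro ⟨h1, -⟩
    exact absurd (hAs q h1) (by omega)
  glob q h j := by
    simp only [fs_a]
    rw [if_neg (by omega), if_neg]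
    rintro ⟨h1, -⟩
    exact absurd (hAs q h1) (by omega)
  re q h j hj := rfl

end Frames

/-- The procedure, called with recursion depth `k`, computes `solve k` for the set of clients in its
frame within time `T`. It leaves this set and the frames of larger recursion depth unchanged. -/
def SolveSpec (Γ : Env) (H q k T : ℕ) : Prop :=
  ∀ σ : Mem, σ.a 20 0 = k → σ.a 21 0 = H → σ.a 22 0 = q → ∃ σ', Run Γ (.call 0) σ T σ' ∧
    Fr Γ.I.n k σ σ' ∧ Res Γ.I.n σ' k (solve Γ.I Γ.α H q k (slice Γ.I.n 0 σ k)) ∧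
    ∀ z < Γ.I.n, σ'.a 0 (k * Γ.I.n + z) = σ.a 0 (k * Γ.I.n + z)

section Child

variable {Γ : Env} {H q k T : ℕ}

/-- A recursive call on the set `P`, which has been written into the frame below by `p`. -/
theorem SolveSpec.child (h : SolveSpec Γ H q k T) {σ : Mem} {U : ℕ} {p : Stmt} {G : ℕ → ℕ → ℕ}
    {P : Finset ℕ} (hk : σ.a 20 0 = k + 1) (hH : σ.a 21 0 = H) (hq : σ.a 22 0 = q)
    (hp : Run Γ p σ U (fs σ [0] (k * Γ.I.n) G Γ.I.n)) (hP : P ⊆ Finset.range Γ.I.n)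
    (hG : ∀ z < Γ.I.n, (1 ≤ G 0 z ↔ z ∈ P)) :
    ∃ σ', Run Γ (.seq p callChild) σ (U + (flat callChild + T)) σ' ∧ Fr Γ.I.n k σ σ' ∧
      Res Γ.I.n σ' k (solve Γ.I Γ.α H q k P) ∧
      ∀ z < Γ.I.n, (1 ≤ σ'.a 0 (k * Γ.I.n + z) ↔ z ∈ P) := by
  set σ₁ := fs σ [0] (k * Γ.I.n) G Γ.I.n with hσ₁
  have r1 := Run.putA (Γ := Γ) (σ := σ₁) (q := 20) (i := .const 0) (e := kE') (by norm_num)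
  have e1 : kE'.eval (conc Γ σ₁) = k := by simp [kE', kE, hσ₁, hk]
  rw [e1, eval_const] at r1
  have hs : slice Γ.I.n 0 (σ₁.setA 20 0 k) k = P := slice_eq hP (fun z hz => by
    rw [← hG z hz]
    simp [hσ₁, hz])
  obtain ⟨σ₂, r2, f2, s2, i2⟩ := h (σ₁.setA 20 0 k) (by simp) (by simp [hσ₁, hH])
    (by simp [hσ₁, hq])
  rw [hs] at s2
  have r3 := Run.putA (Γ := Γ) (σ := σ₂) (q := 20) (i := .const 0) (e := .add kE (.const 1))
    (by norm_num)
  have e3 : (NExpr.add kE (.const 1)).eval (conc Γ σ₂) = k + 1 := by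
    simp [kE, f2.glob]
  rw [e3, eval_const] at r3
  refine ⟨σ₂.setA 20 0 (k + 1), (hp.seq (r1.seq (r2.seq r3))).mono ?_, ?_, ?_, ?_⟩
  · simp only [callChild, flat]
    omega
  · have f1 : Fr Γ.I.n k σ σ₁ := Fr.fs (by simp)
    refine ⟨fun q hq j hj => ?_, fun q hq hq' j hj => ?_, fun q hq j => ?_, fun q hq j hj => ?_⟩
    · rw [← f1.vec q hq j hj, Mem.setA_a, if_neg (by omega), f2.vec q hq j hj, Mem.setA_a,
        if_neg (by omega)]
    · rw [← f1.sc q hq hq' j hj, Mem.setA_a, if_neg (by omega), f2.sc q hq hq' j hj, Mem.setA_a,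
        if_neg (by omega)]
    · rw [Mem.setA_a]
      split_ifs with hc
      · rw [hc.1, hc.2, hk]
      · rw [← f1.glob q hq j, f2.glob q hq j, Mem.setA_a, if_neg hc]
    · rw [← f1.re q hq j hj]
      exact f2.re q hq j hj
  · exact ⟨s2.1, fun z hz => by simpa using s2.2 z hz⟩
  · intro z hz
    have := i2 z hz
    simp only [Mem.setA_a] at this ⊢
    rw [if_neg (by omega), this, if_neg (by omega), ← hG z hz]
    simp [hσ₁, hz]

end Child

/-! ### Correctness of the program at recursion depth zero -/

section Leaf

variable {Γ : Env}

/-- `farCode` computes `far`. -/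
theorem run_far {σ : Mem} {k : ℕ} (hk : σ.a 20 0 = k) (hy : σ.a 12 0 < Γ.I.m) :
    Run Γ farCode σ (500 * (Γ.I.n + 1))
      (((σ.setR 4 0 (far Γ.I (slice Γ.I.n 0 σ k) (σ.a 12 0)).1).setA 14 0
        (far Γ.I (slice Γ.I.n 0 σ k) (σ.a 12 0)).2).setA 13 0 Γ.I.n) := by
  set y := σ.a 12 0 with hy'
  set S := slice Γ.I.n 0 σ k with hS
  set fl : ℕ → ℝ × ℕ := loop (fun x st =>
    if x ∈ S ∧ st.1 ≤ sd Γ.I y x then (sd Γ.I y x, x) else st) (0, 0) with hfl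
  have hsucc : ∀ z, fl (z + 1) = if z ∈ S ∧ (fl z).1 ≤ sd Γ.I y z then (sd Γ.I y z, z) else fl z :=
    fun z => rfl
  set st : ℕ → Mem := fun z => ((σ.setR 4 0 (fl z).1).setA 14 0 (fl z).2).setA 13 0 z with hst
  have r1 := Run.putR (Γ := Γ) (σ := σ) (q := 4) (i := .const 0) (e := zeroE) (by norm_num)
  have r2 := Run.putA (Γ := Γ) (σ := σ.setR 4 0 0) (q := 14) (i := .const 0) (e := .const 0)
    (by norm_num)
  simp only [eval_const, evalR_zeroE] at r1 r2
  obtain ⟨σ', r3, e3⟩ := for_rule (Γ := Γ) (σ := (σ.setR 4 0 0).setA 14 0 0)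
    (q := 13) (i := .const 0) (bound := nN) (N := Γ.I.n) (j := 0) (T := 300) (U := 350)
    (Inv := fun z σ' => σ' = st z)
    (body := .ite (.and (.leN (.const 1) (A 0 (.add (.mul kE nN) (A 13 (.const 0)))))
          (.leR (R 4 (.const 0)) (sdE (A 12 (.const 0)) (A 13 (.const 0)))))
        (.seq (putR 4 (.const 0) (sdE (A 12 (.const 0)) (A 13 (.const 0))))
          (putA 14 (.const 0) (A 13 (.const 0))))
        .skip) (by norm_num) (by decide +kernel) rfl (by
      rintro z _ rfl
      simp [hst]) (by
      rintro z hz _ rfl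
      have eT : (Test.and (.leN (.const 1) (A 0 (.add (.mul kE nN) (A 13 (.const 0)))))
          (.leR (R 4 (.const 0)) (sdE (A 12 (.const 0)) (A 13 (.const 0))))).Holds Γ.α
          (conc Γ (st z)) ↔ z ∈ S ∧ (fl z).1 ≤ sd Γ.I y z := by
        rw [holds_and, holds_leN, holds_leR, eval_sdE (by simpa [hst, ← hy'] using hy)
          (by simpa [hst] using hz), hS, mem_slice hz]
        simp [hst, kE, hk, ← hy']
      by_cases hc : z ∈ S ∧ (fl z).1 ≤ sd Γ.I y z
      · have a1 := Run.putR (Γ := Γ) (σ := st z) (q := 4) (i := .const 0)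
          (e := sdE (A 12 (.const 0)) (A 13 (.const 0))) (by norm_num)
        rw [eval_sdE (by simpa [hst, ← hy'] using hy) (by simpa [hst] using hz)] at a1
        have a2 := Run.putA (Γ := Γ) (σ := (st z).setR 4 0 (sd Γ.I y z)) (q := 14) (i := .const 0)
          (e := A 13 (.const 0)) (by norm_num)
        simp [hst, ← hy'] at a1
        simp [hst] at a2
        refine ⟨_, (Run.ite_pos (eT.2 hc) (a1.seq a2)).mono (by decide +kernel), by simp,
          by simp, ?_⟩
        simp only [hst, hsucc, if_pos hc]
        ext q j
        · simp only [Mem.setA_a, Mem.setR_a]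
          grind
        · simp only [Mem.setR_r, Mem.setA_r]
          grind
      · refine ⟨_, (Run.ite_neg (fun h => hc (eT.1 h)) Run.skip).mono (by decide +kernel), by simp,
          by simp [hst], ?_⟩
        simp only [hst, hsucc, if_neg hc]
        ext q j
        · simp only [Mem.setA_a, Mem.setR_a]
          grind
        · rfl)
  rw [e3] at r3
  have h1 : flat (putR 4 (.const 0) zeroE) + flat (putA 14 (.const 0) (.const 0)) ≤ 100 := by
    decide +kernel
  refine (r1.seq (r2.seq r3)).mono ?_
  omega

/-- `leafCode` computes `leaf` and assigns its ball to all clients. -/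
theorem run_leaf {σ : Mem} (hm : 1 ≤ Γ.I.m) (hk : σ.a 20 0 = 0) :
    ∃ σ', Run Γ leafCode σ (1500 * ((Γ.I.m + 1) * (Γ.I.n + 1))) σ' ∧
      Fr Γ.I.n 0 σ σ' ∧ Res Γ.I.n σ' 0 ((leaf Γ.I Γ.α (slice Γ.I.n 0 σ 0)).1,
        fun _ => (leaf Γ.I Γ.α (slice Γ.I.n 0 σ 0)).2) ∧
      ∀ z, σ'.a 0 z = σ.a 0 z := by
  set S := slice Γ.I.n 0 σ 0 with hS
  set fl : ℕ → ℝ × ℕ × ℕ := loop (fun y st => if y = 0 ∨ (far Γ.I S y).1 ^ Γ.α < st.1 then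
    ((far Γ.I S y).1 ^ Γ.α, y, (far Γ.I S y).2) else st) (0, 0, 0) with hfl
  have hsucc : ∀ z, fl (z + 1) = if z = 0 ∨ (far Γ.I S z).1 ^ Γ.α < (fl z).1 then
    ((far Γ.I S z).1 ^ Γ.α, z, (far Γ.I S z).2) else fl z := fun z => rfl
  have hSn : S ⊆ Finset.range Γ.I.n := Finset.filter_subset _ _
  have r1 := Run.putR (Γ := Γ) (σ := σ) (q := 0) (i := kE) (e := zeroE) (by norm_num)
  have r2 := Run.putA (Γ := Γ) (σ := σ.setR 0 0 0) (q := 15) (i := .const 0) (e := .const 0)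
    (by norm_num)
  have r2' := Run.putA (Γ := Γ) (σ := (σ.setR 0 0 0).setA 15 0 0) (q := 16) (i := .const 0)
    (e := .const 0) (by norm_num)
  rw [show kE.eval (conc Γ σ) = 0 by simp [kE, hk]] at r1
  simp only [eval_const, evalR_zeroE] at r1 r2 r2'
  obtain ⟨σ', r3, f3, c3, v3, b3, w3, -⟩ := for_rule (Γ := Γ)
    (σ := ((σ.setR 0 0 0).setA 15 0 0).setA 16 0 0)
    (q := 12) (i := .const 0) (bound := nM) (N := Γ.I.m) (j := 0) (T := 800 * (Γ.I.n + 1))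
    (U := 900 * (Γ.I.n + 1))
    (Inv := fun z σ' => Fr Γ.I.n 0 σ σ' ∧ (∀ j, σ'.a 0 j = σ.a 0 j) ∧ σ'.r 0 0 = (fl z).1 ∧
      σ'.a 15 0 = (fl z).2.1 ∧ σ'.a 16 0 = (fl z).2.2 ∧ σ'.a 12 0 = z)
    (body := .seq farCode
      (.ite (orT (.leN (A 12 (.const 0)) (.const 0)) (ltR (.pow (R 4 (.const 0))) (R 0 kE)))
        (.seq (putR 0 kE (.pow (R 4 (.const 0)))) (.seq (putA 15 (.const 0) (A 12 (.const 0)))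
          (putA 16 (.const 0) (A 14 (.const 0)))))
        .skip)) (by norm_num) (by
      have : forTime 12 (.const 0) nM ≤ 100 := by decide +kernel
      omega) (by
      refine ⟨?_, ?_, ?_⟩
      · exact (((Fr.setR.trans (Fr.setTemp (by norm_num) (by norm_num))).trans
          (Fr.setTemp (by norm_num) (by norm_num))).trans (Fr.setTemp (by norm_num) (by norm_num)))
      · simp
      · simp [hfl, loop]) (by
      rintro z σ' ⟨-, -, -, -, -, h⟩
      simp [h]) (by
      rintro z hz σ₁ ⟨f1, c1, v1, b1, w1, h1⟩
      have hS1 : slice Γ.I.n 0 σ₁ 0 = S := by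
        ext x
        simp [hS, slice, c1]
      have a0 := run_far (Γ := Γ) (σ := σ₁) (k := 0) (by rw [f1.glob 20 (by norm_num), hk])
        (by rwa [h1])
      rw [hS1, h1] at a0
      set t := far Γ.I S z with ht
      have ht0 : 0 ≤ t.1 := far_nonneg hSn z
      set σ₂ := ((σ₁.setR 4 0 t.1).setA 14 0 t.2).setA 13 0 Γ.I.n with hσ₂
      have f2 : Fr Γ.I.n 0 σ σ₂ := f1.trans (((Fr.setRTemp (by norm_num)).trans
        (Fr.setTemp (by norm_num) (by norm_num))).trans (Fr.setTemp (by norm_num) (by norm_num)))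
      have hk1 : σ₁.a 20 0 = 0 := by rw [f1.glob 20 (by norm_num), hk]
      have eT : (orT (.leN (A 12 (.const 0)) (.const 0))
          (ltR (.pow (R 4 (.const 0))) (R 0 kE))).Holds Γ.α
          (conc Γ σ₂) ↔ z = 0 ∨ t.1 ^ Γ.α < (fl z).1 := by
        simp [hσ₂, kE, hk1, h1, v1, ht0]
      by_cases hc : z = 0 ∨ t.1 ^ Γ.α < (fl z).1
      · have a1 := Run.putR (Γ := Γ) (σ := σ₂) (q := 0) (i := kE)
          (e := .pow (R 4 (.const 0))) (by norm_num)
        rw [show kE.eval (conc Γ σ₂) = 0 by simp [hσ₂, kE, hk1],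
          show (RExpr.pow (R 4 (.const 0))).eval Γ.α (conc Γ σ₂) = t.1 ^ Γ.α by
            simp [hσ₂, ht0]] at a1
        have a2 := Run.putA (Γ := Γ) (σ := σ₂.setR 0 0 (t.1 ^ Γ.α)) (q := 15) (i := .const 0)
          (e := A 12 (.const 0)) (by norm_num)
        rw [eval_const, show (A 12 (.const 0)).eval (conc Γ (σ₂.setR 0 0 (t.1 ^ Γ.α))) = z by
          simp [hσ₂, h1]] at a2
        have a3 := Run.putA (Γ := Γ) (σ := (σ₂.setR 0 0 (t.1 ^ Γ.α)).setA 15 0 z) (q := 16)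
          (i := .const 0) (e := A 14 (.const 0)) (by norm_num)
        rw [eval_const, show (A 14 (.const 0)).eval
          (conc Γ ((σ₂.setR 0 0 (t.1 ^ Γ.α)).setA 15 0 z)) = t.2 by simp [hσ₂]] at a3
        refine ⟨_, (a0.seq (Run.ite_pos (eT.2 hc) (a1.seq (a2.seq a3)))).mono ?_, by simp,
          by simp [hσ₂, h1], ?_, ?_, ?_⟩
        · have : flat (putR 0 kE (.pow (R 4 (.const 0)))) +
            (flat (putA 15 (.const 0) (A 12 (.const 0))) +
              flat (putA 16 (.const 0) (A 14 (.const 0)))) ≤ 150 := by decide +kernel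
          have : (orT (.leN (A 12 (.const 0)) (.const 0))
            (ltR (.pow (R 4 (.const 0))) (R 0 kE))).size ≤ 100 := by decide +kernel
          omega
        · exact ((((f2.trans Fr.setR).trans (Fr.setTemp (by norm_num) (by norm_num))).trans
            (Fr.setTemp (by norm_num) (by norm_num))).trans
            (Fr.setTemp (by norm_num) (by norm_num)))
        · simp [hσ₂, c1]
        · rw [hsucc, if_pos hc]
          simp
          exact ⟨rfl, rfl⟩
      · refine ⟨_, (a0.seq (Run.ite_neg (fun h => hc (eT.1 h)) Run.skip)).mono ?_, by simp,
          by simp [hσ₂, h1], ?_, ?_, ?_⟩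
        · have : (orT (.leN (A 12 (.const 0)) (.const 0))
            (ltR (.pow (R 4 (.const 0))) (R 0 kE))).size ≤ 100 := by decide +kernel
          omega
        · exact f2.trans (Fr.setTemp (by norm_num) (by norm_num))
        · simp [hσ₂, c1]
        · rw [hsucc, if_neg hc]
          simp [hσ₂, v1, b1, w1])
  have hk' : σ'.a 20 0 = 0 := by rw [f3.glob 20 (by norm_num), hk]
  have r4 := fill_rule (Γ := Γ) (σ := σ') [2, 3] (0 * Γ.I.n)
    (fun q _ => if q = 2 then (fl Γ.I.m).2.1 else (fl Γ.I.m).2.2) (U := 300)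
    (body := .seq (putA 2 own (A 15 (.const 0))) (putA 3 own (A 16 (.const 0))))
    (by decide +kernel) (fun z hz =>
    put_run₂ (by norm_num) (by norm_num) (by norm_num) (by simp [own, kE, zE, hk'])
      (by simp [b3]) (by simp [own, kE, zE, hk']) (by simp [w3]))
  refine ⟨_, (r1.seq (r2.seq (r2'.seq (r3.seq r4)))).mono ?_, f3.trans (Fr.fs (by simp)), ?_, ?_⟩
  · have h1 : flat (putR 0 kE zeroE) + flat (putA 15 (.const 0) (.const 0)) +
      flat (putA 16 (.const 0) (.const 0)) ≤ 150 := by decide +kernel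
    have h2 : (Γ.I.n + 1) * 1 ≤ (Γ.I.n + 1) * (Γ.I.m + 1) := by gcongr; omega
    have h3 : (Γ.I.m + 1) * (900 * (Γ.I.n + 1)) = 900 * ((Γ.I.n + 1) * (Γ.I.m + 1)) := by ring
    rw [h3, mul_comm (Γ.I.m + 1)]
    omega
  · refine ⟨?_, fun z hz => ?_⟩
    · simp only [fs_r]
      exact v3
    · constructor
      · simp [hz]
        rfl
      · simp [hz]
        rfl
  · intro z
    simp [c3]

end Leaf

/-! ### Correctness of the cover move -/

/-- Besides everything outside of the frames of recursion depth at most `κ`, the input set, the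
current server and the current boundary client of the frame of depth `κ` are preserved. -/
structure Keep (n κ : ℕ) (σ σ' : Mem) : Prop where
  fr : Fr n κ σ σ'
  inp : ∀ z < n, σ'.a 0 (κ * n + z) = σ.a 0 (κ * n + z)
  yc : σ'.a 6 κ = σ.a 6 κ
  wc : σ'.a 7 κ = σ.a 7 κ

section Frames

variable {n κ : ℕ} {σ σ₁ σ₂ : Mem}

theorem Keep.trans (h : Keep n κ σ σ₁) (h' : Keep n κ σ₁ σ₂) : Keep n κ σ σ₂ where
  fr := h.fr.trans h'.fr
  inp z hz := (h'.inp z hz).trans (h.inp z hz)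
  yc := h'.yc.trans h.yc
  wc := h'.wc.trans h.wc

theorem Keep.slice (h : Keep n κ σ σ₁) : slice n 0 σ₁ κ = slice n 0 σ κ := by
  ext z
  simp only [CoverAlg.slice, Finset.mem_filter, Finset.mem_range]
  constructor
  · rintro ⟨hz, h1⟩
    exact ⟨hz, by rwa [h.inp z hz] at h1⟩
  · rintro ⟨hz, h1⟩
    exact ⟨hz, by rwa [h.inp z hz]⟩

/-- Recursive calls only touch frames of smaller recursion depth. -/
theorem Fr.keep (h : Fr n κ σ σ₁) : Keep n (κ + 1) σ σ₁ where
  fr := h.succ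
  inp z _ := h.vec 0 (by norm_num) _ (Nat.le_add_right _ _)
  yc := h.sc 6 (by norm_num) (by norm_num) _ (by omega)
  wc := h.sc 7 (by norm_num) (by norm_num) _ (by omega)

theorem Keep.setA {q v : ℕ} (hq : 8 ≤ q) (hq' : q < 11) : Keep n κ σ (σ.setA q κ v) where
  fr := Fr.setA (by omega) hq'
  inp z _ := by simp only [Mem.setA_a]; rw [if_neg]; omega
  yc := by simp only [Mem.setA_a]; rw [if_neg]; omega
  wc := by simp only [Mem.setA_a]; rw [if_neg]; omega

theorem Keep.setR {q : ℕ} {v : ℝ} : Keep n κ σ (σ.setR q κ v) :=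
  ⟨Fr.setR, fun _ _ => rfl, rfl, rfl⟩

theorem Keep.fs {As : List ℕ} {G : ℕ → ℕ → ℕ} (hAs : ∀ q ∈ As, q < 6) (h0 : 0 ∉ As) :
    Keep n κ σ (fs σ As (κ * n) G n) where
  fr := Fr.fs hAs
  inp z _ := by simp [h0]
  yc := by
    have : 6 ∉ As := fun h => absurd (hAs 6 h) (by norm_num)
    simp [this]
  wc := by
    have : 7 ∉ As := fun h => absurd (hAs 7 h) (by norm_num)
    simp [this]

theorem not_own_le {n k z : ℕ} (hz : z < n) : ¬ (k + 1) * n ≤ k * n + z := by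
  rw [Nat.succ_mul]
  omega

theorem not_own_lt {n k z z' : ℕ} (hz : z ≤ n) : ¬ (k + 1) * n + z' < k * n + z := by
  rw [Nat.succ_mul]
  omega

theorem Res.keep {r : ℝ × (ℕ → ℕ × ℕ)} (h : Res n σ (κ + 1) r) (f : Fr n κ σ σ₁) :
    Res n σ₁ (κ + 1) r := by
  refine ⟨by rw [f.re 0 (by norm_num) _ (by omega), h.1], fun z hz => ?_⟩
  rw [f.vec 2 (by norm_num) _ (Nat.le_add_right _ _),
    f.vec 3 (by norm_num) _ (Nat.le_add_right _ _)]
  exact h.2 z hz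

end Frames

section Cover

variable {Γ : Env} {H q k T u : ℕ}

theorem eval_dE {σ : Mem} {y w : ℕ} (hym : y < Γ.I.m) (hwn : w < Γ.I.n) (h1 : σ.a 20 0 = k + 1)
    (h2 : σ.a 6 (k + 1) = y) (h3 : σ.a 7 (k + 1) = w) : dE.eval Γ.α (conc Γ σ) = sd Γ.I y w := by
  rw [dE, eval_sdE (by simpa [yE, kE, h1, h2] using hym) (by simpa [wE, kE, h1, h3] using hwn)]
  simp [yE, wE, kE, h1, h2, h3]

/-- `coverCode` replaces the current solution by `coverCand` if this is cheaper. -/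
theorem run_cover (h : SolveSpec Γ H q k T) (hu : T + 1000 * (Γ.I.n + 1) ≤ u) {σ : Mem}
    (hk : σ.a 20 0 = k + 1) (hH : σ.a 21 0 = H) (hq : σ.a 22 0 = q) {y w : ℕ}
    (hy : σ.a 6 (k + 1) = y) (hw : σ.a 7 (k + 1) = w) (hym : y < Γ.I.m) (hwn : w < Γ.I.n)
    {acc : ℝ × (ℕ → ℕ × ℕ)} (hacc : Res Γ.I.n σ (k + 1) acc) :
    ∃ σ', Run Γ coverCode σ (3 * u) σ' ∧ Keep Γ.I.n (k + 1) σ σ' ∧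
      Res Γ.I.n σ' (k + 1) (better (coverCand Γ.I Γ.α (solve Γ.I Γ.α H q k)
        (slice Γ.I.n 0 σ (k + 1)) y w) acc) := by
  set S := slice Γ.I.n 0 σ (k + 1) with hS
  set P := S.filter (fun x => ¬ sd Γ.I y x ≤ sd Γ.I y w) with hP
  set G : ℕ → ℕ → ℕ := fun _ z => if sd Γ.I y z ≤ sd Γ.I y w then 0 else
    σ.a 0 ((k + 1) * Γ.I.n + z) with hG
  have r1 : Run Γ (fillL (.ite (.leR (sdE yE zE) dE) (putA 0 kid (.const 0))
      (putA 0 kid (A 0 own)))) σ ((Γ.I.n + 1) * 300) (fs σ [0] (k * Γ.I.n) G Γ.I.n) := by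
    refine fill_rule (T := 200) [0] (k * Γ.I.n) G (by decide +kernel) fun z hz => ?_
    have eT : (Test.leR (sdE yE zE) dE).Holds Γ.α (conc Γ (fs σ [0] (k * Γ.I.n) G z)) ↔
        sd Γ.I y z ≤ sd Γ.I y w := by
      rw [holds_leR, dE, eval_sdE (by simpa [yE, kE, hk, hy] using hym) (by simpa [zE] using hz),
        eval_sdE (by simpa [yE, kE, hk, hy] using hym) (by simpa [wE, kE, hk, hw] using hwn)]
      simp [yE, zE, wE, kE, hk, hy, hw]
    by_cases hc : sd Γ.I y z ≤ sd Γ.I y w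
    · exact (Run.ite_pos (eT.2 hc) (put_run₁ (by norm_num) (by norm_num)
        (by simp [kid, kE', kE, zE, hk]) (by simp [hG, hc]))).mono (by decide +kernel)
    · refine (Run.ite_neg (fun h => hc (eT.1 h)) (put_run₁ (by norm_num) (by norm_num)
        (by simp [kid, kE', kE, zE, hk]) ?_)).mono (by decide +kernel)
      simp [own, kE, zE, hG, hc, hk, not_own_lt hz.le]
  obtain ⟨σ₁, r2, f1, v1, -⟩ := h.child hk hH hq r1 (P := P)
    ((Finset.filter_subset _ _).trans (Finset.filter_subset _ _)) (fun z hz => by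
      rw [hP, Finset.mem_filter, hS, mem_slice hz, hG]
      dsimp only
      split_ifs with hc
      · simp [hc]
      · simp [hc])
  have hk1 : σ₁.a 20 0 = k + 1 := by rw [f1.glob 20 (by norm_num), hk]
  have hy1 : σ₁.a 6 (k + 1) = y := by rw [f1.keep.yc, hy]
  have hw1 : σ₁.a 7 (k + 1) = w := by rw [f1.keep.wc, hw]
  have ed := fun σ' => eval_dE (Γ := Γ) (σ := σ') (k := k) (y := y) (w := w) hym hwn
  have hd0 := sd_nonneg Γ.I y w
  set v := sd Γ.I y w ^ Γ.α + (solve Γ.I Γ.α H q k P).1 with hv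
  have eT : (ltR (.add (.pow dE) (R 0 kE')) (R 0 kE)).Holds Γ.α (conc Γ σ₁) ↔ v < acc.1 := by
    rw [holds_ltR, evalR_add, evalR_pow, ed σ₁ hk1 hy1 hw1, max_eq_left hd0]
    simp [kE', kE, hk1, v1.1, (hacc.keep f1).1, hv]
  have hsz : (ltR (.add (.pow dE) (R 0 kE')) (R 0 kE)).size +
      flat (putR 0 kE (.add (.pow dE) (R 0 kE'))) + flat callChild + 10 ≤ 600 := by
    decide +kernel
  by_cases hc : v < acc.1
  · set G' : ℕ → ℕ → ℕ := fun p z => if sd Γ.I y z ≤ sd Γ.I y w then (if p = 2 then y else w) else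
      σ₁.a p (k * Γ.I.n + z) with hG'
    set σ₂ := fs σ₁ [2, 3] ((k + 1) * Γ.I.n) G' Γ.I.n with hσ₂
    have r3 : Run Γ (fillL (.ite (.leR (sdE yE zE) dE) (.seq (putA 2 own yE) (putA 3 own wE))
          (.seq (putA 2 own (A 2 kid)) (putA 3 own (A 3 kid)))))
        σ₁ ((Γ.I.n + 1) * 400) σ₂ := by
      refine fill_rule (T := 300) [2, 3] ((k + 1) * Γ.I.n) G' (by decide +kernel) fun z hz => ?_
      have eT : (Test.leR (sdE yE zE) dE).Holds Γ.α (conc Γ (fs σ₁ [2, 3] ((k + 1) * Γ.I.n) G' z)) ↔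
          sd Γ.I y z ≤ sd Γ.I y w := by
        rw [holds_leR, ed _ (by simp [hk1]) (by simp [hy1]) (by simp [hw1]),
          eval_sdE (by simpa [yE, kE, hk1, hy1] using hym) (by simpa [zE] using hz)]
        simp [yE, zE, kE, hk1, hy1]
      by_cases hc : sd Γ.I y z ≤ sd Γ.I y w
      · exact (Run.ite_pos (eT.2 hc) (put_run₂ (by norm_num) (by norm_num) (by norm_num)
          (by simp [own, kE, zE, hk1]) (by simp [yE, kE, hk1, hy1, hG', hc])
          (by simp [own, kE, zE, hk1]) (by simp [wE, kE, hk1, hw1, hG', hc]))).mono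
            (by decide +kernel)
      · refine (Run.ite_neg (fun h => hc (eT.1 h)) (put_run₂ (by norm_num) (by norm_num)
          (by norm_num) (by simp [own, kE, zE, hk1]) ?_ (by simp [own, kE, zE, hk1]) ?_)).mono
            (by decide +kernel)
        · simp [kid, kE', kE, zE, hG', hc, hk1, not_own_le hz]
        · simp [kid, kE', kE, zE, hG', hc, hk1, not_own_le hz]
    have r4 := Run.putR (Γ := Γ) (σ := σ₂) (q := 0) (i := kE) (e := .add (.pow dE) (R 0 kE'))
      (by norm_num)
    rw [evalR_add, evalR_pow, ed σ₂ (by simp [hσ₂, hk1]) (by simp [hσ₂, hy1]) (by simp [hσ₂, hw1]),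
      max_eq_left hd0, eval_R (by norm_num),
      show kE.eval (conc Γ σ₂) = k + 1 by simp [kE, hσ₂, hk1],
      show kE'.eval (conc Γ σ₂) = k by simp [kE', kE, hσ₂, hk1],
      show σ₂.r 0 k = (solve Γ.I Γ.α H q k P).1 from v1.1] at r4
    refine ⟨_, (r2.seq (Run.ite_pos (eT.2 hc) (r3.seq r4))).mono (by omega),
      (f1.keep.trans (Keep.fs (by simp) (by simp))).trans Keep.setR, ?_⟩
    rw [better, if_pos (show (coverCand Γ.I Γ.α (solve Γ.I Γ.α H q k) S y w).1 < acc.1 from hc)]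
    refine ⟨by simp [coverCand, hP], fun z hz => ?_⟩
    by_cases hc : sd Γ.I y z ≤ sd Γ.I y w
    · simp [hσ₂, hz, hG', coverCand, hc]
    · have := v1.2 z hz
      rw [hP] at this
      simpa [-not_le, hσ₂, hz, hG', coverCand, hc] using this
  · refine ⟨_, (r2.seq (Run.ite_neg (fun h => hc (eT.1 h)) Run.skip)).mono (by omega), f1.keep, ?_⟩
    rw [better, if_neg (show ¬ (coverCand Γ.I Γ.α (solve Γ.I Γ.α H q k) S y w).1 < acc.1 from hc)]
    exact hacc.keep f1

end Cover

/-! ### Correctness of the search for a carving radius -/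

/-- The frame of recursion depth `κ` is preserved except for the data of the search for the radius
of a carving step. -/
structure Still (n κ : ℕ) (σ σ' : Mem) : Prop where
  keep : Keep n κ σ σ'
  own : ∀ q < 6, ∀ z, σ'.a q (κ * n + z) = σ.a q (κ * n + z)
  xc : σ'.a 8 κ = σ.a 8 κ
  r0 : σ'.r 0 κ = σ.r 0 κ
  r1 : σ'.r 1 κ = σ.r 1 κ

section Frames

variable {n κ : ℕ} {σ σ₁ σ₂ : Mem}

theorem Still.trans (h : Still n κ σ σ₁) (h' : Still n κ σ₁ σ₂) : Still n κ σ σ₂ where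
  keep := h.keep.trans h'.keep
  own q hq z := (h'.own q hq z).trans (h.own q hq z)
  xc := h'.xc.trans h.xc
  r0 := h'.r0.trans h.r0
  r1 := h'.r1.trans h.r1

theorem Fr.still (h : Fr n κ σ σ₁) : Still n (κ + 1) σ σ₁ where
  keep := h.keep
  own q hq z := h.vec q hq _ (Nat.le_add_right _ _)
  xc := h.sc 8 (by norm_num) (by norm_num) _ (by omega)
  r0 := h.re 0 (by norm_num) _ (by omega)
  r1 := h.re 1 (by norm_num) _ (by omega)

theorem Still.setA {q v : ℕ} (hq : 9 ≤ q) (hq' : q < 11) : Still n κ σ (σ.setA q κ v) where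
  keep := Keep.setA (by omega) hq'
  own q' _ z := by simp only [Mem.setA_a]; rw [if_neg]; omega
  xc := by simp only [Mem.setA_a]; rw [if_neg]; omega
  r0 := rfl
  r1 := rfl

theorem Still.setR {q : ℕ} {v : ℝ} (hq : 2 ≤ q) : Still n κ σ (σ.setR q κ v) where
  keep := Keep.setR
  own q' _ z := rfl
  xc := rfl
  r0 := by simp only [Mem.setR_r]; rw [if_neg]; omega
  r1 := by simp only [Mem.setR_r]; rw [if_neg]; omega

theorem Still.slice (h : Still n κ σ σ₁) : slice n 1 σ₁ κ = slice n 1 σ κ := by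
  ext z
  simp [CoverAlg.slice, h.own 1]

end Frames

section Probe

variable {Γ : Env} {H q k T u : ℕ}

/-- The loop body of `probe`. -/
def probeBody (e : NExpr) : Stmt :=
  .ite (.and (.leN (.const 1) (A 1 own))
      (.leR (entryE xE zE) (.mul (.cast (.mul (.const 2) e)) dE)))
    (putA 0 kid (.const 1)) (putA 0 kid (.const 0))

/-- The data of the current frame on which a carving step depends: recursion depth and parameters,
the current pair and the current carving centre. -/
structure At (Γ : Env) (H q k y w x : ℕ) (σ : Mem) : Prop where
  hk : σ.a 20 0 = k + 1
  hH : σ.a 21 0 = H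
  hq : σ.a 22 0 = q
  hy : σ.a 6 (k + 1) = y
  hw : σ.a 7 (k + 1) = w
  hx : σ.a 8 (k + 1) = x
  hym : y < Γ.I.m
  hwn : w < Γ.I.n
  hxn : x < Γ.I.n

theorem At.still {y w x : ℕ} {σ σ₁ : Mem} (h : At Γ H q k y w x σ)
    (s : Still Γ.I.n (k + 1) σ σ₁) : At Γ H q k y w x σ₁ where
  hk := by rw [s.keep.fr.glob 20 (by norm_num), h.hk]
  hH := by rw [s.keep.fr.glob 21 (by norm_num), h.hH]
  hq := by rw [s.keep.fr.glob 22 (by norm_num), h.hq]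
  hy := by rw [s.keep.yc, h.hy]
  hw := by rw [s.keep.wc, h.hw]
  hx := by rw [s.xc, h.hx]
  hym := h.hym
  hwn := h.hwn
  hxn := h.hxn

/-- `probe` computes the solution of the cluster with radius index `i`. -/
theorem run_probe (h : SolveSpec Γ H q k T) (hu : T + 1000 * (Γ.I.n + 1) ≤ u) {σ : Mem}
    {y w x i : ℕ} (hat : At Γ H q k y w x σ) {e : NExpr}
    (hsz : flat (probeBody e) + forTime 11 (.const 0) nN ≤ 600)
    (he : ∀ G z, e.eval (conc Γ (fs σ [0] (k * Γ.I.n) G z)) = i) :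
    ∃ σ', Run Γ (probe e) σ u σ' ∧ Fr Γ.I.n k σ σ' ∧
      Res Γ.I.n σ' k (solve Γ.I Γ.α H q k
        (near Γ.I x (2 * (i : ℝ) * sd Γ.I y w) (slice Γ.I.n 1 σ (k + 1)))) ∧
      ∀ z < Γ.I.n, (1 ≤ σ'.a 0 (k * Γ.I.n + z) ↔
        z ∈ near Γ.I x (2 * (i : ℝ) * sd Γ.I y w) (slice Γ.I.n 1 σ (k + 1))) := by
  classical
  set P := near Γ.I x (2 * (i : ℝ) * sd Γ.I y w) (slice Γ.I.n 1 σ (k + 1)) with hP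
  set G : ℕ → ℕ → ℕ := fun _ z => if z ∈ P then 1 else 0 with hG
  have r1 : Run Γ (fillL (probeBody e)) σ ((Γ.I.n + 1) * 600)
      (fs σ [0] (k * Γ.I.n) G Γ.I.n) := by
    refine fill_rule (T := flat (probeBody e)) [0] (k * Γ.I.n) G hsz fun z hz => ?_
    have eT : (Test.and (.leN (.const 1) (A 1 own)) (.leR (entryE xE zE)
        (.mul (.cast (.mul (.const 2) e)) dE))).Holds Γ.α
          (conc Γ (fs σ [0] (k * Γ.I.n) G z)) ↔ z ∈ P := by
      rw [holds_and, holds_leR, evalR_mul, eval_dE (k := k) hat.hym hat.hwn (by simp [hat.hk])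
          (by simp [hat.hy]) (by simp [hat.hw]), eval_entryE
          (by
            have := hat.hxn
            simp [xE, kE, hat.hk, hat.hx]
            omega)
          (by
            simp [zE]
            omega), evalR_cast, eval_mul, he, hP, mem_near, mem_slice hz]
      simp [own, xE, zE, kE, hat.hk, hat.hx]
    by_cases hc : z ∈ P
    · refine (Run.ite_pos (eT.2 hc) (put_run₁ (by norm_num) (by norm_num)
        (by simp [kid, kE', kE, zE, hat.hk]) (by simp [hG, hc]))).mono ?_
      simp only [probeBody, flat]
      omega
    · refine (Run.ite_neg (fun h => hc (eT.1 h)) (put_run₁ (by norm_num) (by norm_num)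
        (by simp [kid, kE', kE, zE, hat.hk]) (by simp [hG, hc]))).mono ?_
      simp only [probeBody, flat]
      omega
  obtain ⟨σ₁, r2, f1, v1, i1⟩ := h.child hat.hk hat.hH hat.hq r1 (P := P)
    ((near_subset _ _ _).trans (Finset.filter_subset _ _)) (fun z hz => by
      simp only [hG]
      split_ifs with hc <;> simp [hc])
  have hc : flat callChild ≤ 100 := by decide +kernel
  exact ⟨σ₁, r2.mono (by omega), f1, v1, i1⟩

/-- The loop of `scanCode` computes `pick` for the costs of the concentric clusters. -/
theorem run_scan (h : SolveSpec Γ H q k T) (hu : T + 1000 * (Γ.I.n + 1) ≤ u) {σ : Mem}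
    {y w x : ℕ} (hat : At Γ H q k y w x σ) {v : ℕ → ℝ}
    (hv : ∀ i, v i = (solve Γ.I Γ.α H q k
        (near Γ.I x (2 * (i : ℝ) * sd Γ.I y w) (slice Γ.I.n 1 σ (k + 1)))).1)
    (h2 : σ.r 2 (k + 1) = v 0) (h3 : σ.r 3 (k + 1) = 0) (h10 : σ.a 10 (k + 1) = 0) :
    ∃ σ', Run Γ (forL 9 kE hE scanCode) σ ((H + 1) * (2 * u)) σ' ∧ Still Γ.I.n (k + 1) σ σ' ∧
      σ'.a 10 (k + 1) = pick v q H := by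
  have hkE : ∀ {σ' : Mem}, σ'.a 20 0 = k + 1 → kE.eval (conc Γ σ') = k + 1 := fun h => by
    simp [kE, h]
  obtain ⟨σ', r, s1, -, -, e3, -⟩ := for_rule (Γ := Γ) (σ := σ) (q := 9) (i := kE) (bound := hE)
    (body := scanCode) (N := H) (j := k + 1) (T := u + 700) (U := 2 * u)
    (Inv := fun z σ' => Still Γ.I.n (k + 1) σ σ' ∧ σ'.r 2 (k + 1) = (scan v q z).1 ∧
      σ'.r 3 (k + 1) = (scan v q z).2.1 ∧ σ'.a 10 (k + 1) = (scan v q z).2.2 ∧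
      σ'.a 9 (k + 1) = z)
    (by norm_num) (by
      have : forTime 9 kE hE ≤ 300 := by decide +kernel
      omega) (by
      rw [hkE hat.hk]
      refine ⟨Still.setA (by norm_num) (by norm_num), ?_, ?_, ?_, ?_⟩
      · simpa [scan, loop] using h2
      · simpa [scan, loop] using h3
      · simpa [scan, loop] using h10
      · simp) (by
      rintro z σ' ⟨s, -, -, -, h⟩
      have := hat.still s
      exact ⟨hkE this.hk, by simp [hE, this.hH], h⟩) (by
      rintro z hz σ₁ ⟨s1, p1, b1, i1, c1⟩
      have hat1 := hat.still s1
      obtain ⟨σ₂, r2, f2, v2, -⟩ := run_probe h hu hat1 (e := .add iE (.const 1)) (i := z + 1)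
        (by decide +kernel) (fun G z' => by simp [iE, kE, hat1.hk, c1])
      rw [s1.slice] at v2
      have e2 : σ₂.r 0 k = v (z + 1) := by rw [v2.1, hv]
      have s2 := f2.still
      have hat2 := hat1.still s2
      have p2 : σ₂.r 2 (k + 1) = (scan v q z).1 := by rw [f2.re 2 (by norm_num) _ (by omega), p1]
      have b2 : σ₂.r 3 (k + 1) = (scan v q z).2.1 := by rw [f2.re 3 (by norm_num) _ (by omega), b1]
      have i2 : σ₂.a 10 (k + 1) = (scan v q z).2.2 := by
        rw [f2.sc 10 (by norm_num) (by norm_num) _ (by omega), i1]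
      have c2 : σ₂.a 9 (k + 1) = z := by
        rw [f2.sc 9 (by norm_num) (by norm_num) _ (by omega), c1]
      set ex : RExpr := .sub (.mul (.cast qE) (R 0 kE'))
        (.mul (.cast (.add qE (.const 1))) (R 2 kE)) with hex
      have eex : ex.eval Γ.α (conc Γ σ₂) = q * v (z + 1) - (q + 1) * (scan v q z).1 := by
        simp [hex, qE, hat2.hq, kE', kE, hat2.hk, e2, p2]
      have eT : (orT (.leN iE (.const 0)) (ltR ex (R 3 kE))).Holds Γ.α (conc Γ σ₂) ↔
          z = 0 ∨ q * v (z + 1) - (q + 1) * (scan v q z).1 < (scan v q z).2.1 := by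
        rw [holds_orT, holds_ltR, eex]
        simp [iE, kE, hat2.hk, c2, b2]
      have hs : scan v q (z + 1) = (if z = 0 ∨
          q * v (z + 1) - (q + 1) * (scan v q z).1 < (scan v q z).2.1 then
        (v (z + 1), q * v (z + 1) - (q + 1) * (scan v q z).1, z + 1)
        else (v (z + 1), (scan v q z).2.1, (scan v q z).2.2)) := rfl
      have hsz : (orT (.leN iE (.const 0)) (ltR ex (R 3 kE))).size + flat (putR 3 kE ex) +
        flat (putA 10 kE (.add iE (.const 1))) + flat (putR 2 kE (R 0 kE')) + 10 ≤ 700 := by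
        decide +kernel
      by_cases hc : z = 0 ∨ q * v (z + 1) - (q + 1) * (scan v q z).1 < (scan v q z).2.1
      · have a1 := Run.putR (Γ := Γ) (σ := σ₂) (q := 3) (i := kE) (e := ex) (by norm_num)
        rw [eex, hkE hat2.hk] at a1
        set xv := q * v (z + 1) - (q + 1) * (scan v q z).1 with hxv
        have a2 := Run.putA (Γ := Γ) (σ := σ₂.setR 3 (k + 1) xv) (q := 10) (i := kE)
          (e := .add iE (.const 1)) (by norm_num)
        rw [hkE (by simpa using hat2.hk), show (NExpr.add iE (.const 1)).eval
          (conc Γ (σ₂.setR 3 (k + 1) xv)) = z + 1 by simp [iE, kE, hat2.hk, c2]] at a2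
        have a3 := Run.putR (Γ := Γ) (σ := (σ₂.setR 3 (k + 1) xv).setA 10 (k + 1) (z + 1)) (q := 2)
          (i := kE) (e := R 0 kE') (by norm_num)
        rw [hkE (by simpa using hat2.hk), show (R 0 kE').eval Γ.α
          (conc Γ ((σ₂.setR 3 (k + 1) xv).setA 10 (k + 1) (z + 1))) = v (z + 1) by
            simp [kE', kE, hat2.hk, e2]] at a3
        refine ⟨_, (r2.seq ((Run.ite_pos (eT.2 hc) (a1.seq a2)).seq a3)).mono (by omega),
          hkE (by simpa using hat2.hk), by simp [c2], ?_, ?_⟩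
        · exact (((((s1.trans s2).trans (Still.setR (by norm_num))).trans
            (Still.setA (by norm_num) (by norm_num))).trans (Still.setR (by norm_num))).trans
            (Still.setA (by norm_num) (by norm_num)))
        · rw [hs, if_pos hc]
          simp
      · have a3 := Run.putR (Γ := Γ) (σ := σ₂) (q := 2) (i := kE) (e := R 0 kE') (by norm_num)
        rw [hkE hat2.hk, show (R 0 kE').eval Γ.α (conc Γ σ₂) = v (z + 1) by
            simp [kE', kE, hat2.hk, e2]] at a3
        refine ⟨_, (r2.seq ((Run.ite_neg (fun h => hc (eT.1 h)) Run.skip).seq a3)).mono (by omega),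
          hkE (by simpa using hat2.hk), by simp [c2], ?_, ?_⟩
        · exact ((((s1.trans s2).trans (Still.setR (by norm_num))).trans
            (Still.setA (by norm_num) (by norm_num))))
        · rw [hs, if_neg hc]
          simp [b2, i2])
  exact ⟨σ', r, s1, e3⟩

end Probe

/-! ### Correctness of carving and of the recursive procedure -/

/-- The state `st` of the carving procedure is stored in the frame of recursion depth `κ`. -/
structure CRes (n : ℕ) (σ : Mem) (κ : ℕ) (st : Finset ℕ × ℝ × (ℕ → ℕ × ℕ)) : Prop where
  set : slice n 1 σ κ = st.1
  val : σ.r 1 κ = st.2.1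
  asg : ∀ z < n, σ.a 4 (κ * n + z) = (st.2.2 z).1 ∧ σ.a 5 (κ * n + z) = (st.2.2 z).2

/-- The frame of recursion depth `κ` is preserved except for the data of the carving procedure. -/
structure Part (n κ : ℕ) (σ σ' : Mem) : Prop where
  keep : Keep n κ σ σ'
  v2 : ∀ z, σ'.a 2 (κ * n + z) = σ.a 2 (κ * n + z)
  v3 : ∀ z, σ'.a 3 (κ * n + z) = σ.a 3 (κ * n + z)
  r0 : σ'.r 0 κ = σ.r 0 κ

section Frames

variable {n κ : ℕ} {σ σ₁ σ₂ : Mem}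

theorem Part.trans (h : Part n κ σ σ₁) (h' : Part n κ σ₁ σ₂) : Part n κ σ σ₂ where
  keep := h.keep.trans h'.keep
  v2 z := (h'.v2 z).trans (h.v2 z)
  v3 z := (h'.v3 z).trans (h.v3 z)
  r0 := h'.r0.trans h.r0

theorem Still.part (h : Still n κ σ σ₁) : Part n κ σ σ₁ :=
  ⟨h.keep, h.own 2 (by norm_num), h.own 3 (by norm_num), h.r0⟩

theorem Part.setA {v : ℕ} : Part n κ σ (σ.setA 8 κ v) :=
  ⟨Keep.setA (by norm_num) (by norm_num), fun z => by simp, fun z => by simp, rfl⟩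

theorem Part.setR {v : ℝ} : Part n κ σ (σ.setR 1 κ v) :=
  ⟨Keep.setR, fun _ => rfl, fun _ => rfl, by simp⟩

theorem Part.fs {G : ℕ → ℕ → ℕ} : Part n κ σ (fs σ [4, 5, 1] (κ * n) G n) :=
  ⟨Keep.fs (by simp) (by simp), fun z => by simp, fun z => by simp, rfl⟩

theorem Part.res {r : ℝ × (ℕ → ℕ × ℕ)} (h : Part n κ σ σ₁) (hr : Res n σ κ r) : Res n σ₁ κ r :=
  ⟨by rw [h.r0, hr.1], fun z hz => by rw [h.v2, h.v3]; exact hr.2 z hz⟩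

end Frames

section Step

variable {Γ : Env} {H q k T u : ℕ}

/-- `stepCode` computes `carveStep`. -/
theorem run_step (h : SolveSpec Γ H q k T) (hu : T + 1000 * (Γ.I.n + 1) ≤ u) {σ : Mem}
    {y w x : ℕ} (hat : At Γ H q k y w x σ) {st : Finset ℕ × ℝ × (ℕ → ℕ × ℕ)}
    (hst : CRes Γ.I.n σ (k + 1) st) (hx : x ∈ st.1) :
    ∃ σ', Run Γ stepCode σ ((H + 1) * (7 * u)) σ' ∧ Part Γ.I.n (k + 1) σ σ' ∧
      σ'.a 8 (k + 1) = x ∧ CRes Γ.I.n σ' (k + 1)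
        (carveStep Γ.I H q (solve Γ.I Γ.α H q k) (sd Γ.I y w) x st) := by
  have hkE : ∀ {σ' : Mem}, σ'.a 20 0 = k + 1 → kE.eval (conc Γ σ') = k + 1 := fun h => by
    simp [kE, h]
  obtain ⟨σ₁, r1, f1, v1, -⟩ := run_probe h hu hat (e := .const 0) (i := 0) (by decide +kernel)
    (fun G z => rfl)
  rw [hst.set] at v1
  set v : ℕ → ℝ := fun i => (solve Γ.I Γ.α H q k
    (near Γ.I x (2 * (i : ℝ) * sd Γ.I y w) st.1)).1 with hv
  have hat1 := hat.still f1.still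
  have r2 := Run.putR (Γ := Γ) (σ := σ₁) (q := 2) (i := kE) (e := R 0 kE') (by norm_num)
  rw [hkE hat1.hk, eval_R (by norm_num), show kE'.eval (conc Γ σ₁) = k by
    simp [kE', kE, hat1.hk], v1.1, show (solve Γ.I Γ.α H q k
    (near Γ.I x (2 * ((0 : ℕ) : ℝ) * sd Γ.I y w) st.1)).1 = v 0 from rfl] at r2
  have r3 := Run.putR (Γ := Γ) (σ := σ₁.setR 2 (k + 1) (v 0)) (q := 3) (i := kE) (e := zeroE)
    (by norm_num)
  rw [hkE (by simpa using hat1.hk), evalR_zeroE] at r3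
  have r4 := Run.putA (Γ := Γ) (σ := (σ₁.setR 2 (k + 1) (v 0)).setR 3 (k + 1) 0) (q := 10)
    (i := kE) (e := .const 0) (by norm_num)
  rw [hkE (by simpa using hat1.hk), eval_const] at r4
  set σ₄ := ((σ₁.setR 2 (k + 1) (v 0)).setR 3 (k + 1) 0).setA 10 (k + 1) 0 with hσ₄
  have s4 : Still Γ.I.n (k + 1) σ σ₄ := ((f1.still.trans (Still.setR (by norm_num))).trans
    (Still.setR (by norm_num))).trans (Still.setA (by norm_num) (by norm_num))
  obtain ⟨σ₅, r5, s5, b5⟩ := run_scan h hu (hat.still s4) (v := v)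
    (fun i => by rw [s4.slice, hst.set]) (by simp [hσ₄]) (by simp [hσ₄]) (by simp [hσ₄])
  have s5 := s4.trans s5
  have hat5 := hat.still s5
  obtain ⟨σ₆, r6, f6, v6, i6⟩ := run_probe h hu hat5 (e := bE) (i := pick v q H)
    (by decide +kernel) (fun G z => by simp [bE, kE, hat5.hk, b5])
  rw [s5.slice, hst.set] at v6 i6
  set P := near Γ.I x (2 * (pick v q H : ℝ) * sd Γ.I y w) st.1 with hP
  have s6 := s5.trans f6.still
  have hat6 := hat.still s6
  have hk6 := hat6.hk
  have r7 := Run.putR (Γ := Γ) (σ := σ₆) (q := 1) (i := kE) (e := .add (R 1 kE) (R 0 kE'))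
    (by norm_num)
  rw [hkE hk6, show (RExpr.add (R 1 kE) (R 0 kE')).eval Γ.α (conc Γ σ₆) =
    st.2.1 + (solve Γ.I Γ.α H q k P).1 by
      simp [kE', kE, hk6, v6.1, s6.r1, hst.val]] at r7
  set σ₇ := σ₆.setR 1 (k + 1) (st.2.1 + (solve Γ.I Γ.α H q k P).1) with hσ₇
  have hk7 : σ₇.a 20 0 = k + 1 := hk6
  set G : ℕ → ℕ → ℕ := fun p z => if z ∈ P then
    (if p = 4 then σ₆.a 2 (k * Γ.I.n + z) else if p = 5 then σ₆.a 3 (k * Γ.I.n + z) else 0)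
    else σ₆.a p ((k + 1) * Γ.I.n + z) with hG
  have r8 : Run Γ (fillL (.ite (.leN (.const 1) (A 0 kid))
          (.seq (putA 4 own (A 2 kid)) (.seq (putA 5 own (A 3 kid)) (putA 1 own (.const 0))))
          (.seq (putA 4 own (A 4 own)) (.seq (putA 5 own (A 5 own)) (putA 1 own (A 1 own))))))
      σ₇ ((Γ.I.n + 1) * 600) (fs σ₇ [4, 5, 1] ((k + 1) * Γ.I.n) G Γ.I.n) := by
    refine fill_rule (T := 500) [4, 5, 1] ((k + 1) * Γ.I.n) G (by decide +kernel) fun z hz => ?_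
    have eT : (Test.leN (.const 1) (A 0 kid)).Holds Γ.α
        (conc Γ (fs σ₇ [4, 5, 1] ((k + 1) * Γ.I.n) G z)) ↔ z ∈ P := by
      rw [← i6 z hz]
      simp [kid, kE', kE, zE, hk7]
      rfl
    by_cases hc : z ∈ P
    · refine (Run.ite_pos (eT.2 hc) (put_run₃ (by norm_num) (by norm_num) (by norm_num)
        (by norm_num) (by norm_num) (by norm_num) ?_ ?_ ?_ ?_ ?_ ?_)).mono (by decide +kernel)
      all_goals simp [own, kid, kE', kE, zE, hk6, hσ₇, hG, hc]
    · refine (Run.ite_neg (fun h => hc (eT.1 h)) (put_run₃ (by norm_num) (by norm_num)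
        (by norm_num) (by norm_num) (by norm_num) (by norm_num) ?_ ?_ ?_ ?_ ?_ ?_)).mono
          (by decide +kernel)
      all_goals simp [own, kE, zE, hk6, hσ₇, hG, hc]
  refine ⟨_, (r1.seq (r2.seq (r3.seq (r4.seq (r5.seq (r6.seq (r7.seq r8))))))).mono ?_,
    (s6.part.trans Part.setR).trans Part.fs, ?_, ?_⟩
  · have h1 : flat (putR 2 kE (R 0 kE')) + flat (putR 3 kE zeroE) + flat (putA 10 kE (.const 0)) +
      flat (putR 1 kE (.add (R 1 kE) (R 0 kE'))) ≤ 400 := by decide +kernel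
    have h2 : (H + 1) * (7 * u) = (H + 1) * (2 * u) + 5 * (H * u) + 5 * u := by ring
    omega
  · simp [hσ₇, hat6.hx]
  · rw [carveStep, if_pos hx]
    refine ⟨?_, by simp [hσ₇, hP, hv], fun z hz => ?_⟩
    · refine slice_eq (Finset.sdiff_subset.trans ?_) fun z hz => ?_
      · rw [← hst.set]
        exact Finset.filter_subset _ _
      · have := mem_slice (σ := σ₆) (q := 1) (κ := k + 1) hz
        rw [s6.slice, hst.set] at this
        change _ ↔ z ∈ st.1 \ P
        rw [Finset.mem_sdiff, this]
        by_cases hc : z ∈ P <;> simp [hz, hG, hc]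
    · change _ = (if z ∈ P then (solve Γ.I Γ.α H q k P).2 z else st.2.2 z).1 ∧
        _ = (if z ∈ P then (solve Γ.I Γ.α H q k P).2 z else st.2.2 z).2
      have e1 := hst.asg z hz
      have e2 := v6.2 z hz
      by_cases hc : z ∈ P
      · simp [hz, hG, hc, e2.1, e2.2]
      · simp [hz, hG, hc, s6.own 4, s6.own 5, e1.1, e1.2]

/-- `carveCode` replaces the current solution by that of `carve` if this is cheaper. -/
theorem run_carve (h : SolveSpec Γ H q k T) (hu : T + 1000 * (Γ.I.n + 1) ≤ u) {σ : Mem}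
    (hk : σ.a 20 0 = k + 1) (hH : σ.a 21 0 = H) (hq : σ.a 22 0 = q) {y w : ℕ}
    (hy : σ.a 6 (k + 1) = y) (hw : σ.a 7 (k + 1) = w) (hym : y < Γ.I.m) (hwn : w < Γ.I.n)
    {acc : ℝ × (ℕ → ℕ × ℕ)} (hacc : Res Γ.I.n σ (k + 1) acc) :
    ∃ σ', Run Γ carveCode σ ((Γ.I.n + 1) * ((H + 1) * (10 * u))) σ' ∧
      Keep Γ.I.n (k + 1) σ σ' ∧ Res Γ.I.n σ' (k + 1) (better (carve Γ.I H q
        (solve Γ.I Γ.α H q k) (sd Γ.I y w) (slice Γ.I.n 0 σ (k + 1))).2 acc) := by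
  have hkE : ∀ {σ' : Mem}, σ'.a 20 0 = k + 1 → kE.eval (conc Γ σ') = k + 1 := fun h => by
    simp [kE, h]
  set S := slice Γ.I.n 0 σ (k + 1) with hS
  set G : ℕ → ℕ → ℕ := fun p z => if p = 1 then σ.a 0 ((k + 1) * Γ.I.n + z) else 0 with hG
  have r1 : Run Γ (fillL (.seq (putA 4 own (.const 0)) (.seq (putA 5 own (.const 0))
      (putA 1 own (A 0 own))))) σ ((Γ.I.n + 1) * 400)
      (fs σ [4, 5, 1] ((k + 1) * Γ.I.n) G Γ.I.n) := by
    refine fill_rule (T := 300) [4, 5, 1] ((k + 1) * Γ.I.n) G (by decide +kernel) fun z hz => ?_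
    refine (put_run₃ (by norm_num) (by norm_num) (by norm_num)
        (by norm_num) (by norm_num) (by norm_num) ?_ ?_ ?_ ?_ ?_ ?_).mono (by decide +kernel)
    all_goals simp [own, kE, zE, hk, hG]
  set σ₁ := fs σ [4, 5, 1] ((k + 1) * Γ.I.n) G Γ.I.n with hσ₁
  have r2 := Run.putR (Γ := Γ) (σ := σ₁) (q := 1) (i := kE) (e := zeroE) (by norm_num)
  rw [hkE (by simp [hσ₁, hk]), evalR_zeroE] at r2
  set σ₂ := σ₁.setR 1 (k + 1) 0 with hσ₂
  have p2 : Part Γ.I.n (k + 1) σ σ₂ := Part.fs.trans Part.setR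
  set st : ℕ → Finset ℕ × ℝ × (ℕ → ℕ × ℕ) :=
    loop (carveStep Γ.I H q (solve Γ.I Γ.α H q k) (sd Γ.I y w)) (S, 0, fun _ => (0, 0)) with hst
  obtain ⟨σ₃, r3, p3, c3, -⟩ := for_rule (Γ := Γ) (σ := σ₂) (q := 8) (i := kE) (bound := nN)
    (body := .ite (.leN (.const 1) (A 1 (.add (.mul kE nN) xE))) stepCode .skip) (N := Γ.I.n)
    (j := k + 1) (T := (H + 1) * (7 * u) + 200) (U := (H + 1) * (8 * u))
    (Inv := fun x σ' => Part Γ.I.n (k + 1) σ σ' ∧ CRes Γ.I.n σ' (k + 1) (st x) ∧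
      σ'.a 8 (k + 1) = x) (by norm_num) (by
      have h1 : forTime 8 kE nN ≤ 300 := by decide +kernel
      have h2 : (H + 1) * (8 * u) = (H + 1) * (7 * u) + H * u + u := by ring
      omega) (by
      rw [hkE (by simp [hσ₂, hσ₁, hk])]
      refine ⟨p2.trans Part.setA, ⟨?_, ?_, fun z hz => ?_⟩, by simp⟩
      · refine slice_eq (Finset.filter_subset _ _) fun z hz => ?_
        change _ ↔ z ∈ S
        rw [hS, mem_slice hz]
        simp [hσ₂, hσ₁, hz, hG]
      · simp [hσ₂, hst, loop]
      · simp [hσ₂, hσ₁, hst, loop, hz, hG]) (by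
      rintro x σ' ⟨p, -, c⟩
      exact ⟨hkE (by rw [p.keep.fr.glob 20 (by norm_num), hk]), rfl, c⟩) (by
      rintro x hx σ' ⟨p, cr, c⟩
      have hk' : σ'.a 20 0 = k + 1 := by rw [p.keep.fr.glob 20 (by norm_num), hk]
      have eT : (Test.leN (.const 1) (A 1 (.add (.mul kE nN) xE))).Holds Γ.α (conc Γ σ') ↔
          x ∈ (st x).1 := by
        rw [← cr.set, mem_slice hx]
        simp [kE, xE, hk', c]
      have hs : st (x + 1) = carveStep Γ.I H q (solve Γ.I Γ.α H q k) (sd Γ.I y w) x (st x) := rfl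
      have hsz : (Test.leN (.const 1) (A 1 (.add (.mul kE nN) xE))).size + 10 ≤ 200 := by
        decide +kernel
      have key : ∀ σ'', CRes Γ.I.n σ'' (k + 1) (st (x + 1)) →
          CRes Γ.I.n (σ''.setA 8 (k + 1) (x + 1)) (k + 1) (st (x + 1)) := fun σ'' hc =>
        ⟨by rw [← hc.set]; simp [slice], hc.val, fun z hz => by simpa using hc.asg z hz⟩
      by_cases hc : x ∈ (st x).1
      · obtain ⟨σ'', r4, p4, c4, cr4⟩ := run_step h hu (y := y) (w := w) (x := x) (σ := σ')
          ⟨hk', by rw [p.keep.fr.glob 21 (by norm_num), hH],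
            by rw [p.keep.fr.glob 22 (by norm_num), hq], by rw [p.keep.yc, hy],
            by rw [p.keep.wc, hw], c, hym, hwn, hx⟩ cr hc
        exact ⟨σ'', (Run.ite_pos (eT.2 hc) r4).mono (by omega),
          hkE (by rw [p4.keep.fr.glob 20 (by norm_num), hk']), c4, (p.trans p4).trans Part.setA,
          key _ (by rw [hs]; exact cr4), by simp⟩
      · refine ⟨σ', (Run.ite_neg (fun h => hc (eT.1 h)) Run.skip).mono (by omega), hkE hk', c,
          p.trans Part.setA, key _ ?_, by simp⟩
        rw [hs, carveStep, if_neg hc]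
        exact cr)
  have hcv : (carve Γ.I H q (solve Γ.I Γ.α H q k) (sd Γ.I y w) S) = st Γ.I.n := rfl
  rw [hcv]
  have hk3 : σ₃.a 20 0 = k + 1 := by rw [p3.keep.fr.glob 20 (by norm_num), hk]
  have hacc3 := p3.res hacc
  have eT : (ltR (R 1 kE) (R 0 kE)).Holds Γ.α (conc Γ σ₃) ↔ (st Γ.I.n).2.1 < acc.1 := by
    rw [holds_ltR]
    simp [kE, hk3, c3.val, hacc3.1]
  have ht : (Γ.I.n + 1) * 400 + ((Γ.I.n + 1) * ((H + 1) * (8 * u)) + u) ≤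
      (Γ.I.n + 1) * ((H + 1) * (10 * u)) := by
    have h1 : (Γ.I.n + 1) * ((H + 1) * (10 * u)) = (Γ.I.n + 1) * ((H + 1) * (8 * u)) +
      2 * (Γ.I.n * (H * u) + H * u + Γ.I.n * u) + 2 * u := by ring
    omega
  have hsz : flat (putR 1 kE zeroE) + (ltR (R 1 kE) (R 0 kE)).size +
    flat (putR 0 kE (R 1 kE)) + 10 ≤ 300 := by decide +kernel
  by_cases hc : (st Γ.I.n).2.1 < acc.1
  · rw [better, if_pos hc]
    set G' : ℕ → ℕ → ℕ := fun p z => if p = 2 then ((st Γ.I.n).2.2 z).1 else ((st Γ.I.n).2.2 z).2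
      with hG'
    have r4 : Run Γ (fillL (.seq (putA 2 own (A 4 own)) (putA 3 own (A 5 own)))) σ₃
        ((Γ.I.n + 1) * 400) (fs σ₃ [2, 3] ((k + 1) * Γ.I.n) G' Γ.I.n) := by
      refine fill_rule (T := 300) [2, 3] ((k + 1) * Γ.I.n) G' (by decide +kernel) fun z hz => ?_
      refine (put_run₂ (by norm_num) (by norm_num) (by norm_num) ?_ ?_ ?_ ?_).mono
        (by decide +kernel)
      all_goals simp [own, kE, zE, hk3, hG', c3.asg z hz]
    have r5 := Run.putR (Γ := Γ) (σ := fs σ₃ [2, 3] ((k + 1) * Γ.I.n) G' Γ.I.n) (q := 0) (i := kE)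
      (e := R 1 kE) (by norm_num)
    rw [hkE (by simp [hk3]), eval_R (by norm_num), hkE (by simp [hk3]), fs_r, c3.val] at r5
    refine ⟨_, (r1.seq (r2.seq (r3.seq (Run.ite_pos (eT.2 hc) (r4.seq r5))))).mono (by omega),
      (p3.keep.trans (Keep.fs (by simp) (by simp))).trans Keep.setR, by simp, fun z hz => ?_⟩
    simp [hz, hG']
  · rw [better, if_neg hc]
    exact ⟨σ₃, (r1.seq (r2.seq (r3.seq (Run.ite_neg (fun h => hc (eT.1 h)) Run.skip)))).mono
      (by omega), p3.keep, hacc3⟩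

/-- The double loop of `nodeCode` tries both moves for all servers and clients. -/
theorem run_pairs (h : SolveSpec Γ H q k T) (hu : T + 1000 * (Γ.I.n + 1) ≤ u) {σ : Mem}
    (hk : σ.a 20 0 = k + 1) (hH : σ.a 21 0 = H) (hq : σ.a 22 0 = q) {S : Finset ℕ}
    (hS : slice Γ.I.n 0 σ (k + 1) = S) {acc : ℝ × (ℕ → ℕ × ℕ)} (hacc : Res Γ.I.n σ (k + 1) acc) :
    ∃ σ', Run Γ (forL 6 kE nM (forL 7 kE nN (.seq coverCode carveCode))) σ
        ((Γ.I.m + 1) * ((Γ.I.n + 1) * ((Γ.I.n + 1) * ((H + 1) * (15 * u))))) σ' ∧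
      Fr Γ.I.n (k + 1) σ σ' ∧
      (∀ z < Γ.I.n, σ'.a 0 ((k + 1) * Γ.I.n + z) = σ.a 0 ((k + 1) * Γ.I.n + z)) ∧
      Res Γ.I.n σ' (k + 1) (loop (fun y acc => loop (fun w acc =>
        tryPair Γ.I Γ.α H q (solve Γ.I Γ.α H q k) S y w acc) acc Γ.I.n) acc Γ.I.m) := by
  have hkE : ∀ {σ' : Mem}, Fr Γ.I.n (k + 1) σ σ' → kE.eval (conc Γ σ') = k + 1 := fun h => by
    simp [kE, h.glob 20, hk]
  have hv : (Γ.I.n + 1) * ((H + 1) * u) = Γ.I.n * H * u + Γ.I.n * u + H * u + u := by ring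
  have hw : (Γ.I.n + 1) * ((Γ.I.n + 1) * ((H + 1) * u)) = (Γ.I.n + 1) * Γ.I.n * (H + 1) * u +
    (Γ.I.n * H * u + Γ.I.n * u + H * u + u) := by ring
  have hR : ∀ {σ' : Mem} {acc} {p v : ℕ}, 6 ≤ p → Res Γ.I.n σ' (k + 1) acc →
      Res Γ.I.n (σ'.setA p (k + 1) v) (k + 1) acc := fun hp hr =>
    ⟨hr.1, fun z hz => by
      have := hr.2 z hz
      rw [Mem.setA_a, Mem.setA_a, if_neg (by omega), if_neg (by omega)]
      exact this⟩
  obtain ⟨σ', r, f, i, rs, -⟩ := for_rule (Γ := Γ) (σ := σ) (q := 6) (i := kE) (bound := nM)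
    (body := forL 7 kE nN (.seq coverCode carveCode)) (N := Γ.I.m) (j := k + 1)
    (T := (Γ.I.n + 1) * ((Γ.I.n + 1) * ((H + 1) * (14 * u))))
    (U := (Γ.I.n + 1) * ((Γ.I.n + 1) * ((H + 1) * (15 * u))))
    (Inv := fun y σ' => Fr Γ.I.n (k + 1) σ σ' ∧
      (∀ z < Γ.I.n, σ'.a 0 ((k + 1) * Γ.I.n + z) = σ.a 0 ((k + 1) * Γ.I.n + z)) ∧
      Res Γ.I.n σ' (k + 1) (loop (fun y acc => loop (fun w acc =>
        tryPair Γ.I Γ.α H q (solve Γ.I Γ.α H q k) S y w acc) acc Γ.I.n) acc y) ∧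
      σ'.a 6 (k + 1) = y) (by norm_num) (by
      have h1 : forTime 6 kE nM ≤ 300 := by decide +kernel
      have h2 : ∀ c, (Γ.I.n + 1) * ((Γ.I.n + 1) * ((H + 1) * (c * u))) =
        c * ((Γ.I.n + 1) * ((Γ.I.n + 1) * ((H + 1) * u))) := fun c => by ring
      rw [h2, h2]
      omega) (by
      rw [hkE Fr.refl]
      exact ⟨Fr.setA (by norm_num) (by norm_num), fun z hz => by simp, hR le_rfl hacc, by simp⟩) (by
      rintro y σ' ⟨f, -, -, c⟩
      exact ⟨hkE f, rfl, c⟩) (by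
      rintro y hy σ₁ ⟨f1, i1, rs1, c1⟩
      set acc₁ := loop (fun y acc => loop (fun w acc =>
        tryPair Γ.I Γ.α H q (solve Γ.I Γ.α H q k) S y w acc) acc Γ.I.n) acc y with hacc₁
      obtain ⟨σ₂, r2, f2, i2, rs2, c2, -⟩ := for_rule (Γ := Γ) (σ := σ₁) (q := 7) (i := kE)
        (bound := nN) (body := .seq coverCode carveCode) (N := Γ.I.n) (j := k + 1)
        (T := (Γ.I.n + 1) * ((H + 1) * (13 * u))) (U := (Γ.I.n + 1) * ((H + 1) * (14 * u)))
        (Inv := fun w σ' => Fr Γ.I.n (k + 1) σ σ' ∧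
          (∀ z < Γ.I.n, σ'.a 0 ((k + 1) * Γ.I.n + z) = σ.a 0 ((k + 1) * Γ.I.n + z)) ∧
          Res Γ.I.n σ' (k + 1) (loop (fun w acc =>
            tryPair Γ.I Γ.α H q (solve Γ.I Γ.α H q k) S y w acc) acc₁ w) ∧
          σ'.a 6 (k + 1) = y ∧ σ'.a 7 (k + 1) = w) (by norm_num) (by
          have h1 : forTime 7 kE nN ≤ 300 := by decide +kernel
          have h2 : ∀ c, (Γ.I.n + 1) * ((H + 1) * (c * u)) =
            c * ((Γ.I.n + 1) * ((H + 1) * u)) := fun c => by ring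
          rw [h2, h2]
          omega) (by
          rw [hkE f1]
          exact ⟨f1.trans (Fr.setA (by norm_num) (by norm_num)), fun z hz => by simpa using i1 z hz,
            hR (by norm_num) rs1, by simpa using c1, by simp⟩) (by
          rintro w σ' ⟨f, -, -, -, c⟩
          exact ⟨hkE f, rfl, c⟩) (by
          rintro w hw σ₃ ⟨f3, i3, rs3, c3, d3⟩
          have hS3 : slice Γ.I.n 0 σ₃ (k + 1) = S := by
            rw [← hS]
            exact Finset.filter_congr fun z hz => by rw [i3 z (Finset.mem_range.1 hz)]
          have g : ∀ {σ'}, Fr Γ.I.n (k + 1) σ σ' →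
              σ'.a 20 0 = k + 1 ∧ σ'.a 21 0 = H ∧ σ'.a 22 0 = q := fun f =>
            ⟨by rw [f.glob 20 (by norm_num), hk], by rw [f.glob 21 (by norm_num), hH],
              by rw [f.glob 22 (by norm_num), hq]⟩
          obtain ⟨σ₄, r4, p4, rs4⟩ := run_cover h hu (g f3).1 (g f3).2.1 (g f3).2.2 c3 d3 hy hw rs3
          have f4 := f3.trans p4.fr
          obtain ⟨σ₅, r5, p5, rs5⟩ := run_carve h hu (g f4).1 (g f4).2.1 (g f4).2.2
            (p4.yc.trans c3) (p4.wc.trans d3) hy hw rs4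
          have p := p4.trans p5
          rw [p4.slice, hS3] at rs5
          have f5 := f3.trans p.fr
          refine ⟨σ₅, (r4.seq r5).mono ?_, hkE f5, p.wc.trans d3,
            f5.trans (Fr.setA (by norm_num) (by norm_num)),
            fun z hz => by simpa using (p.inp z hz).trans (i3 z hz), ?_,
            by simpa using p.yc.trans c3, by simp⟩
          · have h2 : ∀ c, (Γ.I.n + 1) * ((H + 1) * (c * u)) =
              c * ((Γ.I.n + 1) * ((H + 1) * u)) := fun c => by ring
            rw [h2, h2]
            omega
          · exact hR (by norm_num) rs5)
      refine ⟨σ₂, r2, hkE f2, c2, f2.trans (Fr.setA (by norm_num) (by norm_num)),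
        fun z hz => by simpa using i2 z hz, hR le_rfl rs2, by simp⟩)
  exact ⟨σ', r, f, i, rs⟩

/-- `nodeCode` computes `solve (k + 1)` by recursive calls of depth `k`. -/
theorem run_node (h : SolveSpec Γ H q k T) (hu : T + 1000 * (Γ.I.n + 1) ≤ u) {σ : Mem}
    (hk : σ.a 20 0 = k + 1) (hH : σ.a 21 0 = H) (hq : σ.a 22 0 = q) :
    ∃ σ', Run Γ nodeCode σ
        ((Γ.I.m + 1) * ((Γ.I.n + 1) * ((Γ.I.n + 1) * ((H + 1) * (18 * u))))) σ' ∧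
      Fr Γ.I.n (k + 1) σ σ' ∧ Res Γ.I.n σ' (k + 1) (solve Γ.I Γ.α H q (k + 1)
        (slice Γ.I.n 0 σ (k + 1))) ∧
      ∀ z < Γ.I.n, σ'.a 0 ((k + 1) * Γ.I.n + z) = σ.a 0 ((k + 1) * Γ.I.n + z) := by
  set S := slice Γ.I.n 0 σ (k + 1) with hS
  set G : ℕ → ℕ → ℕ := fun _ z => σ.a 0 ((k + 1) * Γ.I.n + z) with hG
  have r1 : Run Γ (fillL (putA 0 kid (A 0 own))) σ ((Γ.I.n + 1) * 300)
      (fs σ [0] (k * Γ.I.n) G Γ.I.n) := by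
    refine fill_rule (T := 200) [0] (k * Γ.I.n) G (by decide +kernel) fun z hz => ?_
    exact (put_run₁ (by norm_num) (by norm_num) (by simp [kid, kE', kE, zE, hk])
      (by simp [own, kE, zE, hG, hk, not_own_lt hz.le])).mono (by decide +kernel)
  obtain ⟨σ₁, r2, f1, v1, -⟩ := h.child hk hH hq r1 (P := S) (Finset.filter_subset _ _)
    (fun z hz => (mem_slice hz).symm)
  have hk1 : σ₁.a 20 0 = k + 1 := by rw [f1.glob 20 (by norm_num), hk]
  set G' : ℕ → ℕ → ℕ := fun p z => σ₁.a p (k * Γ.I.n + z) with hG'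
  have r3 : Run Γ (fillL (.seq (putA 2 own (A 2 kid)) (putA 3 own (A 3 kid)))) σ₁
      ((Γ.I.n + 1) * 400) (fs σ₁ [2, 3] ((k + 1) * Γ.I.n) G' Γ.I.n) := by
    refine fill_rule (T := 300) [2, 3] ((k + 1) * Γ.I.n) G' (by decide +kernel) fun z hz => ?_
    refine (put_run₂ (by norm_num) (by norm_num) (by norm_num) ?_ ?_ ?_ ?_).mono
      (by decide +kernel)
    all_goals simp [own, kid, kE', kE, zE, hk1, hG', not_own_le hz]
  set σ₂ := fs σ₁ [2, 3] ((k + 1) * Γ.I.n) G' Γ.I.n with hσ₂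
  have r4 := Run.putR (Γ := Γ) (σ := σ₂) (q := 0) (i := kE) (e := R 0 kE') (by norm_num)
  rw [eval_R (by norm_num), show kE.eval (conc Γ σ₂) = k + 1 by simp [kE, hσ₂, hk1],
    show kE'.eval (conc Γ σ₂) = k by simp [kE', kE, hσ₂, hk1], hσ₂, fs_r, v1.1, ← hσ₂] at r4
  set σ₃ := σ₂.setR 0 (k + 1) (solve Γ.I Γ.α H q k S).1 with hσ₃
  have k3 : Keep Γ.I.n (k + 1) σ σ₃ :=
    (f1.keep.trans (Keep.fs (by simp) (by simp))).trans Keep.setR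
  obtain ⟨σ₄, r5, f5, i5, v5⟩ := run_pairs h hu (σ := σ₃) (acc := solve Γ.I Γ.α H q k S)
    (by rw [k3.fr.glob 20 (by norm_num), hk]) (by rw [k3.fr.glob 21 (by norm_num), hH])
    (by rw [k3.fr.glob 22 (by norm_num), hq]) (k3.slice.trans hS.symm) ⟨by simp [hσ₃],
      fun z hz => by simpa [hσ₃, hσ₂, hz, hG'] using v1.2 z hz⟩
  refine ⟨σ₄, (r2.seq ((r3.seq r4).seq r5)).mono ?_, k3.fr.trans f5, v5,
    fun z hz => (i5 z hz).trans (k3.inp z hz)⟩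
  have h1 : flat callChild + flat (putR 0 kE (R 0 kE')) ≤ 300 := by decide +kernel
  have h2 : ∀ c, (Γ.I.m + 1) * ((Γ.I.n + 1) * ((Γ.I.n + 1) * ((H + 1) * (c * u)))) =
    c * ((Γ.I.m + 1) * ((Γ.I.n + 1) * ((Γ.I.n + 1) * ((H + 1) * u)))) := fun c => by ring
  have h3 : u ≤ (Γ.I.m + 1) * ((Γ.I.n + 1) * ((Γ.I.n + 1) * ((H + 1) * u))) := by
    have h4 : ∀ a b : ℕ, b ≤ (a + 1) * b := fun a b => Nat.le_mul_of_pos_left _ (by omega)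
    exact (h4 H u).trans ((h4 _ _).trans ((h4 _ _).trans (h4 _ _)))
  rw [h2, h2]
  omega

end Step

/-- An upper bound for the running time of the recursive procedure for recursion depth `k`. -/
def solveTime (n m H k : ℕ) : ℕ :=
  (40 * ((m + 1) * ((n + 1) * ((n + 1) * (H + 1))))) ^ k * (2000 * ((m + 1) * (n + 1)))

theorem solveSpec {Γ : Env} {H q : ℕ} (hm : 1 ≤ Γ.I.m) (hp : Γ.procs[0]? = some solveProc) (k : ℕ) :
    SolveSpec Γ H q k (solveTime Γ.I.n Γ.I.m H k) := by
  have hsz : (Test.leN kE (.const 0)).size ≤ 100 := by decide +kernel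
  induction k with
  | zero =>
    intro σ hk hH hq
    obtain ⟨σ', r, f, v, i⟩ := run_leaf (σ := σ) hm hk
    refine ⟨σ', (Run.call hp (Run.ite_pos (by simp [kE, hk]) r)).mono ?_, f, v, fun z _ => i _⟩
    have : 1 ≤ (Γ.I.m + 1) * (Γ.I.n + 1) := Nat.mul_pos (by omega) (by omega)
    simp only [solveTime, pow_zero, one_mul]
    omega
  | succ k ih =>
    intro σ hk hH hq
    obtain ⟨σ', r, f, v, i⟩ := run_node ih (u := solveTime Γ.I.n Γ.I.m H k +
      1000 * ((Γ.I.m + 1) * (Γ.I.n + 1))) (by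
        have : Γ.I.n + 1 ≤ (Γ.I.m + 1) * (Γ.I.n + 1) := Nat.le_mul_of_pos_left _ (by omega)
        omega) hk hH hq
    refine ⟨σ', (Run.call hp (Run.ite_neg (by simp [kE, hk]) r)).mono ?_, f, v, i⟩
    simp only [solveTime]
    set W := (Γ.I.m + 1) * ((Γ.I.n + 1) * ((Γ.I.n + 1) * (H + 1))) with hW
    set a := (Γ.I.m + 1) * (Γ.I.n + 1) with ha
    set X := (40 * W) ^ k with hX
    have hW1 : 1 ≤ W := Nat.mul_pos (by omega) (Nat.mul_pos (by omega)
      (Nat.mul_pos (by omega) (by omega)))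
    have ha1 : 1 ≤ a := Nat.mul_pos (by omega) (by omega)
    have hX1 : 1 ≤ X := Nat.one_le_pow _ _ (by omega)
    have e1 : (Γ.I.m + 1) * ((Γ.I.n + 1) * ((Γ.I.n + 1) * ((H + 1) *
        (18 * (X * (2000 * a) + 1000 * a))))) = 36000 * (W * (X * a)) + 18000 * (W * a) := by
      rw [hW]
      ring
    have e2 : (40 * W) ^ (k + 1) * (2000 * a) = 80000 * (W * (X * a)) := by
      rw [pow_succ, ← hX]
      ring
    have e3 : W * a ≤ W * (X * a) := Nat.mul_le_mul_left _ (Nat.le_mul_of_pos_left _ hX1)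
    have e4 : 1 ≤ W * a := Nat.mul_pos hW1 ha1
    rw [e1, e2]
    omega

/-! ### The main program and its output -/

/-- The output of the solution stored in the frame of recursion depth `k`. The radii are first
computed in a separate array, since the output overwrites the input. -/
def outCode : Stmt :=
  .seq (fillL (putR 5 zE (sdE (A 2 own) (A 3 own))))
    (.seq (fillL (.setR zE (R 5 zE))) (fillL (.setN (.add zE (.const 1)) (A 2 own))))

/-- The recursive procedure is called for the set of all clients, with the parameters computed
by `pre`. -/
def mainCode (pre : Stmt) : Stmt :=
  .seq pre (.seq (fillL (putA 0 own (.const 1))) (.seq (.call 0) outCode))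

section Output

variable {Γ : Env}

theorem exec_congr {p : Stmt} {s s₁ s₂ : State} {t : ℕ} (h : Exec Γ.α Γ.ω Γ.procs p s t s₁)
    (e : s₂ = s₁) : Exec Γ.α Γ.ω Γ.procs p s t s₂ := e ▸ h

/-- A loop that runs through a given sequence of states. The output overwrites the input, so these
states are not of the form `conc Γ σ`. -/
theorem exec_while {b : Test} {p : Stmt} {st : ℕ → State} {N T : ℕ}
    (hb : ∀ z ≤ N, (b.Holds Γ.α (st z) ↔ z < N))
    (hp : ∀ z < N, ∃ t ≤ T, Exec Γ.α Γ.ω Γ.procs p (st z) t (st (z + 1))) {z : ℕ} (hz : z ≤ N) :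
    ∃ t ≤ (N - z) * (b.size + T + 1) + (b.size + 1),
      Exec Γ.α Γ.ω Γ.procs (.while b p) (st z) t (st N) := by
  induction hd : N - z generalizing z with
  | zero =>
    obtain rfl : z = N := by omega
    refine ⟨b.size + 1, by omega, Exec.while_false ?_⟩
    rw [hb z le_rfl]
    omega
  | succ d ih =>
    obtain ⟨t, ht, h1⟩ := hp z (by omega)
    obtain ⟨u, hu, h3⟩ := ih (z := z + 1) (by omega) (by omega)
    refine ⟨_, ?_, Exec.while_true ((hb z hz).2 (by omega)) h1 h3⟩
    rw [Nat.succ_mul]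
    omega

/-- The radii are stored in real array `5`, which the output does not overwrite. -/
theorem run_radii {σ : Mem} {k : ℕ} {r : ℝ × (ℕ → ℕ × ℕ)} (hk : σ.a 20 0 = k)
    (hr : Res Γ.I.n σ k r) (hr' : ∀ z < Γ.I.n, (r.2 z).1 < Γ.I.m ∧ (r.2 z).2 < Γ.I.n) :
    ∃ σ', Run Γ (fillL (putR 5 zE (sdE (A 2 own) (A 3 own)))) σ ((Γ.I.n + 1) * 500) σ' ∧
      σ'.a 20 0 = k ∧ (∀ z < Γ.I.n, σ'.a 2 (k * Γ.I.n + z) = (r.2 z).1) ∧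
      ∀ z < Γ.I.n, σ'.r 5 z = sd Γ.I (r.2 z).1 (r.2 z).2 := by
  set st : ℕ → Mem := fun z => ⟨(σ.setA 11 0 z).a, fun p j =>
    if p = 5 ∧ j < z then sd Γ.I (r.2 j).1 (r.2 j).2 else σ.r p j⟩ with hst
  obtain ⟨σ', h1, h2⟩ := for_rule (Γ := Γ) (σ := σ) (T := 300) (U := 500) (q := 11) (i := .const 0)
    (bound := nN) (body := putR 5 zE (sdE (A 2 own) (A 3 own))) (Inv := fun z σ' => σ' = st z)
    (N := Γ.I.n) (j := 0) (by norm_num) (by decide +kernel) (by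
      ext q j
      · simp [hst]
      · simp [hst]) (by
      rintro z _ rfl
      simp [hst]) (by
      rintro z hz _ rfl
      have h := Run.putR (Γ := Γ) (σ := st z) (q := 5) (i := zE) (e := sdE (A 2 own) (A 3 own))
        (by norm_num)
      have e2 : (A 2 own).eval (conc Γ (st z)) = (r.2 z).1 := by
        simp [own, kE, zE, hst, hk, (hr.2 z hz).1]
      have e3 : (A 3 own).eval (conc Γ (st z)) = (r.2 z).2 := by
        simp [own, kE, zE, hst, hk, (hr.2 z hz).2]
      rw [eval_sdE (by rw [e2]; exact (hr' z hz).1) (by rw [e3]; exact (hr' z hz).2), e2, e3,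
        show zE.eval (conc Γ (st z)) = z by simp [zE, hst]] at h
      refine ⟨_, h.mono (by decide +kernel), by simp, by simp [hst], ?_⟩
      ext q j
      · simp only [hst, Mem.setA_a, Mem.setR_a]
        grind
      · simp only [hst, Mem.setA_r, Mem.setR_r]
        grind)
  subst h2
  refine ⟨_, h1, by simp [hst, hk], fun z hz => by simp [hst, (hr.2 z hz).1], fun z hz => by
    simp [hst, hz]⟩

/-- `outCode` writes the balls of a stored solution to the output cells. -/
theorem run_out {σ : Mem} {k : ℕ} {r : ℝ × (ℕ → ℕ × ℕ)} (hk : σ.a 20 0 = k)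
    (hr : Res Γ.I.n σ k r) (hr' : ∀ z < Γ.I.n, (r.2 z).1 < Γ.I.m ∧ (r.2 z).2 < Γ.I.n) :
    ∃ t ≤ (Γ.I.n + 1) * 1500, ∃ s, Exec Γ.α Γ.ω Γ.procs outCode (conc Γ σ) t s ∧
      s.nat 0 = Γ.I.n ∧ ∀ j < Γ.I.n, s.nat (j + 1) = (r.2 j).1 ∧
        s.real j = sd Γ.I (r.2 j).1 (r.2 j).2 := by
  obtain ⟨σ₁, ⟨t₁, ht₁, h₁⟩, k1, b1, w1⟩ := run_radii hk hr hr'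
  set n := Γ.I.n with hn
  -- `sA z` is the state after `z` radii, and `sB z` the state after all radii and `z` servers have
  -- been written. The servers come last, since writing them destroys cell `1`, which enters the
  -- addresses of the real arrays. Cell `0` already holds the number `n` of balls in the output.
  set rl : ℕ → ℕ → ℝ := fun z c => if c < z then σ₁.r 5 c else (conc Γ σ₁).real c with hrl
  set sA : ℕ → State := fun z => ⟨(conc Γ (σ₁.setA 11 0 z)).nat, rl z, 0⟩ with hsA
  set nt : ℕ → ℕ → ℕ := fun z c => if 1 ≤ c ∧ c ≤ z then σ₁.a 2 (k * n + (c - 1)) else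
    (conc Γ (σ₁.setA 11 0 z)).nat c with hnt
  set sB : ℕ → State := fun z => ⟨nt z, rl n, 0⟩ with hsB
  have hP : n ≤ (n + Γ.I.m) * (n + Γ.I.m) := by nlinarith
  have e0 : ∀ σ : Mem, ∀ z, (σ.setA 11 0 z).setA 11 0 (z + 1) = σ.setA 11 0 (z + 1) := fun σ z => by
    ext q j
    · simp only [Mem.setA_a]
      grind
    · rfl
  have hupd : ∀ (σ : Mem) v, Function.update (conc Γ σ).nat (n + 13 + 32 * 0) v =
      (conc Γ (σ.setA 11 0 v)).nat := fun σ v =>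
    congrArg State.nat (conc_setA (Γ := Γ) (σ := σ) 11 0 v (by norm_num))
  have zA : ∀ z, zE.eval (sA z) = z := fun z =>
    (show zE.eval (sA z) = zE.eval (conc Γ (σ₁.setA 11 0 z)) from rfl).trans (by simp [zE])
  have nat0 : ∀ (z : ℕ), nt z 0 = n := fun z => by simp [hnt, conc, hn]
  have hcell : ∀ q < 32, ∀ z ≤ n, ∀ i, nt z (n + (q + 2) + 32 * i) = (σ₁.setA 11 0 z).a q i :=
    fun q hq z hz i => by
      simp only [hnt]
      rw [if_neg (by omega)]
      exact conc_nat_addr q i hq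
  have hA : ∀ q < 32, ∀ z ≤ n, ∀ e : NExpr, (A q e).eval (sB z) =
      (σ₁.setA 11 0 z).a q (e.eval (sB z)) := fun q hq z hz e => by
    change nt z (nt z 0 + (q + 2) + 32 * e.eval (sB z)) = _
    rw [nat0, hcell q hq z hz]
  have zB : ∀ z ≤ n, zE.eval (sB z) = z := fun z hz => by
    rw [zE, hA 11 (by norm_num) z hz]
    simp [NExpr.eval]
  -- the radii are moved to the output cells
  obtain ⟨t₂, ht₂, h₂⟩ := exec_while (Γ := Γ) (b := ltN zE nN)
    (p := .seq (.setR zE (R 5 zE)) (putA 11 (.const 0) (.add zE (.const 1)))) (st := sA) (N := n)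
    (T := 200) (fun z hz => by
      change zE.eval (sA z) + 1 ≤ n ↔ z < n
      rw [zA]
      omega) (fun z hz => by
      have a1 := Exec.setR (α := Γ.α) (ω := Γ.ω) (procs := Γ.procs) zE (R 5 zE) (sA z)
      have eR : (R 5 zE).eval Γ.α (sA z) = σ₁.r 5 z := by
        change rl z ((n + Γ.I.m) * (n + Γ.I.m) + (5 + 2) + 8 * zE.eval (sA z)) = _
        rw [zA]
        simp only [hrl]
        rw [if_neg (by omega)]
        exact conc_real_addr 5 z (by norm_num)
      rw [eR, zA] at a1
      have a2 := Exec.setN (α := Γ.α) (ω := Γ.ω) (procs := Γ.procs) (addrA 11 (.const 0))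
        (.add zE (.const 1)) { sA z with real := Function.update (sA z).real z (σ₁.r 5 z) }
      refine ⟨_, ?_, exec_congr (a1.seq a2) ?_⟩
      · decide +kernel
      · change _ = State.mk (Function.update (conc Γ (σ₁.setA 11 0 z)).nat (n + 13 + 32 * 0)
          (zE.eval (sA z) + 1)) (Function.update (rl z) z (σ₁.r 5 z)) 0
        rw [zA, hupd, e0]
        simp only [hsA, State.mk.injEq, true_and, and_true]
        funext c
        rcases eq_or_ne c z with rfl | hc
        · rw [Function.update_self]
          simp [hrl]
        · rw [Function.update_of_ne hc]
          simp only [hrl]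
          grind) (z := 0) (Nat.zero_le _)
  -- the servers are moved to the output cells
  obtain ⟨t₃, ht₃, h₃⟩ := exec_while (Γ := Γ) (b := ltN zE nN)
    (p := .seq (.setN (.add zE (.const 1)) (A 2 own)) (putA 11 (.const 0) (.add zE (.const 1))))
    (st := sB) (N := n) (T := 200) (fun z hz => by
      change zE.eval (sB z) + 1 ≤ nt z 0 ↔ z < n
      rw [zB z hz, nat0]
      omega) (fun z hz => by
      have a1 := Exec.setN (α := Γ.α) (ω := Γ.ω) (procs := Γ.procs) (.add zE (.const 1)) (A 2 own)
        (sB z)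
      have eO : own.eval (sB z) = k * n + z := by
        change kE.eval (sB z) * nt z 0 + zE.eval (sB z) = _
        rw [zB z hz.le, nat0, kE, hA 20 (by norm_num) z hz.le]
        simp [NExpr.eval, k1]
      rw [hA 2 (by norm_num) z hz.le, eO, show (NExpr.add zE (.const 1)).eval (sB z) = z + 1 from
        congrArg (· + 1) (zB z hz.le), Mem.setA_a, if_neg (by omega)] at a1
      set nt' := Function.update (nt z) (z + 1) (σ₁.a 2 (k * n + z)) with hnt'
      have a2 := Exec.setN (α := Γ.α) (ω := Γ.ω) (procs := Γ.procs) (addrA 11 (.const 0))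
        (.add zE (.const 1)) ⟨nt', rl n, 0⟩
      have hz0 : nt' 0 = n := by rw [hnt', Function.update_of_ne (by omega), nat0]
      have hz1 : nt' (n + 13 + 32 * 0) = z := by
        rw [hnt', Function.update_of_ne (by omega)]
        exact (hcell 11 (by norm_num) z hz.le 0).trans (by simp)
      refine ⟨_, ?_, exec_congr (a1.seq a2) ?_⟩
      · decide +kernel
      · change _ = State.mk (Function.update nt' (nt' 0 + 13 + 32 * 0)
          (nt' (nt' 0 + 13 + 32 * 0) + 1)) (rl n) 0
        rw [hz0, hz1]
        simp only [hsB, State.mk.injEq, and_true]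
        funext c
        rcases eq_or_ne c (n + 13 + 32 * 0) with rfl | hc
        · rw [Function.update_self]
          exact (hcell 11 (by norm_num) (z + 1) (by omega) 0).trans (by simp)
        · rw [Function.update_of_ne hc, hnt']
          rcases eq_or_ne c (z + 1) with rfl | hc'
          · rw [Function.update_self]
            simp [hnt]
          · rw [Function.update_of_ne hc']
            simp only [hnt]
            by_cases hcz : 1 ≤ c ∧ c ≤ z
            · rw [if_pos hcz, if_pos (by omega)]
            · rw [if_neg hcz, if_neg (by omega), ← e0, ← hupd, Function.update_of_ne hc])
    (z := 0) (Nat.zero_le _)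
  have i₂ : Exec Γ.α Γ.ω Γ.procs (putA 11 (.const 0) (.const 0)) (conc Γ σ₁)
      (flat (putA 11 (.const 0) (.const 0))) (sA 0) := by
    refine exec_congr (Exec.setN _ _ _) ?_
    change _ = State.mk (Function.update (conc Γ σ₁).nat (n + 13 + 32 * 0) 0) (conc Γ σ₁).real 0
    rw [hupd]
    simp [hsA, hrl]
  have i₃ : Exec Γ.α Γ.ω Γ.procs (putA 11 (.const 0) (.const 0)) (sA n)
      (flat (putA 11 (.const 0) (.const 0))) (sB 0) := by
    refine exec_congr (Exec.setN _ _ _) ?_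
    change _ = State.mk (Function.update (conc Γ (σ₁.setA 11 0 n)).nat (n + 13 + 32 * 0) 0) (rl n) 0
    rw [hupd]
    simp only [hsB, State.mk.injEq, and_true]
    funext c
    simp only [hnt]
    rw [if_neg (by omega)]
    congr 2
    ext q j
    · simp only [Mem.setA_a]
      grind
    · rfl
  refine ⟨_, ?_, sB n, h₁.seq ((i₂.seq h₂).seq (i₃.seq h₃)), nat0 n, fun j hj => ⟨?_, ?_⟩⟩
  · have c1 : flat (putA 11 (.const 0) (.const 0)) ≤ 20 := by decide +kernel
    have c2 : (ltN zE nN).size ≤ 30 := by decide +kernel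
    have c3 : (n - 0) * ((ltN zE nN).size + 200 + 1) ≤ n * 240 :=
      Nat.mul_le_mul (by omega) (by omega)
    omega
  · simp only [hsB, hnt]
    rw [if_pos (by omega), Nat.add_sub_cancel, b1 j hj]
  · simp only [hsB, hrl]
    rw [if_pos hj, w1 j hj]

/-- The main program outputs the balls computed by `solve`, with the parameters computed by `pre`.
-/
theorem exec_main {H q N T : ℕ} {pre : Stmt} {σ₀ σ₁ : Mem} (hm : 1 ≤ Γ.I.m)
    (hp : Γ.procs[0]? = some solveProc) (hpre : Run Γ pre σ₀ T σ₁) (hN : σ₁.a 20 0 = N)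
    (hH : σ₁.a 21 0 = H) (hq : σ₁.a 22 0 = q) :
    ∃ t ≤ T + solveTime Γ.I.n Γ.I.m H N + (Γ.I.n + 1) * 2000, ∃ s,
      Exec Γ.α Γ.ω Γ.procs (mainCode pre) (conc Γ σ₀) t s ∧
      MCCInstance.IsOutput s (ballsOf Γ.I (solve Γ.I Γ.α H q N (Finset.range Γ.I.n)).2) := by
  have r1 : Run Γ (fillL (putA 0 own (.const 1))) σ₁ ((Γ.I.n + 1) * 200)
      (fs σ₁ [0] (N * Γ.I.n) (fun _ _ => 1) Γ.I.n) := by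
    refine fill_rule (T := 100) [0] (N * Γ.I.n) _ (by decide +kernel) fun z hz => ?_
    exact (put_run₁ (by norm_num) (by norm_num) (by simp [own, kE, zE, hN])
      (by simp)).mono (by decide +kernel)
  set σ₂ := fs σ₁ [0] (N * Γ.I.n) (fun _ _ => 1) Γ.I.n with hσ₂
  obtain ⟨σ₃, r2, f, v, -⟩ := solveSpec (H := H) (q := q) hm hp N σ₂ (by simp [hσ₂, hN])
    (by simp [hσ₂, hH]) (by simp [hσ₂, hq])
  rw [slice_eq subset_rfl (fun z hz => by simp [hσ₂, hz])] at v
  have hv := solve_valid (α := Γ.α) (H := H) (q := q) hm N (subset_refl (Finset.range Γ.I.n))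
  obtain ⟨t₃, ht₃, s, r3, s0, s1⟩ := run_out (k := N)
    (by rw [f.glob 20 (by norm_num)]; simp [hσ₂, hN]) v fun z hz =>
      ⟨(hv.1 z (Finset.mem_range.2 hz)).1, (hv.1 z (Finset.mem_range.2 hz)).2.1⟩
  obtain ⟨t₀, ht₀, e0⟩ := hpre
  obtain ⟨t₁, ht₁, e1⟩ := r1
  obtain ⟨t₂, ht₂, e2⟩ := r2
  refine ⟨_, ?_, s, e0.seq (e1.seq (e2.seq r3)), ?_⟩
  · omega
  · unfold MCCInstance.IsOutput
    rw [(ballsOf_spec hv).2.2]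
    ext p
    simp only [Set.mem_ofPred_eq, s0]
    constructor
    · rintro ⟨j, hj, rfl⟩
      exact ⟨j, hj, by rw [(s1 j hj).1, (s1 j hj).2]⟩
    · rintro ⟨j, hj, rfl⟩
      exact ⟨j, hj, by rw [(s1 j hj).1, (s1 j hj).2]⟩

end Output

/-! ### Computation of the parameters -/

/-- Cell `0` of array `q`. -/
def glob (q : ℕ) : NExpr := A q (.const 0)

/-- The smallest number that satisfies the test `b` is stored in cell `0` of array `q`. -/
def countCode (q : ℕ) (b : Test) : Stmt :=
  .seq (putA q (.const 0) (.const 0))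
    (.while (.not b) (putA q (.const 0) (.add (glob q) (.const 1))))

/-- The smallest number that satisfies the test `b` is stored in cell `0` of array `q`, and its
power of two in cell `0` of array `26`. -/
def doubleCode (q : ℕ) (b : Test) : Stmt :=
  .seq (.seq (putA 26 (.const 0) (.const 1)) (putA q (.const 0) (.const 0)))
    (.while (.not b) (.seq (putA 26 (.const 0) (.add (glob 26) (glob 26)))
      (putA q (.const 0) (.add (glob q) (.const 1)))))

/-- The loop body of `rangeCode`. -/
def rangeBody : Stmt :=
  .ite (ltN (glob 12) (glob 13))
    (.seq
      (.ite (.leR (R 4 (.const 0)) (entryE (glob 12) (glob 13)))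
        (putR 4 (.const 0) (entryE (glob 12) (glob 13))) .skip)
      (.ite (.leR (entryE (glob 12) (glob 13)) (R 5 (.const 0)))
        (putR 5 (.const 0) (entryE (glob 12) (glob 13))) .skip))
    .skip

/-- The computation of the maximum and the minimum distance between two distinct clients. -/
def rangeCode : Stmt :=
  .seq (.seq (putR 4 (.const 0) (entryE (.const 0) (.const 1)))
      (putR 5 (.const 0) (entryE (.const 0) (.const 1))))
    (forL 12 (.const 0) nN (forL 13 (.const 0) nN rangeBody))

/-- The input parameter `α`. -/
def alphaE : RExpr := .mem (.const 0)
/-- The input parameter `ε`. -/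
def epsE : RExpr := .mem (.const 1)

/-- The smallest `ℓ` with `n ≤ 2 ^ ℓ`. -/
def logCode : Stmt := doubleCode 23 (.leN nN (glob 26))
/-- The smallest `e` with `1 / e ≤ ε`. -/
def precCode : Stmt := countCode 24 (.leR (.cast (.const 1)) (.mul (.cast (glob 24)) epsE))
/-- The smallest `Λ` such that the maximum distance is less than `2 ^ Λ` times the minimum distance.
-/
def ratioCode : Stmt :=
  doubleCode 25 (ltR (R 4 (.const 0)) (.mul (.cast (glob 26)) (R 5 (.const 0))))
/-- The smallest `K` with `(16 * H) ^ α ≤ K`. -/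
def powCode : Stmt :=
  countCode 27 (.leR (.pow (.cast (.mul (.const 16) (glob 21)))) (.cast (glob 27)))

/-- The computation of the remaining parameters. -/
def paramCode : Stmt :=
  .seq (.seq (putA 22 (.const 0) (.mul (.mul (.const 16) (glob 25)) (glob 24)))
      (putA 21 (.const 0) (.mul (glob 22) (.add (glob 23) (.const 1)))))
    (.seq powCode
      (putA 20 (.const 0) (.add (.mul (glob 25) (.add (glob 27) (.const 1))) (.const 1))))

/-- The parameters for an algorithm whose recursion depth depends on the ratio of the distances. -/
def ratioPre : Stmt := .seq rangeCode (.seq ratioCode (.seq logCode (.seq precCode paramCode)))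

/-- The parameters for an algorithm whose recursion depth does not depend on the distances. -/
def levelPre : Stmt :=
  .ite (.leN nN (.const 1)) .skip
    (.seq precCode (.seq (countCode 28 (.leR alphaE (.cast (glob 28)))) (.seq logCode (.seq
      (putA 25 (.const 0) (.mul (.const 2) (.add (.add (.add (.const 14) (glob 28))
        (.mul (.const 2) (glob 23))) (.mul (.const 3) (glob 24)))))
      paramCode))))

section Search

variable {Γ : Env} {σ : Mem}

@[simp] theorem eval_glob {q : ℕ} (hq : q < 32) : (glob q).eval (conc Γ σ) = σ.a q 0 := by
  simp [glob, hq]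

theorem setA_setA (q i v w : ℕ) : (σ.setA q i v).setA q i w = σ.setA q i w := by
  ext q' j
  · simp only [Mem.setA_a]
    grind
  · rfl

/-- `countCode` finds the smallest number with a property that is expressed by the test. -/
theorem run_count {q T : ℕ} {b : Test} {P : ℕ → Prop} (hq : q < 32) (hP : ∃ z, P z)
    (hb : ∀ z, b.Holds Γ.α (conc Γ (σ.setA q 0 z)) ↔ P z)
    (hT : flat (countCode q b) + b.size + (Test.not b).size +
      flat (putA q (.const 0) (.add (glob q) (.const 1))) + 2 ≤ T) :
    ∃ z, P z ∧ (∀ w < z, ¬ P w) ∧ Run Γ (countCode q b) σ ((z + 1) * T) (σ.setA q 0 z) := by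
  classical
  obtain ⟨σ', r, e⟩ := while_rule (Γ := Γ) (b := .not b)
    (p := putA q (.const 0) (.add (glob q) (.const 1))) (N := Nat.find hP)
    (Inv := fun z σ' => σ' = σ.setA q 0 z)
    (T := flat (putA q (.const 0) (.add (glob q) (.const 1)))) (by
      rintro z hz _ rfl
      rw [holds_not, hb]
      exact ⟨fun h => lt_of_le_of_ne hz fun e => h (e ▸ Nat.find_spec hP), Nat.find_min hP⟩) (by
      rintro z hz _ rfl
      refine ⟨_, Run.putA hq, ?_⟩
      simp [hq, setA_setA]) (Nat.zero_le _) rfl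
  rw [e] at r
  refine ⟨_, Nat.find_spec hP, fun w hw => Nat.find_min hP hw,
    ((Run.putA (q := q) (i := .const 0) (e := .const 0) hq).seq r).mono ?_⟩
  refine le_trans ?_ (Nat.mul_le_mul_left _ hT)
  simp only [countCode, flat, Nat.sub_zero]
  set a := flat (putA q (.const 0) (.add (glob q) (.const 1)))
  ring_nf
  omega

/-- `doubleCode` finds the smallest number with a property that is expressed by the test, which may
refer to its power of two. -/
theorem run_double {q T : ℕ} {b : Test} {P : ℕ → Prop} (hq : q < 26) (hP : ∃ z, P z)
    (hb : ∀ z, b.Holds Γ.α (conc Γ ((σ.setA 26 0 (2 ^ z)).setA q 0 z)) ↔ P z)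
    (hT : flat (doubleCode q b) + b.size + (Test.not b).size +
      flat (.seq (putA 26 (.const 0) (.add (glob 26) (glob 26)))
      (putA q (.const 0) (.add (glob q) (.const 1)))) + 2 ≤ T) :
    ∃ z, P z ∧ (∀ w < z, ¬ P w) ∧
      Run Γ (doubleCode q b) σ ((z + 1) * T) ((σ.setA 26 0 (2 ^ z)).setA q 0 z) := by
  classical
  obtain ⟨σ', r, e⟩ := while_rule (Γ := Γ) (b := .not b)
    (p := .seq (putA 26 (.const 0) (.add (glob 26) (glob 26)))
      (putA q (.const 0) (.add (glob q) (.const 1)))) (N := Nat.find hP)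
    (Inv := fun z σ' => σ' = (σ.setA 26 0 (2 ^ z)).setA q 0 z)
    (T := flat (.seq (putA 26 (.const 0) (.add (glob 26) (glob 26)))
      (putA q (.const 0) (.add (glob q) (.const 1))))) (by
      rintro z hz _ rfl
      rw [holds_not, hb]
      exact ⟨fun h => lt_of_le_of_ne hz fun e => h (e ▸ Nat.find_spec hP), Nat.find_min hP⟩) (by
      rintro z hz _ rfl
      refine ⟨_, (Run.putA (by norm_num)).seq (Run.putA (by omega)), ?_⟩
      have h32 : q < 32 := by omega
      ext q' j
      · simp [h32, hq.ne, hq.ne', pow_succ, mul_two]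
        grind
      · rfl) (Nat.zero_le _) rfl
  rw [e] at r
  refine ⟨_, Nat.find_spec hP, fun w hw => Nat.find_min hP hw,
    (((Run.putA (q := 26) (i := .const 0) (e := .const 1) (by norm_num)).seq
      (Run.putA (q := q) (i := .const 0) (e := .const 0) (by omega))).seq r).mono ?_⟩
  refine le_trans ?_ (Nat.mul_le_mul_left _ hT)
  simp only [doubleCode, flat, Nat.sub_zero]
  set a := flat (putA q (.const 0) (.add (glob q) (.const 1)))
  set a' := flat (putA 26 (.const 0) (.add (glob 26) (glob 26)))
  ring_nf
  omega

theorem eval_alphaE : alphaE.eval Γ.α (conc Γ σ) = Γ.α := by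
  change (conc Γ σ).real 0 = _
  simp [conc, MCCInstance.input]

theorem eval_epsE : epsE.eval Γ.α (conc Γ σ) = Γ.ε := by
  change (conc Γ σ).real 1 = _
  simp [conc, MCCInstance.input]

theorem run_log (hn : 1 ≤ Γ.I.n) : ∃ ℓ : ℕ, Γ.I.n ≤ 2 ^ ℓ ∧ (ℓ : ℝ) ≤ Real.logb 2 Γ.I.n + 1 ∧
    Run Γ logCode σ ((ℓ + 1) * 300) ((σ.setA 26 0 (2 ^ ℓ)).setA 23 0 ℓ) := by
  obtain ⟨ℓ, h1, h2, h3⟩ := run_double (Γ := Γ) (σ := σ) (q := 23) (T := 300)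
    (b := .leN nN (glob 26)) (P := fun ℓ => Γ.I.n ≤ 2 ^ ℓ) (by norm_num)
    ⟨Γ.I.n, Nat.lt_two_pow_self.le⟩ (fun z => by simp) (by decide +kernel)
  refine ⟨ℓ, h1, ?_, h3⟩
  rcases ℓ with _ | ℓ
  · have := Real.logb_nonneg (b := 2) (by norm_num) (x := Γ.I.n) (by exact_mod_cast hn)
    push_cast
    linarith
  · have h4 := h2 ℓ (by omega)
    push Not at h4
    have h5 : ((2 : ℝ) ^ ℓ) ≤ Γ.I.n := by exact_mod_cast h4.le
    have h6 : (ℓ : ℝ) ≤ Real.logb 2 Γ.I.n := by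
      rw [Real.le_logb_iff_rpow_le (by norm_num) (by exact_mod_cast hn), Real.rpow_natCast]
      exact h5
    push_cast
    linarith

theorem run_prec (hε : 0 < Γ.ε) : ∃ e : ℕ, 1 ≤ (e : ℝ) * Γ.ε ∧ (e : ℝ) ≤ 1 / Γ.ε + 1 ∧
    Run Γ precCode σ ((e + 1) * 300) (σ.setA 24 0 e) := by
  have hP : ∃ e : ℕ, 1 ≤ (e : ℝ) * Γ.ε := by
    obtain ⟨e, he⟩ := exists_nat_ge (1 / Γ.ε)
    exact ⟨e, by rwa [div_le_iff₀ hε] at he⟩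
  obtain ⟨e, h1, h2, h3⟩ := run_count (Γ := Γ) (σ := σ) (q := 24) (T := 300)
    (b := .leR (.cast (.const 1)) (.mul (.cast (glob 24)) epsE))
    (P := fun e => 1 ≤ (e : ℝ) * Γ.ε) (by norm_num) hP (fun z => by simp [eval_epsE])
    (by decide +kernel)
  refine ⟨e, h1, ?_, h3⟩
  rcases e with _ | e
  · simp
    positivity
  · have h4 := h2 e (by omega)
    push Not at h4
    rw [← lt_div_iff₀ hε] at h4
    push_cast
    linarith

theorem run_alpha (hα : 0 ≤ Γ.α) : ∃ a : ℕ, Γ.α ≤ a ∧ (a : ℝ) ≤ Γ.α + 1 ∧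
    Run Γ (countCode 28 (.leR alphaE (.cast (glob 28)))) σ ((a + 1) * 300) (σ.setA 28 0 a) := by
  obtain ⟨a, h1, h2, h3⟩ := run_count (Γ := Γ) (σ := σ) (q := 28) (T := 300)
    (b := .leR alphaE (.cast (glob 28)))
    (P := fun a => Γ.α ≤ (a : ℝ)) (by norm_num) (exists_nat_ge _) (fun z => by simp [eval_alphaE])
    (by decide +kernel)
  refine ⟨a, h1, ?_, h3⟩
  rcases a with _ | a
  · simp
    linarith
  · have h4 := h2 a (by omega)
    push Not at h4
    push_cast
    linarith

theorem run_pow {H : ℕ} (hH : σ.a 21 0 = H) : ∃ K : ℕ, ((16 * H : ℕ) : ℝ) ^ Γ.α ≤ K ∧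
    (K : ℝ) ≤ ((16 * H : ℕ) : ℝ) ^ Γ.α + 1 ∧
    Run Γ powCode σ ((K + 1) * 300) (σ.setA 27 0 K) := by
  have h0 : (0 : ℝ) ≤ ((16 * H : ℕ) : ℝ) ^ Γ.α := by positivity
  obtain ⟨K, h1, h2, h3⟩ := run_count (Γ := Γ) (σ := σ) (q := 27) (T := 300)
    (b := .leR (.pow (.cast (.mul (.const 16) (glob 21)))) (.cast (glob 27)))
    (P := fun K => ((16 * H : ℕ) : ℝ) ^ Γ.α ≤ (K : ℝ)) (by norm_num) (exists_nat_ge _) (fun z => by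
      rw [holds_leR, evalR_pow, evalR_cast, evalR_cast, max_eq_left (Nat.cast_nonneg _)]
      simp [hH]) (by decide +kernel)
  refine ⟨K, h1, ?_, h3⟩
  rcases K with _ | K
  · push_cast at h0 ⊢
    linarith
  · have h4 := h2 K (by omega)
    push Not at h4
    push_cast at h4 ⊢
    linarith

end Search

/-- The relations between the parameters of the algorithm that are common to both variants. -/
structure Params (I : MCCInstance) (α ε : ℝ) (Λ e ℓ H q K N : ℕ) : Prop where
  he : 1 ≤ e
  heε : 1 ≤ (e : ℝ) * ε
  he' : (e : ℝ) ≤ 1 / ε + 1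
  hℓ : I.n ≤ 2 ^ ℓ
  hℓ' : (ℓ : ℝ) ≤ Real.logb 2 I.n + 1
  hΛ : 1 ≤ Λ
  hq : q = 16 * Λ * e
  hH : H = q * (ℓ + 1)
  hK : ((16 * H : ℕ) : ℝ) ^ α ≤ K
  hK' : (K : ℝ) ≤ ((16 * H : ℕ) : ℝ) ^ α + 1
  hN : N = Λ * (K + 1) + 1

section Preparation

variable {Γ : Env} {σ : Mem}

/-- The parameters that determine the algorithm, computed from `Λ`, `e` and `ℓ`. -/
theorem run_param {Λ e ℓ : ℕ} (hα : 1 ≤ Γ.α) (he : 1 ≤ e) (heε : 1 ≤ (e : ℝ) * Γ.ε)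
    (he' : (e : ℝ) ≤ 1 / Γ.ε + 1) (hℓ : Γ.I.n ≤ 2 ^ ℓ) (hℓ' : (ℓ : ℝ) ≤ Real.logb 2 Γ.I.n + 1)
    (hΛ : 1 ≤ Λ) (h1 : σ.a 25 0 = Λ) (h2 : σ.a 24 0 = e) (h3 : σ.a 23 0 = ℓ) :
    ∃ H q K N, Params Γ.I Γ.α Γ.ε Λ e ℓ H q K N ∧ Λ + e + ℓ ≤ 3 * N ∧ ∃ σ',
      Run Γ paramCode σ ((N + 1) * 600) σ' ∧ σ'.a 20 0 = N ∧ σ'.a 21 0 = H ∧ σ'.a 22 0 = q := by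
  set q := 16 * Λ * e with hq
  set H := q * (ℓ + 1) with hH
  have r1 := Run.putA (Γ := Γ) (σ := σ) (q := 22) (i := .const 0)
    (e := .mul (.mul (.const 16) (glob 25)) (glob 24)) (by norm_num)
  rw [eval_const, show (NExpr.mul (.mul (.const 16) (glob 25)) (glob 24)).eval (conc Γ σ) = q by
    simp [h1, h2, hq]] at r1
  have r2 := Run.putA (Γ := Γ) (σ := σ.setA 22 0 q) (q := 21) (i := .const 0)
    (e := .mul (glob 22) (.add (glob 23) (.const 1))) (by norm_num)
  rw [eval_const, show (NExpr.mul (glob 22) (.add (glob 23) (.const 1))).eval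
    (conc Γ (σ.setA 22 0 q)) = H by simp [h3, hH]] at r2
  obtain ⟨K, hK, hK', r3⟩ := run_pow (Γ := Γ) (σ := (σ.setA 22 0 q).setA 21 0 H) (H := H) (by simp)
  set N := Λ * (K + 1) + 1 with hN
  have r4 := Run.putA (Γ := Γ) (σ := ((σ.setA 22 0 q).setA 21 0 H).setA 27 0 K) (q := 20)
    (i := .const 0) (e := .add (.mul (glob 25) (.add (glob 27) (.const 1))) (.const 1))
    (by norm_num)
  rw [eval_const, show (NExpr.add (.mul (glob 25) (.add (glob 27) (.const 1))) (.const 1)).eval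
    (conc Γ (((σ.setA 22 0 q).setA 21 0 H).setA 27 0 K)) = N by simp [h1, hN]] at r4
  have hq1 : Λ * e ≤ q := by rw [hq, mul_assoc]; omega
  have hΛe : e ≤ Λ * e := Nat.le_mul_of_pos_left _ hΛ
  have hHq : q * (ℓ + 1) = q * ℓ + q := by ring
  have hqℓ : ℓ ≤ q * ℓ := Nat.le_mul_of_pos_left _ (by omega)
  have hHK : H ≤ K := by
    have h5 : (1 : ℝ) ≤ ((16 * H : ℕ) : ℝ) := by
      have : 1 ≤ 16 * H := by omega
      exact_mod_cast this
    have h6 : ((16 * H : ℕ) : ℝ) ≤ K := le_trans (by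
      simpa using Real.rpow_le_rpow_of_exponent_le h5 hα) hK
    have h7 : 16 * H ≤ K := by exact_mod_cast h6
    omega
  have hKN : K + 1 ≤ Λ * (K + 1) := Nat.le_mul_of_pos_left _ hΛ
  have hΛN : Λ ≤ Λ * (K + 1) := Nat.le_mul_of_pos_right _ (by omega)
  refine ⟨H, q, K, N, ⟨he, heε, he', hℓ, hℓ', hΛ, hq, hH, hK, hK', hN⟩, by omega, _,
    ((r1.seq r2).seq (r3.seq r4)).mono ?_, by simp, by simp, by simp⟩
  have c1 : flat (putA 22 (.const 0) (.mul (.mul (.const 16) (glob 25)) (glob 24))) +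
    flat (putA 21 (.const 0) (.mul (glob 22) (.add (glob 23) (.const 1)))) +
    flat (putA 20 (.const 0) (.add (.mul (glob 25) (.add (glob 27) (.const 1))) (.const 1))) ≤
      300 := by decide +kernel
  omega

theorem run_rangeBody {x x' : ℕ} (hx : x < Γ.I.n) (hx' : x' < Γ.I.n) (h1 : σ.a 12 0 = x)
    (h2 : σ.a 13 0 = x') : ∃ σ', Run Γ rangeBody σ 400 σ' ∧ σ'.a = σ.a ∧
      σ'.r 4 0 = (if x < x' then max (σ.r 4 0) (Γ.I.entry x x') else σ.r 4 0) ∧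
      σ'.r 5 0 = (if x < x' then min (σ.r 5 0) (Γ.I.entry x x') else σ.r 5 0) := by
  have eE : ∀ σ' : Mem, σ'.a = σ.a → (entryE (glob 12) (glob 13)).eval Γ.α (conc Γ σ') =
      Γ.I.entry x x' := fun σ' h => by
    rw [eval_entryE (by simp [h, h1]; omega) (by simp [h, h2]; omega)]
    simp [h, h1, h2]
  by_cases hc : x < x'
  · rw [if_pos hc, if_pos hc]
    obtain ⟨σ₁, r1, a1, v1, w1⟩ : ∃ σ₁, Run Γ (.ite (.leR (R 4 (.const 0))
        (entryE (glob 12) (glob 13))) (putR 4 (.const 0) (entryE (glob 12) (glob 13))) .skip) σ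
        150 σ₁ ∧ σ₁.a = σ.a ∧ σ₁.r 4 0 = max (σ.r 4 0) (Γ.I.entry x x') ∧
        σ₁.r 5 0 = σ.r 5 0 := by
      have eT : (Test.leR (R 4 (.const 0)) (entryE (glob 12) (glob 13))).Holds Γ.α (conc Γ σ) ↔
          σ.r 4 0 ≤ Γ.I.entry x x' := by
        rw [holds_leR, eE σ rfl]
        simp
      by_cases hd : σ.r 4 0 ≤ Γ.I.entry x x'
      · refine ⟨_, (Run.ite_pos (eT.2 hd) (Run.putR (by norm_num))).mono (by decide +kernel), rfl,
          ?_, ?_⟩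
        · simp [eE σ rfl, max_eq_right hd]
        · simp
      · exact ⟨σ, (Run.ite_neg (fun h => hd (eT.1 h)) Run.skip).mono (by decide +kernel), rfl,
          (max_eq_left (le_of_not_ge hd)).symm, rfl⟩
    have eT : (Test.leR (entryE (glob 12) (glob 13)) (R 5 (.const 0))).Holds Γ.α (conc Γ σ₁) ↔
        Γ.I.entry x x' ≤ σ.r 5 0 := by
      rw [holds_leR, eE σ₁ a1]
      simp [w1]
    have eT' : (ltN (glob 12) (glob 13)).Holds Γ.α (conc Γ σ) := by simpa [h1, h2] using hc
    by_cases hd : Γ.I.entry x x' ≤ σ.r 5 0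
    · refine ⟨_, (Run.ite_pos eT' (r1.seq (Run.ite_pos (eT.2 hd)
        (Run.putR (by norm_num))))).mono (by decide +kernel), by simpa using a1, ?_, ?_⟩
      · simp [v1]
      · simp [eE σ₁ a1, min_eq_right hd]
    · exact ⟨σ₁, (Run.ite_pos eT' (r1.seq (Run.ite_neg (fun h => hd (eT.1 h)) Run.skip))).mono
        (by decide +kernel), a1, v1, by rw [w1, min_eq_left (le_of_not_ge hd)]⟩
  · rw [if_neg hc, if_neg hc]
    exact ⟨σ, (Run.ite_neg (by simpa [h1, h2] using hc) Run.skip).mono (by decide +kernel), rfl,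
      rfl, rfl⟩

/-- Cells `0` of the real arrays `4` and `5` contain distances between distinct clients and are an
upper and a lower bound for the distances between the pairs of clients that satisfy `Q`. -/
def RangeInv (I : MCCInstance) (Q : ℕ → ℕ → Prop) (σ : Mem) : Prop :=
  (∃ v w, v < w ∧ w < I.n ∧ σ.r 4 0 = I.entry v w) ∧
    (∃ v w, v < w ∧ w < I.n ∧ σ.r 5 0 = I.entry v w) ∧
    ∀ v w, v < w → w < I.n → Q v w → σ.r 5 0 ≤ I.entry v w ∧ I.entry v w ≤ σ.r 4 0

theorem RangeInv.step {Q Q' : ℕ → ℕ → Prop} {σ σ' : Mem} {x x' : ℕ} (h : RangeInv Γ.I Q σ)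
    (hx' : x' < Γ.I.n)
    (h4 : σ'.r 4 0 = (if x < x' then max (σ.r 4 0) (Γ.I.entry x x') else σ.r 4 0))
    (h5 : σ'.r 5 0 = (if x < x' then min (σ.r 5 0) (Γ.I.entry x x') else σ.r 5 0))
    (hQ : ∀ v w, Q' v w → Q v w ∨ (v = x ∧ w = x')) : RangeInv Γ.I Q' σ' := by
  obtain ⟨g1, g2, g3⟩ := h
  split_ifs at h4 h5 with hc
  · refine ⟨?_, ?_, fun v w hv hw hq => ?_⟩
    · rw [h4]
      rcases max_choice (σ.r 4 0) (Γ.I.entry x x') with e | e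
      · rwa [e]
      · exact ⟨x, x', hc, hx', e⟩
    · rw [h5]
      rcases min_choice (σ.r 5 0) (Γ.I.entry x x') with e | e
      · rwa [e]
      · exact ⟨x, x', hc, hx', e⟩
    · rw [h4, h5]
      rcases hQ v w hq with hq | ⟨rfl, rfl⟩
      · exact ⟨(min_le_left _ _).trans (g3 v w hv hw hq).1,
          (g3 v w hv hw hq).2.trans (le_max_left _ _)⟩
      · exact ⟨min_le_right _ _, le_max_right _ _⟩
  · refine ⟨by rwa [h4], by rwa [h5], fun v w hv hw hq => ?_⟩
    rw [h4, h5]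
    rcases hQ v w hq with hq | ⟨rfl, rfl⟩
    · exact g3 v w hv hw hq
    · exact absurd hv hc

theorem run_range (hn : 2 ≤ Γ.I.n) : ∃ σ',
    Run Γ rangeCode σ ((Γ.I.n + 1) * ((Γ.I.n + 1) * 700) + 200) σ' ∧
      RangeInv Γ.I (fun _ _ => True) σ' := by
  have eE : ∀ σ' : Mem, (entryE (.const 0) (.const 1)).eval Γ.α (conc Γ σ') = Γ.I.entry 0 1 :=
    fun σ' => by
      rw [eval_entryE (by simp; omega) (by simp; omega)]
      simp
  have r1 := Run.putR (Γ := Γ) (σ := σ) (q := 4) (i := .const 0)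
    (e := entryE (.const 0) (.const 1)) (by norm_num)
  rw [eE, eval_const] at r1
  have r2 := Run.putR (Γ := Γ) (σ := σ.setR 4 0 (Γ.I.entry 0 1)) (q := 5) (i := .const 0)
    (e := entryE (.const 0) (.const 1)) (by norm_num)
  rw [eE, eval_const] at r2
  obtain ⟨σ', r3, h3, -⟩ := for_rule (Γ := Γ)
    (σ := (σ.setR 4 0 (Γ.I.entry 0 1)).setR 5 0 (Γ.I.entry 0 1)) (q := 12) (i := .const 0)
    (bound := nN) (body := forL 13 (.const 0) nN rangeBody) (N := Γ.I.n) (j := 0)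
    (T := (Γ.I.n + 1) * 600) (U := (Γ.I.n + 1) * 700)
    (Inv := fun x σ' => RangeInv Γ.I (fun v _ => v < x) σ' ∧ σ'.a 12 0 = x) (by norm_num) (by
      have : forTime 12 (.const 0) nN ≤ 100 := by decide +kernel
      omega) (by
      refine ⟨⟨⟨0, 1, by norm_num, hn, by simp⟩, ⟨0, 1, by norm_num, hn, by simp⟩,
        fun v w _ _ h => absurd h (Nat.not_lt_zero v)⟩, by simp⟩) (by
      rintro x σ' ⟨-, h⟩
      exact ⟨rfl, rfl, h⟩) (by
      rintro x hx σ₁ ⟨g1, c1⟩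
      obtain ⟨σ₂, r, g2, c2, -⟩ := for_rule (Γ := Γ) (σ := σ₁) (q := 13) (i := .const 0)
        (bound := nN) (body := rangeBody) (N := Γ.I.n) (j := 0) (T := 400) (U := 600)
        (Inv := fun x' σ' => RangeInv Γ.I (fun v w => v < x ∨ (v = x ∧ w < x')) σ' ∧
          σ'.a 12 0 = x ∧ σ'.a 13 0 = x') (by norm_num) (by decide +kernel) (by
          refine ⟨⟨g1.1, g1.2.1, fun v w hv hw h => g1.2.2 v w hv hw ?_⟩, by simp [c1], by simp⟩
          omega) (by
          rintro x' σ' ⟨-, -, h⟩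
          exact ⟨rfl, rfl, h⟩) (by
          rintro x' hx' σ₃ ⟨g3, c3, d3⟩
          obtain ⟨σ₄, r4, a4, v4, w4⟩ := run_rangeBody hx hx' c3 d3
          refine ⟨σ₄, r4, rfl, by rw [a4, d3], ?_, by simp [a4, c3], by simp⟩
          exact RangeInv.step (σ' := σ₄.setA 13 0 (x' + 1)) g3 hx' v4 w4 fun v w h => by omega)
      refine ⟨σ₂, r, rfl, c2, ⟨g2.1, g2.2.1, fun v w hv hw h => g2.2.2 v w hv hw ?_⟩, by simp⟩
      omega)
  refine ⟨σ', ((r1.seq r2).seq r3).mono ?_, h3.1, h3.2.1, fun v w hv hw _ =>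
    h3.2.2 v w hv hw (by omega)⟩
  have : flat (putR 4 (.const 0) (entryE (.const 0) (.const 1))) +
    flat (putR 5 (.const 0) (entryE (.const 0) (.const 1))) ≤ 200 := by decide +kernel
  omega

/-- A power of two below a quotient of distances is controlled by the parameter `L`. -/
theorem le_L {I : MCCInstance} {v w v' w' Λ : ℕ} (h1 : v < w) (h2 : w < I.n) (h1' : v' < w')
    (h2' : w' < I.n) (h : 2 ^ Λ * I.entry v' w' ≤ I.entry v w) : (Λ + 1 : ℝ) ≤ I.L := by
  rw [entry_client I (by omega) h2, entry_client I (by omega) h2'] at h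
  have hfin : (Set.range I.client).Finite := Set.finite_range _
  have hne : ∀ {v w : ℕ} (h1 : v < w) (h2 : w < I.n),
      I.client ⟨v, h1.trans h2⟩ ≠ I.client ⟨w, h2⟩ := fun h1 h2 h => by
    have := I.client.injective h
    simp only [Fin.mk.injEq] at this
    omega
  have d1 : dist (I.client ⟨v, h1.trans h2⟩) (I.client ⟨w, h2⟩) ≤
      Metric.diam (Set.range I.client) :=
    Metric.dist_le_diam_of_mem hfin.isBounded ⟨_, rfl⟩ ⟨_, rfl⟩
  have d2 : (Set.range I.client).infsep ≤
      dist (I.client ⟨v', h1'.trans h2'⟩) (I.client ⟨w', h2'⟩) :=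
    Set.infsep_le_dist_of_mem ⟨_, rfl⟩ ⟨_, rfl⟩ (hne h1' h2')
  have d3 : 0 < (Set.range I.client).infsep := by
    rw [hfin.infsep_pos_iff_nontrivial]
    exact ⟨_, ⟨_, rfl⟩, _, ⟨_, rfl⟩, hne h1 h2⟩
  have d4 : (2 : ℝ) ^ Λ ≤ Metric.diam (Set.range I.client) / (Set.range I.client).infsep := by
    rw [le_div_iff₀ d3]
    exact (mul_le_mul_of_nonneg_left d2 (by positivity)).trans (h.trans d1)
  have d5 : (Λ : ℝ) ≤ Real.logb 2 (Metric.diam (Set.range I.client) /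
      (Set.range I.client).infsep) := by
    rw [Real.le_logb_iff_rpow_le (by norm_num) (lt_of_lt_of_le (by positivity) d4),
      Real.rpow_natCast]
    exact d4
  unfold MCCInstance.L
  linarith

theorem run_ratio (h : RangeInv Γ.I (fun _ _ => True) σ) :
    ∃ (Λ : ℕ) (Δ : ℝ), 1 ≤ Λ ∧ (Λ : ℝ) ≤ Γ.I.L ∧
      (∀ x < Γ.I.n, ∀ x' < Γ.I.n, Γ.I.entry x x' ≤ Δ) ∧
      (∀ x < Γ.I.n, ∀ x' < Γ.I.n, x ≠ x' → Δ < 2 ^ Λ * Γ.I.entry x x') ∧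
      Run Γ ratioCode σ ((Λ + 1) * 300) ((σ.setA 26 0 (2 ^ Λ)).setA 25 0 Λ) := by
  obtain ⟨⟨v, w, hvw, hw, e4⟩, ⟨v', w', hvw', hw', e5⟩, h3⟩ := h
  have hpos : 0 < Γ.I.entry v' w' := by
    rw [entry_client _ (by omega) hw', dist_pos]
    intro h
    have := Γ.I.client.injective h
    simp only [Fin.mk.injEq] at this
    omega
  have hP : ∃ z : ℕ, Γ.I.entry v w < (2 : ℝ) ^ z * Γ.I.entry v' w' := by
    obtain ⟨z, hz⟩ := pow_unbounded_of_one_lt (Γ.I.entry v w / Γ.I.entry v' w')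
      (by norm_num : (1 : ℝ) < 2)
    exact ⟨z, by rwa [div_lt_iff₀ hpos] at hz⟩
  obtain ⟨Λ, h1, h2, r⟩ := run_double (Γ := Γ) (σ := σ) (q := 25) (T := 300)
    (b := ltR (R 4 (.const 0)) (.mul (.cast (glob 26)) (R 5 (.const 0))))
    (P := fun z => Γ.I.entry v w < (2 : ℝ) ^ z * Γ.I.entry v' w') (by norm_num) hP (fun z => by
      rw [holds_ltR]
      simp [e4, e5]) (by decide +kernel)
  have hsw : ∀ x < Γ.I.n, ∀ x' < Γ.I.n, x ≠ x' →
      Γ.I.entry v' w' ≤ Γ.I.entry x x' ∧ Γ.I.entry x x' ≤ Γ.I.entry v w := by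
    intro x hx x' hx' hne
    rw [← e4, ← e5]
    rcases lt_or_gt_of_ne hne with hlt | hlt
    · exact h3 x x' hlt hx' trivial
    · rw [entry_comm]
      exact h3 x' x hlt hx trivial
  refine ⟨Λ, Γ.I.entry v w, ?_, ?_, fun x hx x' hx' => ?_, fun x hx x' hx' hne => ?_, r⟩
  · rcases Λ with _ | Λ
    · have := (hsw v (by omega) w hw (by omega)).1
      norm_num at h1
      linarith
    · omega
  · rcases Λ with _ | Λ
    · have := (hsw v (by omega) w hw (by omega)).1
      norm_num at h1
      linarith
    · have h4 := h2 Λ (by omega)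
      push Not at h4
      push_cast
      exact le_L hvw hw hvw' hw' h4
  · rcases eq_or_ne x x' with rfl | hne
    · rw [entry_self]
      exact entry_nonneg _ _ _
    · exact (hsw x hx x' hx' hne).2
  · exact h1.trans_le (mul_le_mul_of_nonneg_left (hsw x hx x' hx' hne).1 (by positivity))

/-- `ratioPre` computes parameters for which `Λ` halvings bring the maximum distance below the
minimum distance, while `Λ` is at most `L`. -/
theorem run_ratioPre (hα : 1 ≤ Γ.α) (hε : 0 < Γ.ε) (hn : 2 ≤ Γ.I.n) :
    ∃ Λ e ℓ H q K N, Params Γ.I Γ.α Γ.ε Λ e ℓ H q K N ∧ (Λ : ℝ) ≤ Γ.I.L ∧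
      (∃ Δ : ℝ, (∀ x < Γ.I.n, ∀ x' < Γ.I.n, Γ.I.entry x x' ≤ Δ) ∧
        ∀ x < Γ.I.n, ∀ x' < Γ.I.n, x ≠ x' → Δ < 2 ^ Λ * Γ.I.entry x x') ∧
      ∃ σ', Run Γ ratioPre σ (4000 * ((Γ.I.n + 1) * (Γ.I.n + 1) * (N + 1))) σ' ∧
        σ'.a 20 0 = N ∧ σ'.a 21 0 = H ∧ σ'.a 22 0 = q := by
  obtain ⟨σ₁, r1, g⟩ := run_range (σ := σ) hn
  obtain ⟨Λ, Δ, hΛ, hΛL, h1, h2, r2⟩ := run_ratio g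
  obtain ⟨ℓ, hℓ, hℓ', r3⟩ := run_log (Γ := Γ) (σ := (σ₁.setA 26 0 (2 ^ Λ)).setA 25 0 Λ) (by omega)
  obtain ⟨e, heε, he', r4⟩ := run_prec (Γ := Γ) (σ := ((((σ₁.setA 26 0 (2 ^ Λ)).setA 25 0 Λ).setA
    26 0 (2 ^ ℓ)).setA 23 0 ℓ)) hε
  have he : 1 ≤ e := by
    rcases e with _ | e
    · norm_num at heε
    · omega
  obtain ⟨H, q, K, N, hp, ht, σ', r5, h20, h21, h22⟩ := run_param
    (σ := (((((σ₁.setA 26 0 (2 ^ Λ)).setA 25 0 Λ).setA 26 0 (2 ^ ℓ)).setA 23 0 ℓ)).setA 24 0 e)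
    hα he heε he' hℓ hℓ' hΛ (by simp) (by simp) (by simp)
  refine ⟨Λ, e, ℓ, H, q, K, N, hp, hΛL, ⟨Δ, h1, h2⟩, σ',
    (r1.seq (r2.seq (r3.seq (r4.seq r5)))).mono ?_, h20, h21, h22⟩
  set a := (Γ.I.n + 1) * (Γ.I.n + 1) with ha
  have e1 : (Γ.I.n + 1) * ((Γ.I.n + 1) * 700) = 700 * a := by rw [ha]; ring
  have e2 : 1 ≤ a := Nat.mul_pos (by omega) (by omega)
  have e3 : N + 1 ≤ a * (N + 1) := Nat.le_mul_of_pos_left _ e2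
  have e4 : a ≤ a * (N + 1) := Nat.le_mul_of_pos_right _ (by omega)
  omega

/-- `levelPre` computes parameters that are bounded in terms of `α`, `ε` and `n`. -/
theorem run_levelPre (hα : 1 ≤ Γ.α) (hε : 0 < Γ.ε) (hn : 2 ≤ Γ.I.n) :
    ∃ a Λ e ℓ H q K N, Params Γ.I Γ.α Γ.ε Λ e ℓ H q K N ∧ Γ.α ≤ (a : ℕ) ∧ (a : ℝ) ≤ Γ.α + 1 ∧
      Λ = 2 * (14 + a + 2 * ℓ + 3 * e) ∧
      ∃ σ', Run Γ levelPre σ (4000 * ((Γ.I.n + 1) * (Γ.I.n + 1) * (N + 1))) σ' ∧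
        σ'.a 20 0 = N ∧ σ'.a 21 0 = H ∧ σ'.a 22 0 = q := by
  obtain ⟨e, heε, he', r1⟩ := run_prec (Γ := Γ) (σ := σ) hε
  obtain ⟨a, ha, ha', r2⟩ := run_alpha (Γ := Γ) (σ := σ.setA 24 0 e) (by linarith)
  obtain ⟨ℓ, hℓ, hℓ', r3⟩ := run_log (Γ := Γ) (σ := (σ.setA 24 0 e).setA 28 0 a) (by omega)
  have he : 1 ≤ e := by
    rcases e with _ | e
    · norm_num at heε
    · omega
  set Λ := 2 * (14 + a + 2 * ℓ + 3 * e) with hΛ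
  have r4 := Run.putA (Γ := Γ) (σ := (((σ.setA 24 0 e).setA 28 0 a).setA 26 0 (2 ^ ℓ)).setA 23 0 ℓ)
    (q := 25) (i := .const 0) (e := .mul (.const 2) (.add (.add (.add (.const 14) (glob 28))
        (.mul (.const 2) (glob 23))) (.mul (.const 3) (glob 24)))) (by norm_num)
  rw [eval_const, show (NExpr.mul (.const 2) (.add (.add (.add (.const 14) (glob 28))
        (.mul (.const 2) (glob 23))) (.mul (.const 3) (glob 24)))).eval (conc Γ
        ((((σ.setA 24 0 e).setA 28 0 a).setA 26 0 (2 ^ ℓ)).setA 23 0 ℓ)) = Λ by simp [hΛ]] at r4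
  obtain ⟨H, q, K, N, hp, ht, σ', r5, h20, h21, h22⟩ := run_param (Λ := Λ) (e := e)
    (σ := ((((σ.setA 24 0 e).setA 28 0 a).setA 26 0 (2 ^ ℓ)).setA 23 0 ℓ).setA 25 0 Λ)
    hα he heε he' hℓ hℓ' (by omega) (by simp) (by simp) (by simp)
  refine ⟨a, Λ, e, ℓ, H, q, K, N, hp, ha, ha', rfl, σ',
    (Run.ite_neg (by simp; omega) (r1.seq (r2.seq (r3.seq (r4.seq r5))))).mono ?_, h20, h21, h22⟩
  set b := (Γ.I.n + 1) * (Γ.I.n + 1) with hb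
  have e2 : 1 ≤ b := Nat.mul_pos (by omega) (by omega)
  have e3 : N + 1 ≤ b * (N + 1) := Nat.le_mul_of_pos_left _ e2
  have c1 : flat (putA 25 (.const 0) (.mul (.const 2) (.add (.add (.add (.const 14) (glob 28))
        (.mul (.const 2) (glob 23))) (.mul (.const 3) (glob 24))))) +
        (Test.leN nN (.const 1)).size ≤ 200 := by decide +kernel
  omega

/-- For a single client all parameters remain zero. -/
theorem run_levelPre_small (hn : Γ.I.n ≤ 1) :
    Run Γ levelPre σ (4000 * ((Γ.I.n + 1) * (Γ.I.n + 1) * (0 + 1))) σ := by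
  refine (Run.ite_pos (by simpa using hn) Run.skip).mono ?_
  have c1 : (Test.leN nN (.const 1)).size ≤ 200 := by decide +kernel
  have e2 : 1 ≤ (Γ.I.n + 1) * (Γ.I.n + 1) := Nat.mul_pos (by omega) (by omega)
  omega

end Preparation

/-! ### From the deterministic program to the problem -/

/-- The statement draws no random numbers. -/
def drawFree : Stmt → Bool
  | .draw _ => false
  | .seq p q => drawFree p && drawFree q
  | .ite _ p q => drawFree p && drawFree q
  | .while _ p => drawFree p
  | _ => true

/-- The random numbers are irrelevant for a program that does not draw them. -/
theorem exec_tape {α : ℝ} {ω ω' : Tape} {procs : List Stmt} (hp : ∀ p ∈ procs, drawFree p = true)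
    {p : Stmt} {s s' : State} {t : ℕ} (h : Exec α ω procs p s t s') (hd : drawFree p = true) :
    Exec α ω' procs p s t s' := by
  induction h with
  | skip s => exact .skip s
  | setN a e s => exact .setN a e s
  | setR a e s => exact .setR a e s
  | draw a s => simp [drawFree] at hd
  | seq _ _ ih ih' =>
    simp only [drawFree, Bool.and_eq_true] at hd
    exact .seq (ih hd.1) (ih' hd.2)
  | ite_true hb _ ih =>
    simp only [drawFree, Bool.and_eq_true] at hd
    exact .ite_true hb (ih hd.1)
  | ite_false hb _ ih =>
    simp only [drawFree, Bool.and_eq_true] at hd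
    exact .ite_false hb (ih hd.2)
  | while_false hb => exact .while_false hb
  | while_true hb _ _ ih ih' => exact .while_true hb (ih hd) (ih' hd)
  | call hi _ ih => exact .call hi (ih (hp _ (List.mem_of_getElem? hi)))

/-- The main program with suitable parameters solves the problem. It draws no random numbers, so its
cover and the cost of it are the same for all tapes, and the expected cost is this cost. -/
theorem solvedWithin {I : MCCInstance} {α ε T : ℝ} {pre : Stmt} (hd : drawFree pre = true)
    (hm : 1 ≤ I.m) {H q N T₀ : ℕ} {σ₁ : Mem}
    (hpre : Run ⟨I, α, ε, fun _ => 0, [solveProc]⟩ pre ⟨fun _ _ => 0, fun _ _ => 0⟩ T₀ σ₁)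
    (hN : σ₁.a 20 0 = N) (hH : σ₁.a 21 0 = H) (hq : σ₁.a 22 0 = q)
    (hcost : (solve I α H q N (Finset.range I.n)).1 ≤ (1 + ε) * I.opt α)
    (hT : ((T₀ + solveTime I.n I.m H N + (I.n + 1) * 2000 : ℕ) : ℝ) ≤ T) :
    I.SolvedWithin ⟨mainCode pre, [solveProc]⟩ α ε T := by
  have : IsProbabilityMeasure tapeMeasure := by
    unfold tapeMeasure
    infer_instance
  obtain ⟨h1, h2, -⟩ := ballsOf_spec (solve_valid (α := α) (H := H) (q := q) hm N
    (subset_refl (Finset.range I.n)))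
  refine ⟨fun _ => ballsOf I (solve I α H q N (Finset.range I.n)).2, fun ω => ⟨h1, ?_⟩,
    integrable_const _, ?_⟩
  · obtain ⟨t, ht, s, r, ho⟩ := exec_main hm rfl hpre hN hH hq
    refine ⟨t, s, ?_, le_trans (by exact_mod_cast ht) hT, ho⟩
    rw [input_eq I α ε ω [solveProc] hm]
    refine exec_tape (ω := fun _ => 0) (fun p hp => ?_) r ?_
    · rw [List.mem_singleton.1 hp]
      decide +kernel
    · simp only [mainCode, drawFree, hd, Bool.true_and]
      decide +kernel
  · rw [integral_const, probReal_univ, one_smul]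
    exact h2.trans hcost

/-! ### Running times -/

/-- The base of the exponential bound for the running time. -/
def baseTime (n m H : ℕ) : ℕ := 40 * ((m + 1) * ((n + 1) * ((n + 1) * (H + 1))))

/-- The total running time is at most a power of `baseTime`, with two more factors than the
recursion depth. -/
theorem totalTime_le {n m : ℕ} (hn : 1 ≤ n) (hm : 1 ≤ m) (H N : ℕ) :
    4000 * ((n + 1) * (n + 1) * (N + 1)) + solveTime n m H N + (n + 1) * 2000 ≤
      baseTime n m H ^ (N + 2) := by
  unfold solveTime baseTime
  set W := 40 * ((m + 1) * ((n + 1) * ((n + 1) * (H + 1)))) with hW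
  have a1 : ∀ a b : ℕ, b ≤ (a + 1) * b := fun a b => Nat.le_mul_of_pos_left _ (by omega)
  have a2 : ∀ a b : ℕ, b ≤ b * (a + 1) := fun a b => Nat.le_mul_of_pos_right _ (by omega)
  have b1 : (n + 1) * (n + 1) ≤ (m + 1) * ((n + 1) * ((n + 1) * (H + 1))) :=
    (Nat.mul_le_mul_left _ (a2 H (n + 1))).trans (a1 _ _)
  have b2 : (m + 1) * (n + 1) ≤ (m + 1) * ((n + 1) * ((n + 1) * (H + 1))) :=
    Nat.mul_le_mul_left _ ((a2 H (n + 1)).trans (a1 _ _))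
  have b3 : n + 1 ≤ (m + 1) * (n + 1) := a1 _ _
  have b4 : 2 * (2 * 2) ≤ (m + 1) * ((n + 1) * ((n + 1) * (H + 1))) :=
    Nat.mul_le_mul (by omega) (Nat.mul_le_mul (by omega) ((show 2 ≤ n + 1 by omega).trans (a2 _ _)))
  have c1 : 320 ≤ W := by omega
  have d1 : 4000 * ((n + 1) * (n + 1)) ≤ 100 * W := by omega
  have d2 : 2000 * ((m + 1) * (n + 1)) ≤ 50 * W := by omega
  have d3 : (n + 1) * 2000 ≤ 50 * W := by omega
  clear_value W
  have c2 : N + 1 ≤ W ^ N := Nat.lt_pow_self (by omega)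
  have c4 : 4000 * ((n + 1) * (n + 1) * (N + 1)) ≤ 100 * W * W ^ N := by
    rw [← mul_assoc 4000 ((n + 1) * (n + 1))]
    exact Nat.mul_le_mul d1 c2
  have c5 : W ^ N * (2000 * ((m + 1) * (n + 1))) ≤ W ^ N * (50 * W) :=
    Nat.mul_le_mul_left _ d2
  have c6 : (n + 1) * 2000 ≤ 50 * W * W ^ N :=
    d3.trans (Nat.le_mul_of_pos_right _ (by omega))
  calc _ ≤ 100 * W * W ^ N + W ^ N * (50 * W) + 50 * W * W ^ N := by omega
    _ = 200 * (W ^ N * W) := by ring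
    _ ≤ W * (W ^ N * W) := Nat.mul_le_mul_right _ (by omega)
    _ = W ^ (N + 2) := by ring

theorem baseTime_le {n m : ℕ} (hn : 1 ≤ n) (hm : 1 ≤ m) (H : ℕ) :
    (baseTime n m H : ℝ) ≤ 320 * ((m : ℝ) * n) ^ 2 * (H + 1) := by
  have hn' : (1 : ℝ) ≤ n := by exact_mod_cast hn
  have hm' : (1 : ℝ) ≤ m := by exact_mod_cast hm
  have h1 : ((m : ℝ) + 1) ≤ 2 * (m * m) := by nlinarith
  have h2 : ((n : ℝ) + 1) ≤ 2 * n := by linarith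
  unfold baseTime
  push_cast
  calc (40 * (((m : ℝ) + 1) * (((n : ℝ) + 1) * (((n : ℝ) + 1) * ((H : ℝ) + 1)))))
      ≤ 40 * ((2 * (m * m)) * ((2 * n) * ((2 * n) * ((H : ℝ) + 1)))) := by gcongr
    _ = _ := by ring

theorem solve_le_opt {I : MCCInstance} {α ε v : ℝ} (hα : 1 ≤ α) (hm : 1 ≤ I.m) (hε : 0 < ε)
    {δ : ℝ} (hδ : δ ≤ ε) (h : ∀ 𝓑 ⊆ Finset.range I.m ×ˢ Finset.range I.n,
      Covers I 𝓑 (Finset.range I.n) → v ≤ (1 + δ) * pairCost I α 𝓑) : v ≤ (1 + ε) * I.opt α := by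
  refine le_opt hα hm (by linarith) fun 𝓑 h𝓑 hc => (h 𝓑 h𝓑 hc).trans ?_
  have : 0 ≤ pairCost I α 𝓑 := Finset.sum_nonneg fun p _ => Real.rpow_nonneg (sd_nonneg I _ _) _
  gcongr

section Parameters

variable {I : MCCInstance} {α ε : ℝ} {Λ e ℓ H q K N : ℕ}

theorem Params.inv_le (h : Params I α ε Λ e ℓ H q K N) : 1 / (e : ℝ) ≤ ε := by
  have he : (1 : ℝ) ≤ e := by exact_mod_cast h.he
  rw [div_le_iff₀ (by linarith), mul_comm]
  exact h.heε

theorem Params.le_inv (h : Params I α ε Λ e ℓ H q K N) (hε : 0 < ε) :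
    (e : ℝ) ≤ 2 * (1 / min ε 1) := by
  have h1 : 0 < min ε 1 := lt_min hε one_pos
  have h2 : 1 / ε ≤ 1 / min ε 1 := one_div_le_one_div_of_le h1 (min_le_left _ _)
  have h3 : 1 ≤ 1 / min ε 1 := by
    rw [le_div_iff₀ h1]
    simp
  linarith [h.he']

theorem Params.cast_H (h : Params I α ε Λ e ℓ H q K N) : (H : ℝ) = 16 * Λ * e * (ℓ + 1) := by
  rw [h.hH, h.hq]
  push_cast
  ring

theorem Params.one_le_H (h : Params I α ε Λ e ℓ H q K N) : 1 ≤ H := by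
  rw [h.hH, h.hq]
  have := h.hΛ
  have := h.he
  exact Nat.mul_pos (Nat.mul_pos (by omega) (by omega)) (by omega)

/-- The exponent of the running time. -/
theorem Params.exponent_le (h : Params I α ε Λ e ℓ H q K N) (hα : 1 ≤ α) {l X : ℝ} (hl : Λ ≤ l)
    (hX : 16 * (H : ℝ) ≤ X) : ((N + 2 : ℕ) : ℝ) ≤ 6 * l * X ^ α := by
  have hH : (1 : ℝ) ≤ H := by exact_mod_cast h.one_le_H
  have hΛ : (1 : ℝ) ≤ Λ := by exact_mod_cast h.hΛ
  have h1 : (K : ℝ) ≤ X ^ α + 1 := by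
    refine h.hK'.trans ?_
    push_cast
    gcongr
  have h2 : 1 ≤ X ^ α := Real.one_le_rpow (by linarith) (by linarith)
  rw [h.hN]
  push_cast
  have h3 : (Λ : ℝ) * (K + 1) ≤ l * (3 * X ^ α) :=
    mul_le_mul hl (by linarith) (by positivity) (by linarith)
  have h4 : 1 ≤ l * X ^ α := by nlinarith
  linarith

end Parameters

theorem logb_le_self {n : ℕ} (hn : 1 ≤ n) : Real.logb 2 (n : ℝ) ≤ n := by
  rw [Real.logb_le_iff_le_rpow (by norm_num) (by exact_mod_cast hn), Real.rpow_natCast]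
  exact_mod_cast Nat.lt_two_pow_self.le

theorem le_two_rpow {y : ℝ} (hy : 1 ≤ y) : y ≤ 2 ^ y := by
  have := one_add_mul_self_le_rpow_one_add (s := 1) (by norm_num) hy
  norm_num at this
  linarith

/-- With `y = L / min ε 1`, the base is at most `(m * n) ^ (19 * y)` and the exponent is at most `6
* L * (1536 * y * log n) ^ α`, for the binary logarithm. -/
theorem ratioTime_le {I : MCCInstance} {α ε : ℝ} {Λ e ℓ H q K N : ℕ}
    (h : Params I α ε Λ e ℓ H q K N) (hα : 1 ≤ α) (hε : 0 < ε) (hn : 2 ≤ I.n) (hm : 1 ≤ I.m)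
    (hL : (Λ : ℝ) ≤ I.L) : ((baseTime I.n I.m H ^ (N + 2) : ℕ) : ℝ) ≤
      ((I.m : ℝ) * (I.n : ℝ)) ^ ((175104 * (α * I.L ^ 2 * Real.logb 2 (I.n : ℝ) /
        (min ε 1) ^ 2)) ^ α * I.L) := by
  set M : ℝ := (I.m : ℝ) * (I.n : ℝ) with hM
  set lg := Real.logb 2 (I.n : ℝ) with hlg
  set d := min ε 1 with hd
  have hn' : (2 : ℝ) ≤ I.n := by exact_mod_cast hn
  have hm' : (1 : ℝ) ≤ I.m := by exact_mod_cast hm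
  have hM2 : 2 ≤ M := by rw [hM]; nlinarith
  have hΛ : (1 : ℝ) ≤ Λ := by exact_mod_cast h.hΛ
  have hL1 : 1 ≤ I.L := hΛ.trans hL
  have hlg1 : 1 ≤ lg := by
    rw [hlg, Real.le_logb_iff_rpow_le (by norm_num) (by linarith)]
    simpa using hn'
  have hd0 : 0 < d := lt_min hε one_pos
  have hd1 : 1 ≤ 1 / d := by
    rw [le_div_iff₀ hd0]
    simp [hd]
  set y := I.L * (1 / d) with hy
  have hy1 : 1 ≤ y := one_le_mul_of_one_le_of_one_le hL1 hd1
  set x := y * lg with hx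
  have hx1 : 1 ≤ x := one_le_mul_of_one_le_of_one_le hy1 hlg1
  have he := h.le_inv hε
  have hH : (H : ℝ) ≤ 96 * x := by
    rw [h.cast_H]
    have h2 : (ℓ : ℝ) + 1 ≤ 3 * lg := by linarith [h.hℓ']
    calc 16 * (Λ : ℝ) * e * (ℓ + 1) ≤ 16 * I.L * (2 * (1 / d)) * (3 * lg) := by gcongr
      _ = 96 * x := by rw [hx, hy]; ring
  have hexp := h.exponent_le hα hL (X := 1536 * x) (by linarith)
  -- the base of the power
  have hxM : x ≤ M ^ (y + 1) := by
    have h1 : lg ≤ M := (logb_le_self (by omega)).trans (by rw [hM]; nlinarith)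
    have h2 : y ≤ M ^ y := (le_two_rpow hy1).trans
      (Real.rpow_le_rpow (by norm_num) hM2 (by linarith))
    rw [Real.rpow_add (by linarith), Real.rpow_one]
    exact mul_le_mul h2 h1 (by linarith) (by positivity)
  have hbase : (baseTime I.n I.m H : ℝ) ≤ M ^ (19 * y) := by
    have h1 : (31040 : ℝ) ≤ M ^ (15 : ℕ) := by
      calc (31040 : ℝ) ≤ 2 ^ (15 : ℕ) := by norm_num
        _ ≤ M ^ (15 : ℕ) := by gcongr
    calc (baseTime I.n I.m H : ℝ) ≤ 320 * M ^ 2 * (H + 1) := baseTime_le (by omega) hm H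
      _ ≤ 320 * M ^ 2 * (97 * x) := by gcongr; linarith
      _ = 31040 * M ^ 2 * x := by ring
      _ ≤ M ^ (15 : ℕ) * M ^ 2 * M ^ (y + 1) := by gcongr
      _ = M ^ (y + 18) := by
        rw [← pow_add, ← Real.rpow_natCast, ← Real.rpow_add (by linarith)]
        congr 1
        push_cast
        ring
      _ ≤ M ^ (19 * y) := Real.rpow_le_rpow_of_exponent_le (by linarith) (by linarith)
  push_cast
  calc (baseTime I.n I.m H : ℝ) ^ (N + 2) ≤ (M ^ (19 * y)) ^ (N + 2) := by gcongr
    _ = M ^ (19 * y * ((N + 2 : ℕ) : ℝ)) := by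
      rw [Real.rpow_mul (by linarith) (19 * y), Real.rpow_natCast]
    _ ≤ _ := by
      refine Real.rpow_le_rpow_of_exponent_le (by linarith) ?_
      have h1 : 114 * y ≤ (114 * y) ^ α := by
        simpa using Real.rpow_le_rpow_of_exponent_le (by linarith : 1 ≤ 114 * y) hα
      calc 19 * y * ((N + 2 : ℕ) : ℝ) ≤ 19 * y * (6 * I.L * (1536 * x) ^ α) := by gcongr
        _ = 114 * y * (1536 * x) ^ α * I.L := by ring
        _ ≤ (114 * y) ^ α * (1536 * x) ^ α * I.L := by gcongr
        _ = (114 * y * (1536 * x)) ^ α * I.L := by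
          rw [Real.mul_rpow (x := 114 * y) (by linarith) (by linarith)]
        _ ≤ _ := by
          have e1 : 175104 * (α * I.L ^ 2 * lg / d ^ 2) = α * (114 * y * (1536 * x)) := by
            rw [hx, hy]
            field_simp
            norm_num
          rw [e1]
          have h2 : 114 * y * (1536 * x) ≤ α * (114 * y * (1536 * x)) :=
            le_mul_of_one_le_left (by positivity) hα
          gcongr

/-- The factor of the logarithm of the running time that depends on `α` only. -/
def levelConst (α : ℝ) : ℝ := 312 * α * (79872 * α) ^ α * (5003 * α)

theorem forty_le_levelConst {α : ℝ} (hα : 1 ≤ α) : 40 ≤ levelConst α := by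
  have h1 : 1 ≤ (79872 * α) ^ α := Real.one_le_rpow (by linarith) (by linarith)
  have h2 : 312 ≤ 312 * α * (79872 * α) ^ α := by nlinarith
  unfold levelConst
  nlinarith

/-- Up to factors that depend on `α` only, the logarithm of the base is at most `z ^ 3` and the
exponent is at most `z ^ (3 * α + 1)`. -/
theorem levelTime_le {I : MCCInstance} {α ε : ℝ} {a Λ e ℓ H q K N : ℕ}
    (h : Params I α ε Λ e ℓ H q K N) (hα : 1 ≤ α) (hε : 0 < ε) (hn : 2 ≤ I.n) (hm : 1 ≤ I.m)
    (ha : (a : ℝ) ≤ α + 1) (hΛ : Λ = 2 * (14 + a + 2 * ℓ + 3 * e)) {z : ℝ}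
    (hz : z = Real.logb 2 ((I.m : ℝ) * (I.n : ℝ)) / min ε 1) :
    1 ≤ z ∧ ((baseTime I.n I.m H ^ (N + 2) : ℕ) : ℝ) ≤
      2 ^ (levelConst α * z ^ (3 * α + 4)) := by
  set M : ℝ := (I.m : ℝ) * (I.n : ℝ) with hM
  set d := min ε 1 with hd
  have hn' : (2 : ℝ) ≤ I.n := by exact_mod_cast hn
  have hm' : (1 : ℝ) ≤ I.m := by exact_mod_cast hm
  have hM2 : 2 ≤ M := by rw [hM]; nlinarith
  have hd0 : 0 < d := lt_min hε one_pos
  have hd1 : 1 ≤ 1 / d := by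
    rw [le_div_iff₀ hd0]
    simp [hd]
  have hlg1 : 1 ≤ Real.logb 2 M := by
    rw [Real.le_logb_iff_rpow_le (by norm_num) (by linarith)]
    simpa using hM2
  have hz' : z = Real.logb 2 M * (1 / d) := by rw [hz]; ring
  have hlz : Real.logb 2 M ≤ z := by
    rw [hz']
    exact le_mul_of_one_le_right (by linarith) hd1
  have hdz : 1 / d ≤ z := by
    rw [hz']
    exact le_mul_of_one_le_left (by linarith) hlg1
  have hz1 : 1 ≤ z := hlg1.trans hlz
  refine ⟨hz1, ?_⟩
  have hlnz : Real.logb 2 (I.n : ℝ) ≤ z := by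
    refine le_trans ?_ hlz
    refine Real.logb_le_logb_of_le (by norm_num) (by linarith) ?_
    rw [hM]
    nlinarith
  have he : (e : ℝ) ≤ 2 * z := (h.le_inv hε).trans (by linarith)
  have hℓ : (ℓ : ℝ) ≤ z + 1 := h.hℓ'.trans (by linarith)
  have hαz : α ≤ α * z := le_mul_of_one_le_right (by linarith) hz1
  have hzα : z ≤ α * z := le_mul_of_one_le_left (by linarith) hα
  have hΛ' : (Λ : ℝ) ≤ 52 * (α * z) := by
    rw [hΛ]
    push_cast
    linarith
  have hH : (H : ℝ) ≤ 4992 * (α * z ^ 3) := by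
    rw [h.cast_H]
    have h2 : (ℓ : ℝ) + 1 ≤ 3 * z := by linarith
    calc 16 * (Λ : ℝ) * e * (ℓ + 1) ≤ 16 * (52 * (α * z)) * (2 * z) * (3 * z) := by gcongr
      _ = _ := by ring
  have hexp := h.exponent_le hα hΛ' (X := 79872 * α * z ^ 3) (by linarith)
  -- the base of the power
  have hbase : (baseTime I.n I.m H : ℝ) ≤ 2 ^ (5003 * (α * z ^ 3)) := by
    have h1 : M ≤ 2 ^ z := by
      rwa [← Real.logb_le_iff_le_rpow (by norm_num) (by linarith)]
    have h2 : (320 : ℝ) ≤ 2 ^ (9 * z) := by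
      calc (320 : ℝ) ≤ 2 ^ (9 : ℝ) := by norm_num
        _ ≤ 2 ^ (9 * z) := Real.rpow_le_rpow_of_exponent_le (by norm_num) (by linarith)
    have h3 : (H : ℝ) + 1 ≤ 2 ^ (4992 * (α * z ^ 3)) := by
      have : H + 1 ≤ 2 ^ H := Nat.lt_two_pow_self
      calc (H : ℝ) + 1 ≤ 2 ^ (H : ℝ) := by
            rw [Real.rpow_natCast]
            exact_mod_cast this
        _ ≤ _ := Real.rpow_le_rpow_of_exponent_le (by norm_num) hH
    have h4 : z ≤ α * z ^ 3 := by
      refine hzα.trans ?_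
      have : z ≤ z ^ 3 := le_self_pow₀ hz1 (by norm_num)
      gcongr
    calc (baseTime I.n I.m H : ℝ) ≤ 320 * M ^ 2 * (H + 1) := baseTime_le (by omega) hm H
      _ ≤ 2 ^ (9 * z) * (2 ^ z) ^ 2 * 2 ^ (4992 * (α * z ^ 3)) := by gcongr
      _ = 2 ^ (9 * z + (z + z) + 4992 * (α * z ^ 3)) := by
        rw [sq, ← Real.rpow_add (by norm_num), ← Real.rpow_add (by norm_num),
          ← Real.rpow_add (by norm_num)]
      _ ≤ _ := Real.rpow_le_rpow_of_exponent_le (by norm_num) (by linarith)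
  push_cast
  calc (baseTime I.n I.m H : ℝ) ^ (N + 2) ≤ (2 ^ (5003 * (α * z ^ 3))) ^ (N + 2) := by gcongr
    _ = 2 ^ (5003 * (α * z ^ 3) * ((N + 2 : ℕ) : ℝ)) := by
      rw [Real.rpow_mul (by norm_num) (5003 * (α * z ^ 3)), Real.rpow_natCast]
    _ ≤ _ := by
      refine Real.rpow_le_rpow_of_exponent_le (by norm_num) ?_
      have e1 : (79872 * α * z ^ 3) ^ α = (79872 * α) ^ α * z ^ (3 * α) := by
        rw [Real.mul_rpow (by linarith) (by positivity), Real.rpow_mul (by linarith)]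
        norm_num
      have e2 : z ^ (3 * α + 4) = z ^ (3 * α) * z ^ 4 := by
        rw [Real.rpow_add (by linarith)]
        norm_num
      calc 5003 * (α * z ^ 3) * ((N + 2 : ℕ) : ℝ)
          ≤ 5003 * (α * z ^ 3) * (6 * (52 * (α * z)) * (79872 * α * z ^ 3) ^ α) := by gcongr
        _ = levelConst α * z ^ (3 * α + 4) := by
          rw [e1, e2, levelConst]
          ring

/-- For a single client the recursion depth is zero, and the time is polynomial in the number `m` of
servers. -/
theorem levelTime_le_of_le_one {I : MCCInstance} {α ε : ℝ} (hα : 1 ≤ α) (hε : 0 < ε)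
    (hn : I.n = 1) (hm : 1 ≤ I.m) {z : ℝ}
    (hz : z = Real.logb 2 ((I.m : ℝ) * (I.n : ℝ)) / min ε 1) :
    (z = 0 ∨ 1 ≤ z) ∧ ((baseTime I.n I.m 0 ^ (0 + 2) : ℕ) : ℝ) ≤
      320 ^ 2 * 2 ^ (levelConst α * z ^ (3 * α + 4)) := by
  have hm' : (1 : ℝ) ≤ I.m := by exact_mod_cast hm
  have hA := forty_le_levelConst hα
  have hbase := baseTime_le (n := 1) le_rfl hm 0
  have hd0 : 0 < min ε 1 := lt_min hε one_pos
  rw [hn] at hz ⊢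
  rw [Nat.cast_one, mul_one] at hz
  rw [Nat.cast_one, mul_one, Nat.cast_zero, zero_add, mul_one] at hbase
  have hb : ((baseTime 1 I.m 0 ^ (0 + 2) : ℕ) : ℝ) ≤ 320 ^ 2 * (I.m : ℝ) ^ 4 := by
    push_cast
    calc (baseTime 1 I.m 0 : ℝ) ^ (0 + 2) ≤ (320 * (I.m : ℝ) ^ 2) ^ (0 + 2) := by gcongr
      _ = _ := by ring
  have hlm : Real.logb 2 (I.m : ℝ) ≤ z := by
    rw [hz, le_div_iff₀ hd0]
    exact mul_le_of_le_one_right (Real.logb_nonneg (by norm_num) hm') (min_le_right _ _)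
  rcases Nat.lt_or_ge 1 I.m with h2 | h2
  · have h3 : 1 ≤ Real.logb 2 (I.m : ℝ) := by
      rw [Real.le_logb_iff_rpow_le (by norm_num) (by linarith), Real.rpow_one]
      exact_mod_cast h2
    have hz1 : 1 ≤ z := h3.trans hlm
    refine ⟨Or.inr hz1, hb.trans ?_⟩
    have h4 : (I.m : ℝ) ≤ 2 ^ z := by
      rwa [← Real.logb_le_iff_le_rpow (by norm_num) (by linarith)]
    have h5 : z ≤ z ^ (3 * α + 4) := by
      simpa using Real.rpow_le_rpow_of_exponent_le hz1 (by linarith : 1 ≤ 3 * α + 4)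
    have h6 : z * 4 ≤ levelConst α * z ^ (3 * α + 4) := by nlinarith
    gcongr
    calc (I.m : ℝ) ^ 4 ≤ (2 ^ z) ^ 4 := by gcongr
      _ = 2 ^ (z * ((4 : ℕ) : ℝ)) := by rw [Real.rpow_mul (by norm_num), Real.rpow_natCast]
      _ ≤ _ := Real.rpow_le_rpow_of_exponent_le (by norm_num) (by exact_mod_cast h6)
  · have h3 : I.m = 1 := by omega
    have hz0 : z = 0 := by
      rw [hz, h3]
      simp
    refine ⟨Or.inl hz0, hb.trans ?_⟩
    rw [hz0, h3, Real.zero_rpow (by linarith)]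
    norm_num

/-- Exponentials of polynomials are quasi-polynomial bounds with a single constant. -/
theorem exists_quasi {A B : ℝ} (hA : 0 ≤ A) (hB : 0 < B) : ∃ c : ℝ, 0 < c ∧ ∀ z : ℝ,
    (z = 0 ∨ 1 ≤ z) → 320 ^ 2 * (2 : ℝ) ^ (A * z ^ B) ≤ c * 2 ^ (z ^ c) := by
  set c : ℝ := max (320 ^ 2 * 2 ^ (A * 2 ^ B)) (A + 18 + B) with hc
  have hc1 : 320 ^ 2 * (2 : ℝ) ^ (A * 2 ^ B) ≤ c := le_max_left _ _
  have hc2 : A + 18 + B ≤ c := le_max_right _ _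
  have hc3 : (320 : ℝ) ^ 2 ≤ c := le_trans (by
    have : (1 : ℝ) ≤ 2 ^ (A * 2 ^ B) := Real.one_le_rpow (by norm_num) (by positivity)
    linarith) hc1
  have hc0 : 0 < c := by linarith
  refine ⟨c, hc0, ?_⟩
  rintro z (rfl | hz)
  · rw [Real.zero_rpow hB.ne', Real.zero_rpow hc0.ne', mul_zero, Real.rpow_zero]
    linarith
  · rcases le_total z 2 with h2 | h2
    · have h3 : (1 : ℝ) ≤ 2 ^ (z ^ c) := Real.one_le_rpow (by norm_num) (by positivity)
      calc 320 ^ 2 * (2 : ℝ) ^ (A * z ^ B) ≤ 320 ^ 2 * (2 : ℝ) ^ (A * 2 ^ B) := by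
            gcongr
            norm_num
        _ ≤ c := hc1
        _ ≤ c * 2 ^ (z ^ c) := le_mul_of_one_le_right hc0.le h3
    · have h3 : A ≤ z ^ (A + 1) := by
        calc A ≤ 2 ^ (A + 1) := by linarith [le_two_rpow (y := A + 1) (by linarith)]
          _ ≤ z ^ (A + 1) := by gcongr
      have h4 : A * z ^ B ≤ z ^ c := by
        calc A * z ^ B ≤ z ^ (A + 1) * z ^ B := by gcongr
          _ = z ^ (A + 1 + B) := by rw [Real.rpow_add (by linarith) (A + 1)]
          _ ≤ z ^ c := Real.rpow_le_rpow_of_exponent_le hz (by linarith)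
      gcongr
      norm_num

/-! ### The two programs -/

/-- The program whose recursion depth depends on the ratio of the distances. -/
theorem solvedWithin_ratio {I : MCCInstance} {α ε : ℝ} (hα : 1 ≤ α) (hε : 0 < ε) (hn : 2 ≤ I.n)
    (hm : 1 ≤ I.m) : I.SolvedWithin ⟨mainCode ratioPre, [solveProc]⟩ α ε
      (((I.m : ℝ) * (I.n : ℝ)) ^ ((175104 * (α * I.L ^ 2 * Real.logb 2 (I.n : ℝ) /
        (min ε 1) ^ 2)) ^ α * I.L)) := by
  obtain ⟨Λ, e, ℓ, H, q, K, N, hp, hL, ⟨Δ, hΔ, hsep⟩, σ', r, h20, h21, h22⟩ :=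
    run_ratioPre (Γ := ⟨I, α, ε, fun _ => 0, [solveProc]⟩) (σ := ⟨fun _ _ => 0, fun _ _ => 0⟩)
      hα hε hn
  have hn1 : 1 ≤ I.n := by omega
  refine solvedWithin (by decide +kernel) hm r h20 h21 h22 ?_ ?_
  · refine solve_le_opt hα hm hε hp.inv_le fun 𝓑 h𝓑 hc => ?_
    rw [hp.hN]
    exact solve_le_of_ratio hα hm hn1 hp.hΛ hp.he hp.hℓ hp.hq hp.hH hp.hK hΔ hsep h𝓑 hc
  · exact le_trans (Nat.cast_le.2 (totalTime_le hn1 hm H N))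
      (ratioTime_le hp hα hε hn hm hL)

/-- The program whose recursion depth does not depend on the distances. Its running time is stated
in a form from which `exists_quasi` removes the polynomial. -/
theorem solvedWithin_level {I : MCCInstance} {α ε : ℝ} (hα : 1 ≤ α) (hε : 0 < ε) (hn : 1 ≤ I.n)
    (hm : 1 ≤ I.m) {z : ℝ} (hz : z = Real.logb 2 ((I.m : ℝ) * (I.n : ℝ)) / min ε 1) :
    (z = 0 ∨ 1 ≤ z) ∧ I.SolvedWithin ⟨mainCode levelPre, [solveProc]⟩ α ε
      (320 ^ 2 * 2 ^ (levelConst α * z ^ (3 * α + 4))) := by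
  rcases Nat.lt_or_ge 1 I.n with h2 | h2
  · obtain ⟨a, Λ, e, ℓ, H, q, K, N, hp, ha, ha', hΛ, σ', r, h20, h21, h22⟩ :=
      run_levelPre (Γ := ⟨I, α, ε, fun _ => 0, [solveProc]⟩) (σ := ⟨fun _ _ => 0, fun _ _ => 0⟩)
        hα hε h2
    obtain ⟨hz1, ht⟩ := levelTime_le hp hα hε h2 hm ha' hΛ hz
    refine ⟨Or.inr hz1, solvedWithin (by decide +kernel) hm r h20 h21 h22 ?_ ?_⟩
    · refine solve_le_opt hα hm hε hp.inv_le fun 𝓑 h𝓑 hc => ?_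
      rw [hp.hN]
      exact solve_le_of_levels hα hm hn hp.he ha hp.hℓ hΛ hp.hq hp.hH hp.hK h𝓑 hc
    · refine le_trans (Nat.cast_le.2 (totalTime_le hn hm H N)) (ht.trans ?_)
      exact le_mul_of_one_le_left (by positivity) (by norm_num)
  · obtain ⟨hz1, ht⟩ := levelTime_le_of_le_one (z := z) hα hε (by omega) hm hz
    refine ⟨hz1, solvedWithin (N := 0) (H := 0) (q := 0) (by decide +kernel) hm
      (run_levelPre_small h2) rfl rfl rfl ?_ ?_⟩
    · refine solve_le_opt hα hm hε hε.le fun 𝓑 h𝓑 hc => ?_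
      rw [add_zero, one_mul]
      exact solve_zero_le hα hm h2 h𝓑 hc
    · exact le_trans (Nat.cast_le.2 (totalTime_le hn hm 0 0)) ht

end CoverAlg

end

theorem mainTheorem2 :
    (∃ (P : RealRAM.Program) (C : ℝ), 0 < C ∧
      ∀ α : ℝ, 1 ≤ α → ∀ ε : ℝ, 0 < ε → ∀ I : MCCInstance, 2 ≤ I.n → 1 ≤ I.m →
        I.SolvedWithin P α ε
          (((I.m : ℝ) * (I.n : ℝ)) ^
            ((C * (α * I.L ^ 2 * Real.logb 2 (I.n : ℝ) / (min ε 1) ^ 2)) ^ α * I.L))) ∧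
    (∃ P : RealRAM.Program, ∀ α : ℝ, 1 ≤ α → ∃ c : ℝ, 0 < c ∧
      ∀ ε : ℝ, 0 < ε → ∀ I : MCCInstance, 1 ≤ I.n → 1 ≤ I.m →
        I.SolvedWithin P α ε
          (c * (2 : ℝ) ^ ((Real.logb 2 ((I.m : ℝ) * (I.n : ℝ)) / min ε 1) ^ c))) := by
  refine ⟨⟨⟨CoverAlg.mainCode CoverAlg.ratioPre, [CoverAlg.solveProc]⟩, 175104, by norm_num,
    fun α hα ε hε I hn hm => CoverAlg.solvedWithin_ratio hα hε hn hm⟩,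
    ⟨⟨CoverAlg.mainCode CoverAlg.levelPre, [CoverAlg.solveProc]⟩, fun α hα => ?_⟩⟩
  · obtain ⟨c, hc, h⟩ := CoverAlg.exists_quasi (A := CoverAlg.levelConst α) (B := 3 * α + 4)
      (by linarith [CoverAlg.forty_le_levelConst hα]) (by linarith)
    refine ⟨c, hc, fun ε hε I hn hm => ?_⟩
    obtain ⟨hz, B, h1, h2⟩ := CoverAlg.solvedWithin_level hα hε hn hm rfl
    refine ⟨B, fun ω => ⟨(h1 ω).1, ?_⟩, h2⟩
    obtain ⟨t, s, e1, e2, e3⟩ := (h1 ω).2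
    exact ⟨t, s, e1, e2.trans (h _ hz), e3⟩
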